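/- **Combinatorial tilings.** A *combinatorial tiling* is a 2-dimensional CW-complex $L$ homeomorphic to the plane; here all its closed 2-cells (*tiles*) are pentagons. $L_{\mathrm{aff}}$ denotes $L$ with each tile identified with a Euclidean regular pentagon of edge length $1$ (these pentagons being pasted together isometrically along edges in the pattern of $L$), and with the metric $d_L(x,y)$ given by the length of a shortest path from $x$ to $y$. Write $B(x,r,L)=\{y\in L : d_L(x,y)\le r\}$. A *patch* is a finite set of tiles (or their union). **The tiling $K$.** The subdivision $\omega$ of a pentagonal complex divides every pentagon with corners $c_0,\dots,c_4$ into six pentagons: with $m_i$ the midpoint of the side $c_ic_{i+1}$ (indices mod $5$), one introduces a central pentagon $q_0q_1q_2q_3q_4$, joins each $q_i$ to $m_i$ by an edge, and obtains besides the central pentagon the five pentagons $c_i m_i q_i q_{i-1} m_{i-1}$. Let $K_0$ be one pentagon, $K_n=\omega^n(K_0)$, let $\iota_0:K_0\to K_1$ be the embedding onto the central pentagon and $\iota_{n+1}=\omega(\iota_n):K_{n+1}\to K_{n+2}$, and let $K=\varinjlim K_n$ along the embeddings $\iota_n$. Let the tiles of $K$ be decorated in any way that uses only finitely many different decorated pentagons,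 where a decoration of a tile is a colouring of its points. All combinatorial tilings $L$ below are decorated. **The hull.** $L$ is *locally isomorphic* to $K$ if for every patch $P$ of $L$ there are a patch $Q$ of $K$ and a cell-preserving isomorphism $P\to Q$, isometric on tiles, that preserves decorations. Let $$\Omega=\{[L,x] : L \text{ a combinatorial tiling locally isomorphic to } K,\ x\in L_{\mathrm{aff}}\},$$ where $[L,x]=[L',x']$ if and only if there is a bijection $L_{\mathrm{aff}}\to L'_{\mathrm{aff}}$ that is cell-preserving, decoration-preserving, isometric on each cell, and maps $x$ to $x'$. Define $$d([L,x],[L',x'])=\min\bigl(\tfrac1{\sqrt2},\inf\Lambda\bigr),\qquad \inf\emptyset=+\infty,$$ where $\Lambda$ is the set of those $\varepsilon>0$ for which there exist maps $$\phi:B(x,1/\varepsilon,L)\to L',\quad d_{L'}(\phi(x),x')\le\varepsilon,\qquad \phi':B(x',1/\varepsilon,L')\to L,\quad d_{L}(\phi'(x'),x)\le\varepsilon,$$ that are isometries (for $d_L$ and $d_{L'}$), are cell-preserving (on each tile that meets the ball, the map is the restriction of an isometry onto a tile), and preserve the decorations of these tiles and the degrees of the vertices in the ball. **Theorem.** $d$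 is a metric on $\Omega$, and the metric space $(\Omega,d)$ is compact. -/

import Mathlib

open scoped unitInterval

noncomputable section

/-! ### The Euclidean regular pentagon of edge length one -/

/-- The `i`-th corner of the regular pentagon with edge length one centred at `0`
(circumradius `1 / (2 sin (π / 5))`), in counterclockwise order. -/
def corner (i : ZMod 5) : ℂ :=
  ((1 / (2 * Real.sin (Real.pi / 5)) : ℝ) : ℂ) *
    Complex.exp (((2 * Real.pi * (i.val : ℝ) / 5 : ℝ) : ℂ) * Complex.I)

/-- The closed regular pentagon with edge length one, with its Euclidean metric. -/
def pentagon : Set ℂ := convexHull ℝ (Set.range corner)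

theorem corner_mem (i : ZMod 5) : corner i ∈ pentagon :=
  subset_convexHull ℝ _ ⟨i, rfl⟩

/-- The `i`-th corner as a point of the pentagon. -/
def cornerPt (i : ZMod 5) : pentagon := ⟨corner i, corner_mem i⟩

/-- The arclength parametrization of the `i`-th side, from corner `i` to corner `i + 1`. -/
def sidePt (i : ZMod 5) (s : I) : pentagon :=
  ⟨AffineMap.lineMap (corner i) (corner (i + 1)) (s : ℝ),
    (convex_convexHull ℝ _).lineMap_mem (corner_mem i) (corner_mem (i + 1)) s.2⟩

/-! ### Pentagonal complexes and their piecewise affine realization -/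

/-- The combinatorial pattern of a two-dimensional complex all of whose faces are pentagons: a set
of tiles, each with its sides cyclically numbered by `ZMod 5`, and a relation saying which sides are
glued. `Glued t i t' j` means that side `i` of `t` is glued to side `j` of `t'` such that corner `i`
of `t` becomes corner `j + 1` of `t'` and corner `i + 1` of `t` becomes corner `j` of `t'`
(as the plane is orientable, the tiles of a plane complex can be numbered so that all gluings have
this form). -/
structure PentComplex where
  Tile : Type
  Glued : Tile → ZMod 5 → Tile → ZMod 5 → Prop

namespace PentComplex

/-- The elementary identifications of boundary points of the tiles. -/
inductive GlueRel (L : PentComplex) :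
    (Σ _ : L.Tile, pentagon) → (Σ _ : L.Tile, pentagon) → Prop
  | glue (t : L.Tile) (i : ZMod 5) (t' : L.Tile) (j : ZMod 5) (s : I) (h : L.Glued t i t' j) :
      GlueRel L ⟨t, sidePt i s⟩ ⟨t', sidePt j (unitInterval.symm s)⟩

/-- The complex itself: regular unit pentagons, one for each tile, pasted together in the
given pattern. -/
def Realization (L : PentComplex) : Type := Quot L.GlueRel

/-- The CW topology: the quotient of the disjoint union of the closed tiles. -/
instance (L : PentComplex) : TopologicalSpace L.Realization :=
  inferInstanceAs (TopologicalSpace (Quot L.GlueRel))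

/-- The characteristic map of the tile `t`. -/
def pt (L : PentComplex) (t : L.Tile) (p : pentagon) : L.Realization := Quot.mk _ ⟨t, p⟩

/-- `PolyPath x y r`: there is a path of length `r` from `x` to `y` that is a finite
concatenation of straight segments, each one inside a (closed) tile. -/
inductive PolyPath (L : PentComplex) : L.Realization → L.Realization → ℝ → Prop
  | nil (x : L.Realization) : PolyPath L x x 0
  | cons (t : L.Tile) (p q : pentagon) (y : L.Realization) (r : ℝ)
      (h : PolyPath L (L.pt t q) y r) : PolyPath L (L.pt t p) y (dist p q + r)

/-- The metric of the piecewise affine structure: the least length of a path. -/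
def affDist (L : PentComplex) (x y : L.Realization) : ℝ := sInf {r | L.PolyPath x y r}

/-- The closed balls of that metric. -/
def ball (L : PentComplex) (x : L.Realization) (r : ℝ) : Set L.Realization :=
  {y | L.affDist x y ≤ r}

/-- The `i`-th edge of the tile `t`, as a set of points. -/
def edge (L : PentComplex) (t : L.Tile) (i : ZMod 5) : Set L.Realization :=
  Set.range fun s : I => L.pt t (sidePt i s)

/-- A point is a vertex if it is a corner of some tile. -/
def IsVertex (L : PentComplex) (v : L.Realization) : Prop :=
  ∃ t i, v = L.pt t (cornerPt i)

/-- The degree of a vertex: the number of edges at it. -/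
def degree (L : PentComplex) (v : L.Realization) : ℕ :=
  {e : Set L.Realization | (∃ t i, e = L.edge t i) ∧ v ∈ e}.ncard

/-- A combinatorial tiling: the complex is homeomorphic to the plane. -/
def IsTiling (L : PentComplex) : Prop :=
  Nonempty (L.Realization ≃ₜ EuclideanSpace ℝ (Fin 2))

/-! ### The subdivision and the combinatorial pentagonal tiling -/

/-- The gluings of the subdivided complex. A tile `t` with corners `c i` is divided into six
pentagons, using the midpoints `m i` of its sides (`m i` between `c i` and `c (i + 1)`) and the
corners `q i` of a central pentagon, where `q i` is joined to `m i`: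
* `(t, none)` is the central pentagon, with corners `q 0, …, q 4` in this order;
* `(t, some i)` is the pentagon at `c i`, with corners `c i, m i, q i, q (i - 1), m (i - 1)`
  in this order. -/
inductive SubGlued (L : PentComplex) : L.Tile × Option (ZMod 5) → ZMod 5 →
    L.Tile × Option (ZMod 5) → ZMod 5 → Prop
  /-- the side from `q i` to `q (i + 1)` -/
  | central (t : L.Tile) (i : ZMod 5) : SubGlued L (t, none) i (t, some (i + 1)) 2
  /-- the side from `m i` to `q i` -/
  | spoke (t : L.Tile) (i : ZMod 5) : SubGlued L (t, some i) 1 (t, some (i + 1)) 3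
  /-- the half of side `i` of `t` at `c i` -/
  | firstHalf (t : L.Tile) (i : ZMod 5) (t' : L.Tile) (j : ZMod 5) (h : L.Glued t i t' j) :
      SubGlued L (t, some i) 0 (t', some (j + 1)) 4
  /-- the half of side `i` of `t` at `c (i + 1)` -/
  | secondHalf (t : L.Tile) (i : ZMod 5) (t' : L.Tile) (j : ZMod 5) (h : L.Glued t i t' j) :
      SubGlued L (t, some (i + 1)) 4 (t', some j) 0

/-- The subdivision `ω(L)`: every tile is replaced with six pentagons, every edge with two. -/
def subdivide (L : PentComplex) : PentComplex where
  Tile := L.Tile × Option (ZMod 5)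
  Glued := L.SubGlued

/-- `K_n = ω^n(K_0)`, where `K_0` is a single pentagon. -/
def supertile : ℕ → PentComplex
  | 0 => { Tile := Unit, Glued := fun _ _ _ _ => False }
  | n + 1 => (supertile n).subdivide

/-- The embedding `ι_n : K_n → K_{n+1}` on tiles: `ι_0` maps the pentagon to the central pentagon
of `K_1`, with the same numbering of the sides, and `ι_{n+1} = ω(ι_n)`. In particular central
pentagons are mapped to central pentagons. -/
def iota : (n : ℕ) → (supertile n).Tile → (supertile (n + 1)).Tile
  | 0, t => (t, none)
  | n + 1, (t, c) => (iota n t, c)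

/-- The identification of a tile of `K_n` with its image in `K_{n+1}`. -/
inductive LimRel : (Σ n, (supertile n).Tile) → (Σ n, (supertile n).Tile) → Prop
  | step (n : ℕ) (t : (supertile n).Tile) : LimRel ⟨n, t⟩ ⟨n + 1, iota n t⟩

/-- The combinatorial pentagonal tiling `K`, the direct limit of the `K_n` along the `ι_n`. -/
def tilingK : PentComplex where
  Tile := Quot LimRel
  Glued := fun a i b j => ∃ (n : ℕ) (t t' : (supertile n).Tile),
    (supertile n).Glued t i t' j ∧ a = Quot.mk _ ⟨n, t⟩ ∧ b = Quot.mk _ ⟨n, t'⟩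

end PentComplex

/-! ### Decorated complexes, isomorphisms, local isomorphism -/

/-- A complex with a decoration: a picture (a colouring of the points of the pentagon, with colours
in `A`) is drawn on every tile. -/
structure DecComplex (A : Type) extends PentComplex where
  deco : Tile → pentagon → A

namespace DecComplex

variable {A : Type}

/-- The map `φ` maps the tile `t` isometrically onto the tile `t'` and carries the
decoration of `t` to that of `t'`. -/
def MapsTile (L L' : DecComplex A) (φ : L.Realization → L'.Realization)
    (t : L.Tile) (t' : L'.Tile) : Prop :=
  ∃ g : pentagon ≃ᵢ pentagon, ∀ p,
    φ (L.pt t p) = L'.pt t' (g p) ∧ L'.deco t' (g p) = L.deco t p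

/-- The union of the tiles of a patch. -/
def support (L : DecComplex A) (P : Finset L.Tile) : Set L.Realization :=
  {x | ∃ t ∈ P, ∃ p, x = L.pt t p}

/-- Two patches are isomorphic: there is a bijection between them that maps tiles isometrically
onto tiles (hence cells onto cells) and preserves the decorations. -/
def PatchIso (L L' : DecComplex A) (P : Finset L.Tile) (Q : Finset L'.Tile) : Prop :=
  ∃ φ : L.Realization → L'.Realization,
    Set.BijOn φ (L.support P) (L'.support Q) ∧
    (∀ t ∈ P, ∃ t' ∈ Q, L.MapsTile L' φ t t') ∧
    (∀ t' ∈ Q, ∃ t ∈ P, L.MapsTile L' φ t t')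

/-- `L` is locally isomorphic to `K`: every patch of `L` is isomorphic to a patch of `K`. -/
def LocallyIsomorphic (L K : DecComplex A) : Prop :=
  ∀ P : Finset L.Tile, ∃ Q : Finset K.Tile, L.PatchIso K P Q

/-- The admissible maps `B(x, 1/ε, L) → L'`: isometries for the metrics of `L` and `L'`, which are
cell-preserving (the restriction to a tile that meets the ball extends to an isometry onto a tile
of `L'`), preserve the decorations of these tiles and the degrees of the vertices, and move `x` to a
point within distance `ε` of `x'`. -/
def NearMap (L L' : DecComplex A) (x : L.Realization) (x' : L'.Realization) (ε : ℝ) : Prop :=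
  ∃ φ : L.Realization → L'.Realization,
    (∀ y ∈ L.ball x (1 / ε), ∀ z ∈ L.ball x (1 / ε), L'.affDist (φ y) (φ z) = L.affDist y z) ∧
    (∀ t : L.Tile, (∃ p, L.pt t p ∈ L.ball x (1 / ε)) →
      ∃ (t' : L'.Tile) (g : pentagon ≃ᵢ pentagon),
        (∀ p, L.pt t p ∈ L.ball x (1 / ε) → φ (L.pt t p) = L'.pt t' (g p)) ∧
        (∀ p, L'.deco t' (g p) = L.deco t p)) ∧
    (∀ v ∈ L.ball x (1 / ε), L.IsVertex v → L'.degree (φ v) = L.degree v) ∧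
    L'.affDist (φ x) x' ≤ ε

end DecComplex

/-! ### The continuous hull -/

/-- A (decorated) combinatorial tiling locally isomorphic to `K`, with a point of it. -/
structure PointedTiling {A : Type} (K : DecComplex A) where
  L : DecComplex A
  isTiling : L.IsTiling
  locIso : L.LocallyIsomorphic K
  x : L.Realization

namespace PointedTiling

variable {A : Type} {K : DecComplex A}

/-- Pointed tilings are isomorphic if there is a bijection between them that maps, in both
directions, tiles isometrically onto tiles and preserves the decorations, and that
maps the one point to the other. -/
def Iso (a b : PointedTiling K) : Prop :=
  ∃ φ : a.L.Realization ≃ b.L.Realization,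
    (∀ t, ∃ t', a.L.MapsTile b.L φ t t') ∧ (∀ t', ∃ t, b.L.MapsTile a.L φ.symm t' t) ∧
    φ a.x = b.x

theorem Iso.refl (a : PointedTiling K) : Iso a a :=
  ⟨Equiv.refl _, fun t => ⟨t, IsometryEquiv.refl _, fun _ => ⟨rfl, rfl⟩⟩,
    fun t => ⟨t, IsometryEquiv.refl _, fun _ => ⟨rfl, rfl⟩⟩, rfl⟩

theorem Iso.symm {a b : PointedTiling K} : Iso a b → Iso b a := by
  rintro ⟨φ, h1, h2, h3⟩
  exact ⟨φ.symm, h2, h1, by rw [← h3, Equiv.symm_apply_apply]⟩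

theorem mapsTile_trans {L L' L'' : DecComplex A} {φ : L.Realization → L'.Realization}
    {ψ : L'.Realization → L''.Realization} {t : L.Tile} {t' : L'.Tile} {t'' : L''.Tile}
    (h : L.MapsTile L' φ t t') (h' : L'.MapsTile L'' ψ t' t'') :
    L.MapsTile L'' (ψ ∘ φ) t t'' := by
  obtain ⟨g, hg⟩ := h
  obtain ⟨g', hg'⟩ := h'
  refine ⟨g.trans g', fun p => ⟨?_, ?_⟩⟩
  · simp [(hg p).1, (hg' (g p)).1]
  · simp [(hg p).2, (hg' (g p)).2]

theorem Iso.trans {a b c : PointedTiling K} : Iso a b → Iso b c → Iso a c := by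
  rintro ⟨φ, h1, h2, h3⟩ ⟨ψ, k1, k2, k3⟩
  refine ⟨φ.trans ψ, fun t => ?_, fun t => ?_, by simp [h3, k3]⟩
  · obtain ⟨t', ht'⟩ := h1 t
    obtain ⟨t'', ht''⟩ := k1 t'
    have h := mapsTile_trans ht' ht''
    exact ⟨t'', h⟩
  · obtain ⟨t', ht'⟩ := k2 t
    obtain ⟨t'', ht''⟩ := h2 t'
    have h := mapsTile_trans ht' ht''
    exact ⟨t'', h⟩

instance isoSetoid (K : DecComplex A) : Setoid (PointedTiling K) :=
  ⟨Iso, Iso.refl, Iso.symm, Iso.trans⟩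

end PointedTiling

/-- The continuous hull `Ω` of `K`: the isomorphism classes `[L, x]` of pointed tilings. -/
def ContinuousHull {A : Type} (K : DecComplex A) : Type 1 :=
  Quotient (PointedTiling.isoSetoid K)

/-- The set `Λ` of a pair of elements `[L, x]`, `[L', x']` of the hull (the condition does not
depend on the representatives). -/
def hullLambda {A : Type} {K : DecComplex A} (a b : ContinuousHull K) : Set ℝ :=
  {ε | 0 < ε ∧ ∃ u v : PointedTiling K,
    Quotient.mk (PointedTiling.isoSetoid K) u = a ∧
    Quotient.mk (PointedTiling.isoSetoid K) v = b ∧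
    u.L.NearMap v.L u.x v.x ε ∧ v.L.NearMap u.L v.x u.x ε}

/-- `d([L, x], [L', x']) = min (1/√2, inf Λ)`, where the infimum of the empty set is `+∞`. -/
def hullDist {A : Type} {K : DecComplex A} (a b : ContinuousHull K) : ℝ :=
  sInf (insert (1 / Real.sqrt 2) (hullLambda a b))

/-- The combinatorial pentagonal tiling `K` with the decoration `deco`. -/
def decoratedK {A : Type} (deco : PentComplex.tilingK.Tile → pentagon → A) : DecComplex A where
  toPentComplex := PentComplex.tilingK
  deco := deco

end

open scoped unitInterval

noncomputable section

/-! ### Geometry of the regular pentagon -/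

namespace Pentagon

/-! Tilings locally isomorphic to `K` inherit its local combinatorics: sides are glued in pairs, the
corners of a tile are distinct, two tiles have at most two common vertices, and a vertex has at most
four corners (`Regular`). This is proved for the `K_n` by induction on the subdivision, for `K` by
passing to the limit, and for `L` by embedding its patches (`Regular.of_tileEmb`). A complex
homeomorphic to the plane is moreover connected and has no free side (`IsTiling.chained`,
`Regular.complete_of_homeomorph`). Hence combinatorial balls are finite, and an embedding of a large
ball is an admissible map on a slightly smaller metric ball (`DecEmb.near`).

Metric. Admissible maps compose, and below the cap 1/√2 the radii of the balls fit together; this is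
the triangle inequality (`add_mem_hullLambda`). If the distance is zero, there are admissible maps
on balls of every radius. Each tile has only finitely many possible images, so an ultrafilter
selects a limit map, and this is an isomorphism (`iso_of_forall_near`).

Compactness. A sequence of pointed tilings has a limit along a nonprincipal ultrafilter: its tiles
are sequences of tiles at bounded combinatorial distance from the base tiles, up to equality almost
everywhere, and sides are glued if they are glued almost everywhere. Finite patches of the limit
embed into almost all terms (`ultraLimit_tileEmb`). So the limit is locally isomorphic to `K`, its
large balls agree with balls of the terms, and this is convergence (`exists_eventually_nearMap`).
The decorations converge because there are finitely many of them, the positions of the base points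
because the pentagon is compact.

The main difficulty is that the limit has to be homeomorphic to the plane. By the self-similarity of
`K`, every ball of radius `r` lies in the star of one vertex of the supertiles of some order that
depends only on `r` (`exists_supertile_star`). The open star of a vertex is an open disc, so every
ball lies in an open cell that is itself contained in a ball of controlled radius (`exists_cell`).
This is a statement about finite patches and passes to the limit (`exists_cell_of_tileEmb`). The
limit is therefore an increasing union of open cells, and by engulfing such a union is again an open
cell (`nonempty_homeomorph_of_iUnion`). -/

theorem zmod_five_cases (k : ZMod 5) : k = 0 ∨ k = 1 ∨ k = 2 ∨ k = 3 ∨ k = 4 := by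
  revert k; decide

/-- The inner products of the corners, as a function of the difference of their indices. -/
def cornerInner : ZMod 5 → ℝ :=
  ![(5 + √5) / 10, √5 / 10, -(5 + 3 * √5) / 20, -(5 + 3 * √5) / 20, √5 / 10]

theorem cos_two_pi_div_five : Real.cos (2 * Real.pi / 5) = (√5 - 1) / 4 := by
  have h := Real.cos_two_mul (Real.pi / 5)
  rw [Real.cos_pi_div_five] at h
  have h5 : √5 ^ 2 = 5 := Real.sq_sqrt (by norm_num)
  rw [show 2 * Real.pi / 5 = 2 * (Real.pi / 5) by ring, h]
  nlinarith

theorem cos_four_pi_div_five : Real.cos (4 * Real.pi / 5) = -(√5 + 1) / 4 := by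
  rw [show 4 * Real.pi / 5 = Real.pi - Real.pi / 5 by ring, Real.cos_pi_sub,
    Real.cos_pi_div_five]
  ring

theorem circumradius_sq : (1 / (2 * Real.sin (Real.pi / 5))) ^ 2 = (5 + √5) / 10 := by
  have h := Real.sin_sq (Real.pi / 5)
  rw [Real.cos_pi_div_five] at h
  have h5 : √5 ^ 2 = 5 := Real.sq_sqrt (by norm_num)
  have h6 : √5 < 3 := by nlinarith [Real.sqrt_nonneg 5]
  have : Real.sin (Real.pi / 5) ^ 2 = (5 - √5) / 8 := by rw [h]; nlinarith
  rw [div_pow, mul_pow, this, one_pow, div_eq_div_iff (by nlinarith) (by norm_num)]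
  nlinarith

/-- The inner product is the squared circumradius times the cosine of the angle between the corners.
The representatives `i.val` and `j.val` differ by an integer from -4 to 4, which leaves nine
cosines. -/
theorem inner_corner (i j : ZMod 5) : inner ℝ (corner i) (corner j) = cornerInner (j - i) := by
  have key : ∀ a b : ℝ, inner ℝ (((1 / (2 * Real.sin (Real.pi / 5)) : ℝ) : ℂ) * Complex.exp ((a : ℝ) * Complex.I))
      (((1 / (2 * Real.sin (Real.pi / 5)) : ℝ) : ℂ) * Complex.exp ((b : ℝ) * Complex.I)) =
      (5 + √5) / 10 * Real.cos (b - a) := by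
    intro a b
    rw [← circumradius_sq, Complex.inner, map_mul, Complex.conj_ofReal, ← Complex.exp_conj, map_mul, Complex.conj_ofReal,
      Complex.conj_I, mul_mul_mul_comm, ← Complex.exp_add, ← Complex.ofReal_mul, Complex.re_ofReal_mul,
      show (b : ℂ) * Complex.I + a * -Complex.I = ((b - a : ℝ) : ℂ) * Complex.I by push_cast; ring, Complex.exp_ofReal_mul_I_re]
    ring
  have h5 : √5 ^ 2 = 5 := Real.sq_sqrt (by norm_num)
  have c0 := Real.cos_zero
  have c1 := cos_two_pi_div_five
  have c2 := cos_four_pi_div_five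
  have c3 : Real.cos (6 * Real.pi / 5) = -(√5 + 1) / 4 := by
    rw [← c2, ← Real.cos_two_pi_sub]; congr 1; ring
  have c4 : Real.cos (8 * Real.pi / 5) = (√5 - 1) / 4 := by
    rw [← c1, ← Real.cos_two_pi_sub]; congr 1; ring
  have d1 : Real.cos (-(2 * Real.pi / 5)) = (√5 - 1) / 4 := by rw [Real.cos_neg, c1]
  have d2 : Real.cos (-(4 * Real.pi / 5)) = -(√5 + 1) / 4 := by rw [Real.cos_neg, c2]
  have d3 : Real.cos (-(6 * Real.pi / 5)) = -(√5 + 1) / 4 := by rw [Real.cos_neg, c3]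
  have d4 : Real.cos (-(8 * Real.pi / 5)) = (√5 - 1) / 4 := by rw [Real.cos_neg, c4]
  have e0 : (5 + √5) / 10 * 1 = cornerInner 0 := by simp [cornerInner]
  have e1 : (5 + √5) / 10 * ((√5 - 1) / 4) = cornerInner 1 := by
    simp [cornerInner]; nlinarith
  have e2 : (5 + √5) / 10 * (-(√5 + 1) / 4) = cornerInner 2 := by
    change _ = -(5 + 3 * √5) / 20; nlinarith
  have key2 : ∀ (k : ℤ) (x : ℝ), Real.cos (2 * Real.pi * k / 5) = x →
      ((j.val : ℤ) - i.val = k) → (5 + √5) / 10 * x = cornerInner (k : ℤ) →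
      inner ℝ (corner i) (corner j) = cornerInner (j - i) := by
    intro k x hx hk hc
    have : (j - i : ZMod 5) = (k : ℤ) := by
      rw [← hk]; push_cast; rw [ZMod.natCast_zmod_val, ZMod.natCast_zmod_val]
    rw [corner, corner, key, this, ← hc, ← hx, ← hk]
    congr 2; push_cast; ring
  have hi := ZMod.val_lt i
  have hj := ZMod.val_lt j
  have hk : ∃ k : ℤ, (j.val : ℤ) - i.val = k := ⟨_, rfl⟩
  obtain ⟨k, hk⟩ := hk
  have hk1 : -5 < k := by omega
  have hk2 : k < 5 := by omega
  interval_cases k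
  · exact key2 (-4) ((√5 - 1) / 4) (by rw [← d4]; congr 1; push_cast; ring) hk (by rw [e1]; rfl)
  · exact key2 (-3) (-(√5 + 1) / 4) (by rw [← d3]; congr 1; push_cast; ring) hk (by rw [e2]; rfl)
  · exact key2 (-2) (-(√5 + 1) / 4) (by rw [← d2]; congr 1; push_cast; ring) hk (by rw [e2]; rfl)
  · exact key2 (-1) ((√5 - 1) / 4) (by rw [← d1]; congr 1; push_cast; ring) hk (by rw [e1]; rfl)
  · exact key2 (0) 1 (by rw [← c0]; congr 1; push_cast; ring) hk (by rw [e0]; rfl)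
  · exact key2 (1) ((√5 - 1) / 4) (by rw [← c1]; congr 1; push_cast; ring) hk (by rw [e1]; rfl)
  · exact key2 (2) (-(√5 + 1) / 4) (by rw [← c2]; congr 1; push_cast; ring) hk (by rw [e2]; rfl)
  · exact key2 (3) (-(√5 + 1) / 4) (by rw [← c3]; congr 1; push_cast; ring) hk (by rw [e2]; rfl)
  · exact key2 (4) ((√5 - 1) / 4) (by rw [← c4]; congr 1; push_cast; ring) hk (by rw [e1]; rfl)

theorem inner_corner_add (i k : ZMod 5) :
    inner ℝ (corner i) (corner (i + k)) = cornerInner k := by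
  rw [inner_corner]; congr 1; ring

theorem norm_corner_sq (i : ZMod 5) : ‖corner i‖ ^ 2 = (5 + √5) / 10 := by
  rw [← real_inner_self_eq_norm_sq, inner_corner, sub_self]; rfl

theorem two_lt_sqrt_five : 2 < √5 := by
  rw [Real.lt_sqrt (by norm_num)]; norm_num

theorem sqrt_five_lt_three : √5 < 3 := by
  rw [Real.sqrt_lt' (by norm_num)]; norm_num

/-- Every corner is orthogonal to the sum, because the values of `cornerInner` add up to zero. -/
theorem sum_corner : ∑ i, corner i = 0 := by
  rw [← norm_eq_zero, ← sq_eq_zero_iff, ← real_inner_self_eq_norm_sq, sum_inner]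
  apply Finset.sum_eq_zero
  intro i _
  rw [inner_sum]
  have : ∀ j, inner ℝ (corner i) (corner j) = cornerInner (j - i) := inner_corner i
  simp only [this]
  rw [show ∑ x, cornerInner (x - i) = ∑ x, cornerInner x from
    (Equiv.subRight i).sum_comp cornerInner]
  refine (Fin.sum_univ_five cornerInner).trans ?_
  change (5 + √5) / 10 + √5 / 10 + -(5 + 3 * √5) / 20 + -(5 + 3 * √5) / 20 + √5 / 10 = 0
  ring

theorem zero_mem : (0 : ℂ) ∈ pentagon := by
  have h := (convex_convexHull ℝ (Set.range corner)).sum_mem (t := Finset.univ)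
    (w := fun _ : ZMod 5 => (1 / 5 : ℝ)) (z := corner) (fun _ _ => by norm_num)
    (by simp [ZMod.card]) (fun i _ => corner_mem i)
  rwa [← Finset.smul_sum, sum_corner, smul_zero] at h

theorem convex_pentagon : Convex ℝ pentagon := convex_convexHull ℝ _

theorem isCompact_pentagon : IsCompact pentagon :=
  (Set.finite_range corner).isCompact_convexHull (𝕜 := ℝ)

instance : CompactSpace pentagon := isCompact_iff_compactSpace.1 isCompact_pentagon

theorem norm_le_one (p : pentagon) : ‖(p : ℂ)‖ ≤ 1 := by
  have h : pentagon ⊆ Metric.closedBall 0 1 := by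
    refine convexHull_min ?_ (convex_closedBall _ _)
    rintro _ ⟨i, rfl⟩
    rw [mem_closedBall_zero_iff]
    have := norm_corner_sq i
    have := sqrt_five_lt_three
    by_contra! h
    nlinarith
  simpa using h p.2

theorem dist_le_two (p q : pentagon) : dist p q ≤ 2 := by
  rw [Subtype.dist_eq, dist_eq_norm]
  linarith [norm_sub_le (p : ℂ) q, norm_le_one p, norm_le_one q]

/-- The squared distances of the corners. -/
def cornerDist : ZMod 5 → ℝ := ![0, 1, (3 + √5) / 2, (3 + √5) / 2, 1]

theorem dist_corner_sq (i k : ZMod 5) : dist (corner i) (corner (i + k)) ^ 2 = cornerDist k := by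
  rw [dist_eq_norm, norm_sub_sq_real, norm_corner_sq, norm_corner_sq, inner_corner_add]
  obtain rfl | rfl | rfl | rfl | rfl := zmod_five_cases k
  · change (5 + √5) / 10 - 2 * ((5 + √5) / 10) + (5 + √5) / 10 = 0; ring
  · change (5 + √5) / 10 - 2 * (√5 / 10) + (5 + √5) / 10 = 1; ring
  · change (5 + √5) / 10 - 2 * (-(5 + 3 * √5) / 20) + (5 + √5) / 10 = (3 + √5) / 2; ring
  · change (5 + √5) / 10 - 2 * (-(5 + 3 * √5) / 20) + (5 + √5) / 10 = (3 + √5) / 2; ring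
  · change (5 + √5) / 10 - 2 * (√5 / 10) + (5 + √5) / 10 = 1; ring

theorem dist_corner_succ (i : ZMod 5) : dist (corner i) (corner (i + 1)) = 1 := by
  have h : dist (corner i) (corner (i + 1)) ^ 2 = 1 := dist_corner_sq i 1
  nlinarith [dist_nonneg (x := corner i) (y := corner (i + 1))]

theorem corner_injective : Function.Injective corner := by
  intro i j h
  obtain ⟨k, rfl⟩ : ∃ k, j = i + k := ⟨j - i, by ring⟩
  have h1 := dist_corner_sq i k
  rw [← h, dist_self] at h1
  have := two_lt_sqrt_five
  obtain rfl | rfl | rfl | rfl | rfl := zmod_five_cases k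
  · exact (add_zero i).symm
  · change 0 ^ 2 = (1 : ℝ) at h1; norm_num at h1
  · change 0 ^ 2 = (3 + √5) / 2 at h1; nlinarith
  · change 0 ^ 2 = (3 + √5) / 2 at h1; nlinarith
  · change 0 ^ 2 = (1 : ℝ) at h1; norm_num at h1

/-- A diagonal has squared length (3 + √5)/2, which is not 1. -/
theorem eq_succ_of_dist_corner {i j : ZMod 5} (h : dist (corner i) (corner j) = 1) :
    j = i + 1 ∨ i = j + 1 := by
  obtain ⟨k, rfl⟩ : ∃ k, j = i + k := ⟨j - i, by ring⟩
  have h1 := dist_corner_sq i k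
  rw [h] at h1
  have := two_lt_sqrt_five
  obtain rfl | rfl | rfl | rfl | rfl := zmod_five_cases k
  · change 1 ^ 2 = (0 : ℝ) at h1; norm_num at h1
  · exact Or.inl rfl
  · change 1 ^ 2 = (3 + √5) / 2 at h1; nlinarith
  · change 1 ^ 2 = (3 + √5) / 2 at h1; nlinarith
  · right; rw [add_assoc, show (4 + 1 : ZMod 5) = 0 by decide, add_zero]

theorem sidePt_coe (i : ZMod 5) (s : I) :
    (sidePt i s : ℂ) = (1 - s : ℝ) • corner i + (s : ℝ) • corner (i + 1) :=
  AffineMap.lineMap_apply_module _ _ _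

@[simp] theorem sidePt_zero (i : ZMod 5) : sidePt i 0 = cornerPt i := by
  ext1; simp [sidePt_coe, cornerPt]

@[simp] theorem sidePt_one (i : ZMod 5) : sidePt i 1 = cornerPt (i + 1) := by
  ext1; simp [sidePt_coe, cornerPt]

theorem cornerPt_injective : Function.Injective cornerPt := fun _ _ h =>
  corner_injective (congrArg Subtype.val h)

theorem continuous_sidePt (i : ZMod 5) : Continuous (sidePt i) := by
  refine Continuous.subtype_mk ?_ _
  exact AffineMap.lineMap_continuous.comp continuous_subtype_val

theorem dist_sidePt (i : ZMod 5) (s s' : I) : dist (sidePt i s) (sidePt i s') = |(s : ℝ) - s'| := by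
  rw [Subtype.dist_eq]
  change dist (AffineMap.lineMap _ _ _) (AffineMap.lineMap _ _ _) = _
  rw [dist_lineMap_lineMap, dist_corner_succ, mul_one, Real.dist_eq]

theorem dist_cornerPt_sidePt (i : ZMod 5) (s : I) : dist (cornerPt i) (sidePt i s) = s := by
  rw [← sidePt_zero, dist_sidePt, abs_sub_comm]
  simpa using s.2.1

theorem dist_cornerPt_succ_sidePt (i : ZMod 5) (s : I) :
    dist (cornerPt (i + 1)) (sidePt i s) = 1 - s := by
  rw [← sidePt_one, dist_sidePt, abs_of_nonneg] <;> simp [s.2.2]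

/-- Stewart's theorem. -/
theorem dist_lineMap_sq (a b c : ℂ) (s : ℝ) : dist c (AffineMap.lineMap a b s) ^ 2 =
    (1 - s) * dist c a ^ 2 + s * dist c b ^ 2 - s * (1 - s) * dist a b ^ 2 := by
  simp only [dist_eq_norm, AffineMap.lineMap_apply_module, ← Complex.normSq_eq_norm_sq,
    Complex.normSq_apply]
  simp
  ring

/-- This bound makes the function of `exists_control` depend, on a side, only on the two ends of the
side; that is why it respects the gluings. -/
theorem one_le_dist_sidePt {i j : ZMod 5} (h0 : j ≠ i) (h1 : j ≠ i + 1) (s : I) :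
    1 ≤ dist (cornerPt j) (sidePt i s) := by
  rw [← one_le_sq_iff₀ dist_nonneg, Subtype.dist_eq]
  change 1 ≤ dist (corner j) (AffineMap.lineMap (corner i) (corner (i + 1)) (s : ℝ)) ^ 2
  obtain ⟨k, rfl⟩ : ∃ k, i = j + k := ⟨i - j, by ring⟩
  rw [dist_lineMap_sq, dist_corner_succ, add_assoc, dist_corner_sq, dist_corner_sq]
  have hw := two_lt_sqrt_five
  have s0 := s.2.1
  have s1 := s.2.2
  obtain rfl | rfl | rfl | rfl | rfl := zmod_five_cases k
  · simp at h0
  · change 1 ≤ (1 - (s : ℝ)) * 1 + s * ((3 + √5) / 2) - s * (1 - s) * 1 ^ 2; nlinarith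
  · change 1 ≤ (1 - (s : ℝ)) * ((3 + √5) / 2) + s * ((3 + √5) / 2) - s * (1 - s) * 1 ^ 2; nlinarith
  · change 1 ≤ (1 - (s : ℝ)) * ((3 + √5) / 2) + s * 1 - s * (1 - s) * 1 ^ 2; nlinarith
  · exfalso; apply h1; rw [add_assoc]
    rw [show (4 + 1 : ZMod 5) = 0 by decide, add_zero]

/-- The linear functional that is maximal on the pentagon at the `i`-th side. -/
def sideFun (i : ZMod 5) (z : ℂ) : ℝ := inner ℝ (corner i + corner (i + 1)) z

theorem sideFun_corner (i k : ZMod 5) :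
    sideFun i (corner (i + k)) = cornerInner k + cornerInner (k - 1) := by
  rw [sideFun, inner_add_left, inner_corner_add, inner_corner]; congr 2; ring

theorem sideFun_sidePt (i j : ZMod 5) (s : I) : sideFun i (sidePt j s) =
    (1 - s) * sideFun i (corner j) + s * sideFun i (corner (j + 1)) := by
  simp only [sideFun, sidePt_coe, inner_add_right, inner_smul_right]

theorem sideFun_zero (i : ZMod 5) : sideFun i (corner i) = (5 + 2 * √5) / 10 := by
  have := sideFun_corner i 0
  rw [add_zero] at this; rw [this]; change (5 + √5) / 10 + √5 / 10 = _; ring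

theorem sideFun_one (i : ZMod 5) : sideFun i (corner (i + 1)) = (5 + 2 * √5) / 10 := by
  rw [sideFun_corner]; change √5 / 10 + (5 + √5) / 10 = _; ring

theorem sideFun_two (i : ZMod 5) : sideFun i (corner (i + 2)) = -(5 + √5) / 20 := by
  rw [sideFun_corner]; change -(5 + 3 * √5) / 20 + √5 / 10 = _; ring

theorem sideFun_three (i : ZMod 5) : sideFun i (corner (i + 3)) = -(5 + 3 * √5) / 10 := by
  rw [sideFun_corner]; change -(5 + 3 * √5) / 20 + -(5 + 3 * √5) / 20 = _; ring

theorem sideFun_four (i : ZMod 5) : sideFun i (corner (i + 4)) = -(5 + √5) / 20 := by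
  rw [sideFun_corner]; change √5 / 10 + -(5 + 3 * √5) / 20 = _; ring

theorem sideFun_le (i : ZMod 5) (p : pentagon) : sideFun i p ≤ (5 + 2 * √5) / 10 := by
  have h : pentagon ⊆ {z | sideFun i z ≤ (5 + 2 * √5) / 10} := by
    refine convexHull_min ?_ ?_
    · rintro _ ⟨j, rfl⟩
      obtain ⟨k, rfl⟩ : ∃ k, j = i + k := ⟨j - i, by ring⟩
      have hw := two_lt_sqrt_five
      change sideFun i _ ≤ _
      obtain rfl | rfl | rfl | rfl | rfl := zmod_five_cases k
      · exact (congrArg _ (congrArg _ (add_zero i))).le.trans (sideFun_zero i).le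
      · exact (sideFun_one i).le
      · exact (sideFun_two i).le.trans (by linarith)
      · exact (sideFun_three i).le.trans (by linarith)
      · exact (sideFun_four i).le.trans (by linarith)
    · exact convex_halfSpace_le ⟨fun x y => inner_add_right _ _ _,
        fun c x => real_inner_smul_right _ _ _⟩ _
  exact h p.2

theorem sideFun_self (i : ZMod 5) (s : I) : sideFun i (sidePt i s) = (5 + 2 * √5) / 10 := by
  rw [sideFun_sidePt, sideFun_zero, sideFun_one]; ring

/-- The functional of side `i` reaches its maximum on this side only, so another side can reach it
only in a common corner. -/
theorem eq_of_sideFun_eq {i j : ZMod 5} {s : I}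
    (h : sideFun i (sidePt j s) = (5 + 2 * √5) / 10) :
    j = i ∨ (j = i + 1 ∧ s = 0) ∨ (i = j + 1 ∧ s = 1) := by
  obtain ⟨k, rfl⟩ : ∃ k, j = i + k := ⟨j - i, by ring⟩
  have hw := two_lt_sqrt_five
  have s0 := s.2.1
  have s1 := s.2.2
  rw [sideFun_sidePt] at h
  have e4 : i + 4 + 1 = i := by rw [add_assoc, show (4 + 1 : ZMod 5) = 0 by decide, add_zero]
  obtain rfl | rfl | rfl | rfl | rfl := zmod_five_cases k
  · left; exact add_zero i
  · right; left; refine ⟨rfl, ?_⟩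
    change (1 - (s : ℝ)) * sideFun i (corner (i + 1)) + s * sideFun i (corner (i + 1 + 1)) = _ at h
    rw [sideFun_one, add_assoc, show (1 + 1 : ZMod 5) = 2 by decide, sideFun_two] at h
    ext; change (s : ℝ) = 0; nlinarith
  · change (1 - (s : ℝ)) * sideFun i (corner (i + 2)) + s * sideFun i (corner (i + 2 + 1)) = _ at h
    rw [sideFun_two, add_assoc, show (2 + 1 : ZMod 5) = 3 by decide, sideFun_three] at h
    nlinarith
  · change (1 - (s : ℝ)) * sideFun i (corner (i + 3)) + s * sideFun i (corner (i + 3 + 1)) = _ at h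
    rw [sideFun_three, add_assoc, show (3 + 1 : ZMod 5) = 4 by decide, sideFun_four] at h
    nlinarith
  · right; right
    change (1 - (s : ℝ)) * sideFun i (corner (i + 4)) + s * sideFun i (corner (i + 4 + 1)) = _ at h
    rw [sideFun_four, e4, sideFun_zero] at h
    exact ⟨e4.symm, by ext; change (s : ℝ) = 1; nlinarith⟩

theorem sidePt_injective (i : ZMod 5) : Function.Injective (sidePt i) := by
  intro s s' h
  have h1 := dist_sidePt i s s'
  rw [h, dist_self] at h1
  exact Subtype.ext (by linarith [abs_eq_zero.1 h1.symm])

theorem sidePt_eq_sidePt {i j : ZMod 5} {s s' : I} (h : sidePt i s = sidePt j s') :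
    (i = j ∧ s = s') ∨ (j = i + 1 ∧ s = 1 ∧ s' = 0) ∨ (i = j + 1 ∧ s = 0 ∧ s' = 1) := by
  have h1 := sideFun_self i s
  have h2 := sideFun_self j s'
  rw [h] at h1
  rw [← h] at h2
  rcases eq_of_sideFun_eq h1 with rfl | ⟨e, e'⟩ | ⟨e, e'⟩
  · exact Or.inl ⟨rfl, sidePt_injective _ h⟩
  · subst e e'
    right; left
    refine ⟨rfl, ?_, rfl⟩
    rw [sidePt_zero, ← sidePt_one] at h
    exact sidePt_injective _ h
  · subst e e'
    right; right
    refine ⟨rfl, ?_, rfl⟩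
    rw [sidePt_one, ← sidePt_zero] at h
    exact sidePt_injective _ h

theorem sidePt_eq_cornerPt {i j : ZMod 5} {s : I} (h : sidePt i s = cornerPt j) :
    (i = j ∧ s = 0) ∨ (j = i + 1 ∧ s = 1) := by
  rw [← sidePt_zero] at h
  rcases sidePt_eq_sidePt h with h | h | h
  · exact Or.inl h
  · exact Or.inr ⟨h.1, h.2.1⟩
  · exact absurd h.2.2 (by simp)

end Pentagon

namespace Pentagon

/-! ### Cone coordinates -/

/-- The point of the pentagon on the segment from the centre to a point of the boundary. -/
def cone (i : ZMod 5) (s r : I) : pentagon :=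
  ⟨(r : ℝ) • (sidePt i s : ℂ),
    convex_pentagon.starConvex zero_mem |>.smul_mem (sidePt i s).2 r.2.1 r.2.2⟩

@[simp] theorem cone_one (i : ZMod 5) (s : I) : cone i s 1 = sidePt i s := by
  ext1; simp [cone]

theorem sideFun_smul (i : ZMod 5) (r : ℝ) (z : ℂ) : sideFun i (r • z) = r * sideFun i z :=
  real_inner_smul_right _ _ _

theorem apothem_pos : 0 < (5 + 2 * √5) / 10 := by
  have := two_lt_sqrt_five; linarith

/-- The functional of side `i` takes on `cone i s r` the value `r` times its maximum, and on a point
of radius `r'` at most `r'` times the maximum. So the radius is the gauge of the pentagon. -/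
theorem cone_radius_le {i j : ZMod 5} {s s' r r' : I} (h : cone i s r = cone j s' r') :
    (r : ℝ) ≤ r' := by
  have h1 : sideFun i (cone i s r) = sideFun i (cone j s' r') := by rw [h]
  change sideFun i ((r : ℝ) • (sidePt i s : ℂ)) = sideFun i ((r' : ℝ) • (sidePt j s' : ℂ)) at h1
  rw [sideFun_smul, sideFun_smul, sideFun_self] at h1
  have h2 := sideFun_le i (sidePt j s')
  have h3 := mul_le_mul_of_nonneg_left h2 r'.2.1
  have := apothem_pos
  nlinarith

theorem cone_eq_cone {i j : ZMod 5} {s s' r r' : I} :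
    cone i s r = cone j s' r' ↔ r = r' ∧ (r = 0 ∨ sidePt i s = sidePt j s') := by
  constructor
  · intro h
    have hr : r = r' := Subtype.ext (le_antisymm (cone_radius_le h) (cone_radius_le h.symm))
    subst hr
    refine ⟨rfl, or_iff_not_imp_left.2 fun h0 => ?_⟩
    have h1 : (r : ℝ) • (sidePt i s : ℂ) = (r : ℝ) • (sidePt j s' : ℂ) := congrArg Subtype.val h
    have h2 : (r : ℝ) ≠ 0 := fun h => h0 (Subtype.ext h)
    exact Subtype.ext (smul_right_injective _ h2 h1)
  · rintro ⟨rfl, rfl | h⟩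
    · ext1; simp [cone]
    · ext1; simp [cone, h]

theorem continuous_cone (i : ZMod 5) : Continuous fun x : I × I => cone i x.1 x.2 := by
  refine Continuous.subtype_mk ?_ _
  have := continuous_subtype_val.comp ((continuous_sidePt i).comp (continuous_fst (Y := I)))
  have h2 : Continuous fun x : I × I => (x.2 : ℝ) := by fun_prop
  exact h2.smul this

theorem exists_corner_coords (i : ZMod 5) (z : ℂ) :
    ∃ a b : ℝ, z = a • corner i + b • corner (i + 1) := by
  -- If the determinant vanished, the Gram determinant ((5 + √5)/10)² - (√5/10)² of the two corners
  -- would vanish too.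
  have hD : (corner i).re * (corner (i + 1)).im - (corner i).im * (corner (i + 1)).re ≠ 0 := by
    intro h0
    have h1 := norm_corner_sq i
    have h2 := norm_corner_sq (i + 1)
    have h3 := inner_corner_add i 1
    change _ = √5 / 10 at h3
    rw [Complex.inner] at h3
    rw [← Complex.normSq_eq_norm_sq, Complex.normSq_apply] at h1 h2
    simp at h3
    have h4 : ((corner i).re * (corner i).re + (corner i).im * (corner i).im) *
        ((corner (i+1)).re * (corner (i+1)).re + (corner (i+1)).im * (corner (i+1)).im) =
        (√5 / 10) ^ 2 := by
      rw [← h3]; linear_combination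
        (((corner i).re * (corner (i + 1)).im - (corner i).im * (corner (i + 1)).re)) * h0
    rw [h1, h2] at h4
    nlinarith [two_lt_sqrt_five]
  refine ⟨(z.re * (corner (i + 1)).im - z.im * (corner (i + 1)).re) /
      ((corner i).re * (corner (i + 1)).im - (corner i).im * (corner (i + 1)).re),
    ((corner i).re * z.im - (corner i).im * z.re) /
      ((corner i).re * (corner (i + 1)).im - (corner i).im * (corner (i + 1)).re), ?_⟩
  apply Complex.ext
  · simp only [Complex.add_re, Complex.smul_re, smul_eq_mul]
    rw [div_mul_eq_mul_div, div_mul_eq_mul_div, ← add_div, eq_div_iff hD]; ring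
  · simp only [Complex.add_im, Complex.smul_im, smul_eq_mul]
    rw [div_mul_eq_mul_div, div_mul_eq_mul_div, ← add_div, eq_div_iff hD]; ring

theorem cone_surjective (p : pentagon) : ∃ i s r, cone i s r = p := by
  -- The side with the largest functional at `p` is the one that the ray through `p` meets:
  -- comparison with the two neighbouring sides makes both coordinates of `p` nonnegative.
  obtain ⟨i, -, hi⟩ := Finset.exists_max_image Finset.univ (fun i => sideFun i p) ⟨0, by simp⟩
  have hi1 := hi (i + 1) (by simp)
  have hi2 := hi (i - 1) (by simp)
  obtain ⟨a, b, hab⟩ := exists_corner_coords i p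
  have ev : ∀ j, sideFun j p = a * sideFun j (corner i) + b * sideFun j (corner (i + 1)) := by
    intro j
    rw [hab]; simp only [sideFun, inner_add_right, real_inner_smul_right]
  have hw := two_lt_sqrt_five
  have f1 : sideFun (i + 1) (corner i) = -(5 + √5) / 20 := by
    rw [← sideFun_four (i + 1)]; congr 2; rw [add_assoc, show (1 + 4 : ZMod 5) = 0 by decide, add_zero]
  have f2 : sideFun (i - 1) (corner i) = (5 + 2 * √5) / 10 := by
    rw [← sideFun_one (i - 1)]; congr 2; ring
  have f3 : sideFun (i - 1) (corner (i + 1)) = -(5 + √5) / 20 := by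
    rw [← sideFun_two (i - 1)]; congr 2; ring
  rw [ev, ev, sideFun_zero, sideFun_one, f1, sideFun_zero] at hi1
  rw [ev, ev, sideFun_zero, sideFun_one, f2, f3] at hi2
  have ha : 0 ≤ a := by nlinarith
  have hb : 0 ≤ b := by nlinarith
  have hr : a + b ≤ 1 := by
    have := sideFun_le i p
    rw [ev, sideFun_zero, sideFun_one] at this
    nlinarith
  rcases eq_or_ne (a + b) 0 with h0 | h0
  · have ha0 : a = 0 := by linarith
    have hb0 : b = 0 := by linarith
    refine ⟨i, 0, 0, Subtype.ext ?_⟩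
    rw [hab]; simp [cone, ha0, hb0]
  · have hpos : 0 < a + b := lt_of_le_of_ne (by positivity) h0.symm
    refine ⟨i, ⟨b / (a + b), by positivity, (div_le_one hpos).2 (by linarith)⟩,
      ⟨a + b, hpos.le, hr⟩, Subtype.ext ?_⟩
    rw [hab]
    simp only [cone, sidePt_coe, smul_add, smul_smul]
    congr 2 <;> field_simp
    ring

/-- An identification of the boundary with the unit sphere of a norm extends radially. Cone
coordinates are a quotient map, being a continuous surjection of a compact space onto a Hausdorff
one, so continuity can be checked in them. The norm is left open: it is used for the round disc and
for the square. -/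
theorem exists_coneMap {E : Type*} [NormedAddCommGroup E] [NormedSpace ℝ E]
    (δ : ZMod 5 → I → E) (hc : ∀ i, Continuous (δ i)) (h1 : ∀ i s, ‖δ i s‖ = 1)
    (hδ : ∀ i j s s', δ i s = δ j s' ↔ sidePt i s = sidePt j s')
    (hs : ∀ x, ‖x‖ = 1 → ∃ i s, δ i s = x) :
    ∃ h : pentagon → E, Continuous h ∧ Function.Injective h ∧
      Set.range h = Metric.closedBall 0 1 ∧ ∀ i s r, h (cone i s r) = (r : ℝ) • δ i s := by
  choose i s r hp using cone_surjective
  set h : pentagon → E := fun p => (r p : ℝ) • δ (i p) (s p) with hh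
  have key : ∀ j t u, h (cone j t u) = (u : ℝ) • δ j t := by
    intro j t u
    rcases cone_eq_cone.1 (hp (cone j t u)) with ⟨e1, e2 | e2⟩
    · have e3 : u = 0 := e1.symm.trans e2
      change (r (cone j t u) : ℝ) • _ = _
      rw [e2, e3]; simp
    · change (r (cone j t u) : ℝ) • δ _ _ = _
      rw [(hδ _ _ _ _).2 e2, e1]
  refine ⟨h, ?_, ?_, ?_, key⟩
  · let _ : TopologicalSpace (ZMod 5) := ⊥
    have _ : DiscreteTopology (ZMod 5) := ⟨rfl⟩
    let q : ZMod 5 × (I × I) → pentagon := fun x => cone x.1 x.2.1 x.2.2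
    have hq : Continuous q := continuous_prod_of_discrete_left.2 fun i => continuous_cone i
    have hqs : Function.Surjective q := fun p => ⟨(i p, s p, r p), hp p⟩
    have hqq : Topology.IsQuotientMap q := (hq.isClosedMap).isQuotientMap hq hqs
    rw [hqq.continuous_iff]
    refine continuous_prod_of_discrete_left.2 fun i => ?_
    have : (fun x : I × I => (h ∘ q) (i, x)) = fun x => (x.2 : ℝ) • δ i x.1 :=
      funext fun x => key _ _ _
    change Continuous (fun x : I × I => (h ∘ q) (i, x))
    rw [this]
    have h2 : Continuous fun x : I × I => (x.2 : ℝ) := by fun_prop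
    exact h2.smul ((hc i).comp continuous_fst)
  · intro p p' hpp
    rw [← hp p, ← hp p', cone_eq_cone]
    have hn := congrArg norm hpp
    simp only [hh, norm_smul, h1, mul_one, Real.norm_eq_abs, abs_of_nonneg (r p).2.1,
      abs_of_nonneg (r p').2.1] at hn
    have hr : r p = r p' := Subtype.ext hn
    refine ⟨hr, or_iff_not_imp_left.2 fun h0 => ?_⟩
    simp only [hh] at hpp
    rw [← hr] at hpp
    have h2 : (r p : ℝ) ≠ 0 := fun h => h0 (Subtype.ext h)
    exact (hδ _ _ _ _).1 (smul_right_injective _ h2 hpp)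
  · ext x
    simp only [Set.mem_range, mem_closedBall_zero_iff]
    constructor
    · rintro ⟨p, rfl⟩
      simp only [hh, norm_smul, h1, mul_one, Real.norm_eq_abs, abs_of_nonneg (r p).2.1]
      exact (r p).2.2
    · intro hx
      rcases eq_or_ne x 0 with rfl | h0
      · exact ⟨cone 0 0 0, by rw [key]; simp⟩
      · have hx0 : 0 < ‖x‖ := norm_pos_iff.2 h0
        obtain ⟨j, t, e⟩ := hs (‖x‖⁻¹ • x) (by rw [norm_smul, norm_inv, norm_norm]; field_simp)
        refine ⟨cone j t ⟨‖x‖, hx0.le, hx⟩, ?_⟩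
        rw [key, e, smul_smul, mul_inv_cancel₀ hx0.ne', one_smul]

/-! ### Rotations -/

theorem exp_mul_corner (i k : ZMod 5) :
    Complex.exp (((2 * Real.pi * (k.val : ℝ) / 5 : ℝ) : ℂ) * Complex.I) * corner i =
      corner (i + k) := by
  obtain ⟨n, hv⟩ : ∃ n : ℕ, ((i + k).val : ℤ) = i.val + k.val - 5 * n :=
    ⟨(i.val + k.val) / 5, by rw [ZMod.val_add]; omega⟩
  have hv' : ((i + k).val : ℂ) = i.val + k.val - 5 * n := by exact_mod_cast hv
  rw [corner, corner, mul_left_comm, ← Complex.exp_add]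
  congr 1
  rw [Complex.exp_eq_exp_iff_exists_int]
  refine ⟨n, ?_⟩
  push_cast
  rw [hv']
  ring

/-- The rotation of the pentagon that moves the corner `0` to the corner `k`. -/
def rot (k : ZMod 5) (p : pentagon) : pentagon :=
  ⟨Complex.exp (((2 * Real.pi * (k.val : ℝ) / 5 : ℝ) : ℂ) * Complex.I) * p, by
    have h : pentagon ⊆ (LinearMap.mulLeft ℝ
      (Complex.exp (((2 * Real.pi * (k.val : ℝ) / 5 : ℝ) : ℂ) * Complex.I))) ⁻¹' pentagon := by
      refine convexHull_min ?_ (convex_pentagon.linear_preimage _)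
      rintro _ ⟨i, rfl⟩
      change _ * corner i ∈ pentagon
      rw [exp_mul_corner]
      exact corner_mem _
    exact h p.2⟩

theorem rot_sidePt (k i : ZMod 5) (s : I) : rot k (sidePt i s) = sidePt (i + k) s := by
  ext1
  simp only [rot, sidePt_coe, mul_add, mul_smul_comm, exp_mul_corner]
  rw [add_right_comm]

theorem rot_cone (k i : ZMod 5) (s r : I) : rot k (cone i s r) = cone (i + k) s r := by
  ext1
  simp only [cone, ← rot_sidePt k i s, rot, mul_smul_comm]

theorem rot_rot (k l : ZMod 5) (p : pentagon) : rot k (rot l p) = rot (l + k) p := by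
  obtain ⟨i, s, r, rfl⟩ := cone_surjective p
  rw [rot_cone, rot_cone, rot_cone, add_assoc]

@[simp] theorem rot_zero (p : pentagon) : rot 0 p = p := by
  obtain ⟨i, s, r, rfl⟩ := cone_surjective p
  rw [rot_cone, add_zero]

theorem rot_cornerPt (k i : ZMod 5) : rot k (cornerPt i) = cornerPt (i + k) := by
  rw [← sidePt_zero, rot_sidePt, sidePt_zero]

theorem continuous_rot (k : ZMod 5) : Continuous (rot k) :=
  Continuous.subtype_mk (by fun_prop) _

theorem rot_injective (k : ZMod 5) : Function.Injective (rot k) := fun p q h => by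
  have := congrArg (rot (-k)) h
  rwa [rot_rot, rot_rot, add_neg_cancel, rot_zero, rot_zero] at this

/-! ### Isometries -/

/-- Extreme points are preserved although `g` is defined on the pentagon only. If the image of a
corner lay between `a` and `b`, then, by strict convexity of the plane, the corner would lie between
their preimages in the same ratio; as corners have the largest norm in the pentagon, the preimages
coincide. -/
theorem exists_cornerPt_of_isometry (g : pentagon ≃ᵢ pentagon) (i : ZMod 5) :
    ∃ j, g (cornerPt i) = cornerPt j := by
  have hext : (g (cornerPt i) : ℂ) ∈ pentagon.extremePoints ℝ := by
    rw [mem_extremePoints_iff_left]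
    refine ⟨(g (cornerPt i)).2, fun a ha b hb hab => ?_⟩
    obtain ⟨a', ha'⟩ := g.surjective ⟨a, ha⟩
    obtain ⟨b', hb'⟩ := g.surjective ⟨b, hb⟩
    obtain ⟨t, ht, hp⟩ := (openSegment_eq_image_lineMap ℝ a b).le hab
    have hp' : (g (cornerPt i) : ℂ) = AffineMap.lineMap a b t := hp.symm
    have d1 : dist (a' : ℂ) (corner i) = t * dist (a' : ℂ) b' := by
      have e1 : dist a' (cornerPt i) = dist (g a') (g (cornerPt i)) := (g.dist_eq _ _).symm
      have e2 : dist a' b' = dist (g a') (g b') := (g.dist_eq _ _).symm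
      rw [ha', hb', Subtype.dist_eq, Subtype.dist_eq] at e2
      rw [ha', Subtype.dist_eq, Subtype.dist_eq, hp', dist_left_lineMap] at e1
      change dist (a' : ℂ) (corner i) = _ at e1
      rw [e1, e2, Real.norm_of_nonneg ht.1.le]
    have d2 : dist (corner i) b' = (1 - t) * dist (a' : ℂ) b' := by
      have e1 : dist (cornerPt i) b' = dist (g (cornerPt i)) (g b') := (g.dist_eq _ _).symm
      have e2 : dist a' b' = dist (g a') (g b') := (g.dist_eq _ _).symm
      rw [ha', hb', Subtype.dist_eq, Subtype.dist_eq] at e2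
      rw [hb', Subtype.dist_eq, Subtype.dist_eq, hp', dist_lineMap_right] at e1
      change dist (corner i) (b' : ℂ) = _ at e1
      rw [e1, e2, Real.norm_of_nonneg (by linarith [ht.2])]
    have hc := eq_lineMap_of_dist_eq_mul_of_dist_eq_mul d1 d2
    have hR : ∀ p : pentagon, ‖(p : ℂ)‖ ≤ ‖corner i‖ := by
      intro p
      have h : pentagon ⊆ Metric.closedBall 0 ‖corner i‖ := by
        refine convexHull_min ?_ (convex_closedBall _ _)
        rintro _ ⟨j, rfl⟩
        rw [mem_closedBall_zero_iff]
        exact le_of_eq ((sq_eq_sq₀ (norm_nonneg _) (norm_nonneg _)).1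
          (by rw [norm_corner_sq, norm_corner_sq]))
      simpa using h p.2
    have hab' : (a' : ℂ) = b' := by
      by_contra hne
      have := norm_combo_lt_of_ne (hR a') (hR b') hne (a := 1 - t) (b := t)
        (by linarith [ht.2]) ht.1 (by ring)
      rw [← AffineMap.lineMap_apply_module, ← hc] at this
      exact lt_irrefl _ this
    have : a = b := by
      have h := (ha'.symm.trans (congrArg g (Subtype.ext hab'))).trans hb'
      exact congrArg Subtype.val h
    rw [hp', this, AffineMap.lineMap_same_apply]
  obtain ⟨j, hj⟩ := extremePoints_convexHull_subset hext
  exact ⟨j, Subtype.ext hj.symm⟩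

/-- An isometry of the pentagon permutes the sides. -/
theorem exists_sidePt_of_isometry (g : pentagon ≃ᵢ pentagon) (i : ZMod 5) :
    ∃ j, (∀ s, g (sidePt i s) = sidePt j s) ∨ (∀ s, g (sidePt i s) = sidePt j (unitInterval.symm s)) := by
  obtain ⟨a, ha⟩ := exists_cornerPt_of_isometry g i
  obtain ⟨b, hb⟩ := exists_cornerPt_of_isometry g (i + 1)
  have hab : dist (corner a) (corner b) = 1 := by
    have := g.dist_eq (cornerPt i) (cornerPt (i + 1))
    rw [ha, hb, Subtype.dist_eq, Subtype.dist_eq] at this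
    exact this.trans (dist_corner_succ i)
  have key : ∀ s, (g (sidePt i s) : ℂ) = AffineMap.lineMap (corner a) (corner b) (s : ℝ) := by
    intro s
    apply eq_lineMap_of_dist_eq_mul_of_dist_eq_mul
    · rw [hab, mul_one]
      change dist ((cornerPt a : pentagon) : ℂ) _ = _
      rw [← Subtype.dist_eq, ← ha, g.dist_eq, dist_cornerPt_sidePt]
    · rw [hab, mul_one]
      change dist _ ((cornerPt b : pentagon) : ℂ) = _
      rw [← Subtype.dist_eq, ← hb, g.dist_eq, dist_comm, dist_cornerPt_succ_sidePt]
  rcases eq_succ_of_dist_corner hab with rfl | rfl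
  · exact ⟨a, Or.inl fun s => Subtype.ext (key s)⟩
  · refine ⟨b, Or.inr fun s => Subtype.ext ((key s).trans ?_)⟩
    change _ = AffineMap.lineMap (corner b) (corner (b + 1)) ((unitInterval.symm s : I) : ℝ)
    rw [unitInterval.coe_symm_eq, AffineMap.lineMap_apply_one_sub]

/-- The inner product of `x - y` with a corner does not depend on the corner. Since the corners add
up to zero it vanishes, and two adjacent corners span the plane. -/
theorem eq_of_dist_corner_eq {x y : ℂ} (h : ∀ i, dist x (corner i) = dist y (corner i)) :
    x = y := by
  have h1 : ∀ i, 2 * inner ℝ (x - y) (corner i) = ‖x‖ ^ 2 - ‖y‖ ^ 2 := by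
    intro i
    have := congrArg (· ^ 2) (h i)
    simp only [dist_eq_norm, norm_sub_sq_real] at this
    rw [inner_sub_left]; linarith
  have h2 : ‖x‖ ^ 2 - ‖y‖ ^ 2 = 0 := by
    have : ∑ i : ZMod 5, 2 * inner ℝ (x - y) (corner i) = 0 := by
      rw [← Finset.mul_sum, ← inner_sum, sum_corner, inner_zero_right, mul_zero]
    simp only [h1, Finset.sum_const, Finset.card_univ, ZMod.card, nsmul_eq_mul] at this
    simpa using this
  obtain ⟨a, b, hab⟩ := exists_corner_coords 0 (x - y)
  have h3 : inner ℝ (x - y) (x - y) = 0 := by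
    nth_rewrite 2 [hab]
    rw [inner_add_right, real_inner_smul_right, real_inner_smul_right]
    have e1 := h1 0
    have e2 := h1 (0 + 1)
    rw [h2] at e1 e2
    rw [show inner ℝ (x - y) (corner 0) = 0 by linarith,
      show inner ℝ (x - y) (corner (0 + 1)) = 0 by linarith]
    ring
  exact sub_eq_zero.1 (inner_self_eq_zero.1 h3)

/-- An isometry is determined by its action on the corners. This finiteness is used whenever an
ultrafilter has to fix the position of a tile. -/
instance : Finite (pentagon ≃ᵢ pentagon) := by
  choose c hc using exists_cornerPt_of_isometry
  refine Finite.of_injective c fun g g' h => ?_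
  ext1 p
  apply Subtype.ext
  apply eq_of_dist_corner_eq
  intro i
  obtain ⟨q, hq⟩ := g.surjective (cornerPt i)
  obtain ⟨j, rfl⟩ : ∃ j, q = cornerPt j := by
    obtain ⟨j, hj⟩ := exists_cornerPt_of_isometry g.symm i
    exact ⟨j, by rw [← hj, ← hq, g.symm_apply_apply]⟩
  have hq' : g' (cornerPt j) = cornerPt i := by rw [hc, ← h, ← hc, hq]
  have e1 := g.dist_eq p (cornerPt j)
  have e2 := g'.dist_eq p (cornerPt j)
  rw [hq] at e1
  rw [hq'] at e2
  exact e1.trans e2.symm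

end Pentagon

namespace PentComplex

open Pentagon

variable {L : PentComplex}

/-! ### Adjacency, vertices and the identifications -/

/-- Two sides are adjacent if they are glued, in one of the two orders. -/
def Adj (L : PentComplex) (t : L.Tile) (i : ZMod 5) (t' : L.Tile) (j : ZMod 5) : Prop :=
  L.Glued t i t' j ∨ L.Glued t' j t i

theorem Adj.symm {t t' : L.Tile} {i j : ZMod 5} (h : L.Adj t i t' j) : L.Adj t' j t i :=
  Or.symm h

theorem pt_eq_of_glued {t t' : L.Tile} {i j : ZMod 5} (h : L.Glued t i t' j) (s : I) :
    L.pt t (sidePt i s) = L.pt t' (sidePt j (unitInterval.symm s)) :=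
  Quot.sound (GlueRel.glue t i t' j s h)

theorem Adj.pt_eq {t t' : L.Tile} {i j : ZMod 5} (h : L.Adj t i t' j) (s : I) :
    L.pt t (sidePt i s) = L.pt t' (sidePt j (unitInterval.symm s)) := by
  rcases h with h | h
  · exact pt_eq_of_glued h s
  · rw [pt_eq_of_glued h, unitInterval.symm_symm]

/-- The elementary identifications of corners. -/
inductive CornerRel (L : PentComplex) : L.Tile × ZMod 5 → L.Tile × ZMod 5 → Prop
  | left {t : L.Tile} {i : ZMod 5} {t' : L.Tile} {j : ZMod 5} (h : L.Glued t i t' j) :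
      CornerRel L (t, i) (t', j + 1)
  | right {t : L.Tile} {i : ZMod 5} {t' : L.Tile} {j : ZMod 5} (h : L.Glued t i t' j) :
      CornerRel L (t, i + 1) (t', j)

/-- The combinatorial vertices of a complex. -/
def Vertex (L : PentComplex) : Type := Quot L.CornerRel

/-- The `i`-th vertex of a tile. -/
def vert (L : PentComplex) (t : L.Tile) (i : ZMod 5) : L.Vertex := Quot.mk _ (t, i)

theorem Vertex.ind {P : L.Vertex → Prop} (h : ∀ t i, P (L.vert t i)) (v : L.Vertex) : P v :=
  Quot.ind (fun a => h a.1 a.2) v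

theorem Adj.vert_left {t t' : L.Tile} {i j : ZMod 5} (h : L.Adj t i t' j) :
    L.vert t i = L.vert t' (j + 1) := by
  rcases h with h | h
  · exact Quot.sound (CornerRel.left h)
  · exact (Quot.sound (CornerRel.right h)).symm

theorem Adj.vert_right {t t' : L.Tile} {i j : ZMod 5} (h : L.Adj t i t' j) :
    L.vert t (i + 1) = L.vert t' j := h.symm.vert_left.symm

/-- The vertex as a point of the realization. -/
def vertexPt (L : PentComplex) : L.Vertex → L.Realization :=
  Quot.lift (fun a => L.pt a.1 (cornerPt a.2)) (by
    rintro _ _ (⟨h⟩ | ⟨h⟩)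
    · simpa using pt_eq_of_glued h 0
    · simpa using pt_eq_of_glued h 1)

open Classical in
/-- The vertex at a point of the realization, if there is one. -/
def vertexAt (L : PentComplex) : L.Realization → Option L.Vertex :=
  Quot.lift (fun x => if h : ∃ i, x.2 = cornerPt i then some (L.vert x.1 h.choose) else none) (by
    have aux : ∀ (t : L.Tile) (p : pentagon) (i : ZMod 5), p = cornerPt i →
        (if h : ∃ i, p = cornerPt i then some (L.vert t h.choose) else none) =
          some (L.vert t i) := by
      rintro t _ i rfl
      have h : ∃ j, cornerPt i = cornerPt j := ⟨i, rfl⟩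
      rw [dif_pos h, ← cornerPt_injective h.choose_spec]
    rintro _ _ ⟨t, i, t', j, s, h⟩
    simp only
    rcases eq_or_ne s 0 with rfl | h0
    · rw [aux t _ i (by simp), aux t' _ (j + 1) (by simp), Adj.vert_left (Or.inl h)]
    rcases eq_or_ne s 1 with rfl | h1
    · rw [aux t _ (i + 1) (by simp), aux t' _ j (by simp), Adj.vert_right (Or.inl h)]
    · rw [dif_neg, dif_neg]
      · rintro ⟨k, hk⟩
        rcases sidePt_eq_cornerPt hk with ⟨-, e⟩ | ⟨-, e⟩
        · exact h1 (by simpa using congrArg unitInterval.symm e)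
        · exact h0 (by simpa using congrArg unitInterval.symm e)
      · rintro ⟨k, hk⟩
        rcases sidePt_eq_cornerPt hk with ⟨-, e⟩ | ⟨-, e⟩
        · exact h0 e
        · exact h1 e)

theorem vertexAt_cornerPt (t : L.Tile) (i : ZMod 5) :
    L.vertexAt (L.pt t (cornerPt i)) = some (L.vert t i) := by
  have h : ∃ j, cornerPt i = cornerPt j := ⟨i, rfl⟩
  change (if h : ∃ j, cornerPt i = cornerPt j then some (L.vert t h.choose) else none) = _
  rw [dif_pos h, ← cornerPt_injective h.choose_spec]

/-- `vertexAt` recovers the combinatorial vertex from the point; it is well defined because gluings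
take ends of sides to ends of sides. -/
theorem pt_cornerPt_eq_iff {t t' : L.Tile} {i j : ZMod 5} :
    L.pt t (cornerPt i) = L.pt t' (cornerPt j) ↔ L.vert t i = L.vert t' j := by
  constructor
  · intro h
    have := congrArg L.vertexAt h
    rwa [vertexAt_cornerPt, vertexAt_cornerPt, Option.some_inj] at this
  · intro h
    exact congrArg L.vertexPt h

/-- Every side is glued to at most one side. -/
def EdgeRegular (L : PentComplex) : Prop :=
  ∀ ⦃t i t₁ j₁ t₂ j₂⦄, L.Adj t i t₁ j₁ → L.Adj t i t₂ j₂ → t₁ = t₂ ∧ j₁ = j₂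

/-- The explicit form of the identifications. -/
def Ident (L : PentComplex) (t : L.Tile) (p : pentagon) (t' : L.Tile) (p' : pentagon) : Prop :=
  (t = t' ∧ p = p') ∨
  (∃ i j s, L.Adj t i t' j ∧ s ≠ 0 ∧ s ≠ 1 ∧ p = sidePt i s ∧ p' = sidePt j (unitInterval.symm s)) ∨
  (∃ i j, p = cornerPt i ∧ p' = cornerPt j ∧ L.vert t i = L.vert t' j)

theorem symm_eq_zero {s : I} : unitInterval.symm s = 0 ↔ s = 1 := by
  rw [← unitInterval.symm_one, unitInterval.symm_bijective.injective.eq_iff]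

theorem symm_eq_one {s : I} : unitInterval.symm s = 1 ↔ s = 0 := by
  rw [← unitInterval.symm_zero, unitInterval.symm_bijective.injective.eq_iff]

theorem sidePt_eq_sidePt_of_ne {i j : ZMod 5} {s s' : I} (h0 : s ≠ 0) (h1 : s ≠ 1)
    (h : sidePt i s = sidePt j s') : i = j ∧ s = s' := by
  rcases sidePt_eq_sidePt h with h | h | h
  · exact h
  · exact absurd h.2.1 h1
  · exact absurd h.2.1 h0

theorem sidePt_ne_cornerPt {i j : ZMod 5} {s : I} (h0 : s ≠ 0) (h1 : s ≠ 1) :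
    sidePt i s ≠ cornerPt j := fun h => by
  rcases sidePt_eq_cornerPt h with h | h
  · exact h0 h.2
  · exact h1 h.2

theorem Ident.symm {t t' : L.Tile} {p p' : pentagon} (h : L.Ident t p t' p') :
    L.Ident t' p' t p := by
  rcases h with ⟨rfl, rfl⟩ | ⟨i, j, s, h, h0, h1, rfl, rfl⟩ | ⟨i, j, rfl, rfl, h⟩
  · exact Or.inl ⟨rfl, rfl⟩
  · exact Or.inr (Or.inl ⟨j, i, unitInterval.symm s, h.symm, by rwa [Ne, symm_eq_zero],
      by rwa [Ne, symm_eq_one], rfl, by simp⟩)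
  · exact Or.inr (Or.inr ⟨j, i, rfl, rfl, h.symm⟩)

theorem Ident.pt_eq {t t' : L.Tile} {p p' : pentagon} (h : L.Ident t p t' p') :
    L.pt t p = L.pt t' p' := by
  rcases h with ⟨rfl, rfl⟩ | ⟨i, j, s, h, h0, h1, rfl, rfl⟩ | ⟨i, j, rfl, rfl, h⟩
  · rfl
  · exact h.pt_eq s
  · exact pt_cornerPt_eq_iff.2 h

/-- `EdgeRegular` enters at inner points of sides, where two successive gluings must lead back to
the first tile. At corners the relation is an equality of vertices and is transitive anyway. -/
theorem Ident.trans (hL : L.EdgeRegular) {t t' t'' : L.Tile} {p p' p'' : pentagon}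
    (h : L.Ident t p t' p') (h' : L.Ident t' p' t'' p'') : L.Ident t p t'' p'' := by
  rcases h with ⟨rfl, rfl⟩ | ⟨i, j, s, h, h0, h1, rfl, rfl⟩ | ⟨i, j, rfl, rfl, h⟩
  · exact h'
  · rcases h' with ⟨rfl, rfl⟩ | ⟨i', j', s', h', h0', h1', e, rfl⟩ | ⟨i', j', e, rfl, h'⟩
    · exact Or.inr (Or.inl ⟨i, j, s, h, h0, h1, rfl, rfl⟩)
    · obtain ⟨rfl, rfl⟩ := sidePt_eq_sidePt_of_ne h0' h1' e.symm
      obtain ⟨rfl, rfl⟩ := hL h.symm h'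
      exact Or.inl ⟨rfl, by simp⟩
    · exact absurd e (sidePt_ne_cornerPt (by rwa [Ne, symm_eq_zero]) (by rwa [Ne, symm_eq_one]))
  · rcases h' with ⟨rfl, rfl⟩ | ⟨i', j', s', h', h0', h1', e, rfl⟩ | ⟨i', j', e, rfl, h'⟩
    · exact Or.inr (Or.inr ⟨i, j, rfl, rfl, h⟩)
    · exact absurd e.symm (sidePt_ne_cornerPt h0' h1')
    · cases cornerPt_injective e
      exact Or.inr (Or.inr ⟨i, j', rfl, rfl, h.trans h'⟩)

theorem Ident.of_glued {t t' : L.Tile} {i j : ZMod 5} (h : L.Glued t i t' j) (s : I) :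
    L.Ident t (sidePt i s) t' (sidePt j (unitInterval.symm s)) := by
  have h' : L.Adj t i t' j := Or.inl h
  rcases eq_or_ne s 0 with rfl | h0
  · exact Or.inr (Or.inr ⟨i, j + 1, by simp, by simp, h'.vert_left⟩)
  rcases eq_or_ne s 1 with rfl | h1
  · exact Or.inr (Or.inr ⟨i + 1, j, by simp, by simp, h'.vert_right⟩)
  · exact Or.inr (Or.inl ⟨i, j, s, h', h0, h1, rfl, rfl⟩)

theorem EdgeRegular.pt_eq_iff (hL : L.EdgeRegular) {t t' : L.Tile} {p p' : pentagon} :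
    L.pt t p = L.pt t' p' ↔ L.Ident t p t' p' := by
  refine ⟨fun h => ?_, Ident.pt_eq⟩
  have h := Quot.eqvGen_exact h
  suffices ∀ x y, Relation.EqvGen L.GlueRel x y → L.Ident x.1 x.2 y.1 y.2 from this _ _ h
  intro x y h
  induction h with
  | rel x y h => obtain ⟨t, i, t', j, s, h⟩ := h; exact Ident.of_glued h s
  | refl x => exact Or.inl ⟨rfl, rfl⟩
  | symm x y _ h => exact h.symm
  | trans x y z _ _ h h' => exact h.trans hL h'

/-! ### Touching tiles -/

/-- Two tiles touch if they have a common point. -/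
def Touch (L : PentComplex) (t t' : L.Tile) : Prop := ∃ p p', L.pt t p = L.pt t' p'

theorem Touch.refl (t : L.Tile) : L.Touch t t := ⟨cornerPt 0, cornerPt 0, rfl⟩

theorem Touch.symm {t t' : L.Tile} : L.Touch t t' → L.Touch t' t
  | ⟨p, p', h⟩ => ⟨p', p, h.symm⟩

theorem Adj.touch {t t' : L.Tile} {i j : ZMod 5} (h : L.Adj t i t' j) : L.Touch t t' :=
  ⟨_, _, h.pt_eq 0⟩

theorem touch_of_vert_eq {t t' : L.Tile} {i j : ZMod 5} (h : L.vert t i = L.vert t' j) :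
    L.Touch t t' := ⟨_, _, pt_cornerPt_eq_iff.2 h⟩

theorem EdgeRegular.exists_vert_eq (hL : L.EdgeRegular) {t t' : L.Tile} (h : L.Touch t t') :
    ∃ i j, L.vert t i = L.vert t' j := by
  obtain ⟨p, p', h⟩ := h
  rcases hL.pt_eq_iff.1 h with ⟨rfl, rfl⟩ | ⟨i, j, s, h, -⟩ | ⟨i, j, -, -, h⟩
  · exact ⟨0, 0, rfl⟩
  · exact ⟨_, _, h.vert_left⟩
  · exact ⟨_, _, h⟩

/-- The tiles that can be reached from `t` in `k` steps between touching tiles. -/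
def tball (L : PentComplex) (t : L.Tile) : ℕ → Set L.Tile
  | 0 => {t}
  | k + 1 => {u | ∃ u' ∈ tball L t k, L.Touch u' u}

theorem tball_succ_subset (t : L.Tile) (k : ℕ) : L.tball t k ⊆ L.tball t (k + 1) :=
  fun u hu => ⟨u, hu, Touch.refl u⟩

theorem tball_mono (t : L.Tile) : Monotone (L.tball t) :=
  monotone_nat_of_le_succ (tball_succ_subset t)

theorem mem_tball_self (t : L.Tile) (k : ℕ) : t ∈ L.tball t k :=
  tball_mono t (Nat.zero_le k) rfl

theorem tball_add {t u v : L.Tile} {k l : ℕ} (hu : u ∈ L.tball t k) (hv : v ∈ L.tball u l) :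
    v ∈ L.tball t (k + l) := by
  induction l generalizing v with
  | zero => cases hv; exact hu
  | succ l ih =>
    obtain ⟨w, hw, h⟩ := hv
    exact ⟨w, ih hw, h⟩

theorem Touch.mem_tball {t u : L.Tile} (h : L.Touch t u) : u ∈ L.tball t 1 := ⟨t, rfl, h⟩

theorem tball_symm {t u : L.Tile} {k : ℕ} (hu : u ∈ L.tball t k) : t ∈ L.tball u k := by
  induction k generalizing u with
  | zero => cases hu; rfl
  | succ l ih =>
    obtain ⟨w, hw, h⟩ := hu
    rw [add_comm]
    exact tball_add h.symm.mem_tball (ih hw)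

/-- Any two tiles are joined by a chain of touching tiles. -/
def Chained (L : PentComplex) : Prop := ∀ t u : L.Tile, ∃ k, u ∈ L.tball t k

/-! ### The topology of the realization -/

theorem continuous_pt (t : L.Tile) : Continuous (L.pt t) :=
  continuous_quot_mk.comp continuous_sigmaMk

theorem isOpen_iff {U : Set L.Realization} : IsOpen U ↔ ∀ t, IsOpen (L.pt t ⁻¹' U) := by
  refine ((isQuotientMap_quot_mk (r := L.GlueRel)).isOpen_preimage (s := U)).symm.trans ?_
  rw [isOpen_sigma_iff]
  rfl

theorem continuous_of_pt {Y : Type*} [TopologicalSpace Y] {f : L.Realization → Y}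
    (h : ∀ t, Continuous fun p => f (L.pt t p)) : Continuous f := by
  refine ⟨fun U hU => isOpen_iff.2 fun t => ?_⟩
  exact hU.preimage (h t)

theorem Realization.ind {P : L.Realization → Prop} (h : ∀ t p, P (L.pt t p)) (x : L.Realization) :
    P x := Quot.ind (fun a => h a.1 a.2) x

theorem Realization.exists_pt (x : L.Realization) : ∃ t p, x = L.pt t p :=
  Realization.ind (P := fun x => ∃ t p, x = L.pt t p) (fun t p => ⟨t, p, rfl⟩) x

/-! ### Paths and the metric -/

/-- A function that is non-expanding on every tile. -/
def TileLipschitz (L : PentComplex) (f : L.Realization → ℝ) : Prop :=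
  ∀ t p q, |f (L.pt t p) - f (L.pt t q)| ≤ dist p q

theorem TileLipschitz.continuous {f : L.Realization → ℝ} (hf : L.TileLipschitz f) :
    Continuous f := by
  refine continuous_of_pt fun t => LipschitzWith.continuous (K := 1) ?_
  exact LipschitzWith.of_dist_le_mul fun p q => by
    rw [Real.dist_eq, NNReal.coe_one, one_mul]; exact hf t p q

theorem PolyPath.abs_sub_le {f : L.Realization → ℝ} (hf : L.TileLipschitz f)
    {x y : L.Realization} {r : ℝ} (h : L.PolyPath x y r) : |f x - f y| ≤ r := by
  induction h with
  | nil x => simp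
  | cons t p q y r h ih =>
    calc |f (L.pt t p) - f y| ≤ |f (L.pt t p) - f (L.pt t q)| + |f (L.pt t q) - f y| :=
          _root_.abs_sub_le _ _ _
      _ ≤ _ := add_le_add (hf t p q) ih

theorem PolyPath.nonneg {x y : L.Realization} {r : ℝ} (h : L.PolyPath x y r) : 0 ≤ r := by
  induction h with
  | nil x => exact le_rfl
  | cons t p q y r h ih => positivity

theorem PolyPath.append {x y z : L.Realization} {r s : ℝ} (h : L.PolyPath x y r)
    (h' : L.PolyPath y z s) : L.PolyPath x z (r + s) := by
  induction h with
  | nil x => simpa using h'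
  | cons t p q y r h ih => rw [add_assoc]; exact PolyPath.cons t p q z _ (ih h')

theorem PolyPath.single (t : L.Tile) (p q : pentagon) :
    L.PolyPath (L.pt t p) (L.pt t q) (dist p q) := by
  simpa using PolyPath.cons t p q _ 0 (PolyPath.nil _)

theorem PolyPath.symm {x y : L.Realization} {r : ℝ} (h : L.PolyPath x y r) :
    L.PolyPath y x r := by
  induction h with
  | nil x => exact PolyPath.nil x
  | cons t p q y r h ih =>
    rw [add_comm, dist_comm]
    exact ih.append (PolyPath.single t q p)

theorem Chained.exists_path (hL : L.Chained) (x y : L.Realization) : ∃ r, L.PolyPath x y r := by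
  obtain ⟨t, p, rfl⟩ := x.exists_pt
  obtain ⟨u, q, rfl⟩ := y.exists_pt
  obtain ⟨k, hk⟩ := hL t u
  induction k generalizing u q with
  | zero => cases hk; exact ⟨_, PolyPath.single _ _ _⟩
  | succ k ih =>
    obtain ⟨w, hw, a, b, h⟩ := hk
    obtain ⟨r, hr⟩ := ih w a hw
    rw [h] at hr
    exact ⟨_, hr.append (PolyPath.single u b q)⟩

theorem bddBelow_path (x y : L.Realization) : BddBelow {r | L.PolyPath x y r} :=
  ⟨0, fun _ h => PolyPath.nonneg h⟩

theorem PolyPath.affDist_le {x y : L.Realization} {r : ℝ} (h : L.PolyPath x y r) :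
    L.affDist x y ≤ r := csInf_le (bddBelow_path x y) h

theorem affDist_nonneg (x y : L.Realization) : 0 ≤ L.affDist x y :=
  Real.sInf_nonneg fun _ h => PolyPath.nonneg h

@[simp] theorem affDist_self (x : L.Realization) : L.affDist x x = 0 :=
  le_antisymm (PolyPath.nil x).affDist_le (affDist_nonneg x x)

theorem affDist_comm (x y : L.Realization) : L.affDist x y = L.affDist y x := by
  unfold affDist; congr 1; ext r; exact ⟨PolyPath.symm, PolyPath.symm⟩

theorem affDist_pt_le (t : L.Tile) (p q : pentagon) :
    L.affDist (L.pt t p) (L.pt t q) ≤ dist p q := (PolyPath.single t p q).affDist_le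

theorem Chained.exists_path_lt (hL : L.Chained) {x y : L.Realization} {r : ℝ}
    (h : L.affDist x y < r) : ∃ s < r, L.PolyPath x y s := by
  obtain ⟨s, hs, h'⟩ := exists_lt_of_csInf_lt (hL.exists_path x y) h
  exact ⟨s, h', hs⟩

theorem Chained.affDist_triangle (hL : L.Chained) (x y z : L.Realization) :
    L.affDist x z ≤ L.affDist x y + L.affDist y z := by
  refine le_of_forall_pos_lt_add fun ε hε => ?_
  obtain ⟨r, hr, h⟩ := hL.exists_path_lt (show L.affDist x y < L.affDist x y + ε / 2 by linarith)
  obtain ⟨s, hs, h'⟩ := hL.exists_path_lt (show L.affDist y z < L.affDist y z + ε / 2 by linarith)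
  linarith [(h.append h').affDist_le]

/-- Lower bounds for `affDist` are obtained from functions of this kind. -/
theorem TileLipschitz.abs_sub_le {f : L.Realization → ℝ} (hf : L.TileLipschitz f) (hL : L.Chained)
    (x y : L.Realization) : |f x - f y| ≤ L.affDist x y :=
  le_csInf (hL.exists_path x y) fun _ h => PolyPath.abs_sub_le hf h

/-- A path that stays in tiles on which a map is tilewise isometric is mapped to a path. -/
theorem PolyPath.map {L' : PentComplex} {φ : L.Realization → L'.Realization} {S : Set L.Tile}
    (hφ : ∀ t ∈ S, ∃ t', ∃ g : pentagon ≃ᵢ pentagon, ∀ p, φ (L.pt t p) = L'.pt t' (g p))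
    {f : L.Realization → ℝ} (hf : L.TileLipschitz f) {b : ℝ}
    (hS : ∀ t p, f (L.pt t p) ≤ b → t ∈ S) {x y : L.Realization} {r : ℝ} (h : L.PolyPath x y r)
    (hb : f x + r ≤ b) : L'.PolyPath (φ x) (φ y) r := by
  induction h with
  | nil x => exact PolyPath.nil _
  | cons t p q y r h ih =>
    have h1 := h.nonneg
    have h2 := (abs_le.1 (hf t p q)).1
    obtain ⟨t', g, hg⟩ := hφ t (hS t p (by linarith [dist_nonneg (x := p) (y := q)]))
    have h3 := ih (by linarith)
    rw [hg] at h3 ⊢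
    rw [← g.dist_eq]
    exact PolyPath.cons t' (g p) (g q) _ r h3

/-! ### Functions that control the metric -/

theorem lift_tileLipschitz (F : L.Tile → pentagon → ℝ)
    (h1 : ∀ t p q, F t p ≤ F t q + dist p q)
    (h2 : ∀ t i t' j, L.Glued t i t' j → ∀ s, F t (sidePt i s) = F t' (sidePt j (unitInterval.symm s))) :
    ∃ f : L.Realization → ℝ, L.TileLipschitz f ∧ ∀ t p, f (L.pt t p) = F t p := by
  refine ⟨Quot.lift (fun x => F x.1 x.2) ?_, fun t p q => ?_, fun t p => rfl⟩
  · rintro _ _ ⟨t, i, t', j, s, h⟩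
    exact h2 t i t' j h s
  · change |F t p - F t q| ≤ _
    rw [abs_le]
    have := h1 t p q
    have := h1 t q p
    rw [dist_comm] at this
    constructor <;> linarith

/-- The combinatorial distance of a point from the tile `t₀`. -/
def level (L : PentComplex) (t₀ : L.Tile) (x : L.Realization) : ℕ :=
  sInf {k | ∃ t ∈ L.tball t₀ k, ∃ p, L.pt t p = x}

theorem Chained.level_le_succ (hL : L.Chained) (t₀ t : L.Tile) (p q : pentagon) :
    L.level t₀ (L.pt t p) ≤ L.level t₀ (L.pt t q) + 1 := by
  have hne : {k | ∃ u ∈ L.tball t₀ k, ∃ p', L.pt u p' = L.pt t q}.Nonempty := by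
    obtain ⟨k, hk⟩ := hL t₀ t
    exact ⟨k, t, hk, q, rfl⟩
  obtain ⟨u, hu, p', h⟩ := Nat.sInf_mem hne
  exact Nat.sInf_le ⟨t, ⟨u, hu, p', q, h⟩, p, rfl⟩

theorem Chained.mem_tball_level (hL : L.Chained) (t₀ t : L.Tile) (p : pentagon) :
    t ∈ L.tball t₀ (L.level t₀ (L.pt t p) + 1) := by
  have hne : {k | ∃ u ∈ L.tball t₀ k, ∃ p', L.pt u p' = L.pt t p}.Nonempty := by
    obtain ⟨k, hk⟩ := hL t₀ t
    exact ⟨k, t, hk, p, rfl⟩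
  obtain ⟨u, hu, p', h⟩ := Nat.sInf_mem hne
  exact ⟨u, hu, p', p, h⟩

theorem level_self (t₀ : L.Tile) (p : pentagon) : L.level t₀ (L.pt t₀ p) = 0 :=
  Nat.le_zero.1 (Nat.sInf_le ⟨t₀, rfl, p, rfl⟩)

/-- A path of bounded length meets only tiles at bounded combinatorial distance. -/
theorem Chained.exists_control (hL : L.Chained) (t₀ : L.Tile) :
    ∃ f : L.Realization → ℝ, L.TileLipschitz f ∧ (∀ p, f (L.pt t₀ p) ≤ 0) ∧
      ∀ t p (r : ℝ), f (L.pt t p) ≤ r → t ∈ L.tball t₀ (⌈2 * r⌉₊ + 5) := by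
  -- The levels of two corners of a tile differ by at most 1. Half of the level thus varies by at
  -- most 1/2 within a tile, which leaves room for the comparison on the sides.
  let a : L.Tile → ZMod 5 → ℝ := fun t i => (L.level t₀ (L.pt t (cornerPt i)) : ℝ) / 2
  have ha : ∀ t i j, a t i ≤ a t j + 1 / 2 := by
    intro t i j
    have := hL.level_le_succ t₀ t (cornerPt i) (cornerPt j)
    have : (L.level t₀ (L.pt t (cornerPt i)) : ℝ) ≤ L.level t₀ (L.pt t (cornerPt j)) + 1 := by
      exact_mod_cast this
    simp only [a]; linarith
  have hu : (Finset.univ : Finset (ZMod 5)).Nonempty := ⟨0, Finset.mem_univ _⟩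
  -- A maximum of functions of slope one, with one peak at each corner.
  let F : L.Tile → pentagon → ℝ := fun t p =>
    Finset.univ.sup' hu fun i => a t i - dist p (cornerPt i)
  have hF : ∀ t i p, a t i - dist p (cornerPt i) ≤ F t p := fun t i p =>
    Finset.le_sup' (fun i => a t i - dist p (cornerPt i)) (Finset.mem_univ i)
  -- The three other corners are at distance at least 1 and their values exceed those at the ends by
  -- at most 1/2, while the nearer end is at distance at most 1/2. So only the ends count.
  have hFs : ∀ t i s, F t (sidePt i s) = max (a t i - s) (a t (i + 1) - (1 - s)) := by
    intro t i s
    have e1 := dist_cornerPt_sidePt i s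
    have e2 := dist_cornerPt_succ_sidePt i s
    apply le_antisymm
    · refine Finset.sup'_le _ _ fun j _ => ?_
      rw [dist_comm]
      by_cases h0 : j = i
      · subst h0; rw [e1]; exact le_max_left _ _
      by_cases h1 : j = i + 1
      · subst h1; rw [e2]; exact le_max_right _ _
      have h2 := one_le_dist_sidePt h0 h1 s
      rcases le_total (s : ℝ) (1 / 2) with hs | hs
      · refine le_trans ?_ (le_max_left _ _); linarith [ha t j i]
      · refine le_trans ?_ (le_max_right _ _); linarith [ha t j (i + 1)]
    · refine max_le ?_ ?_
      · rw [← e1, dist_comm]; exact hF _ _ _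
      · rw [← e2, dist_comm]; exact hF _ _ _
  obtain ⟨f, hf, hfF⟩ := lift_tileLipschitz F (fun t p q => by
    refine Finset.sup'_le _ _ fun i _ => ?_
    have := hF t i q
    have := dist_triangle q p (cornerPt i)
    rw [dist_comm q p] at this
    linarith) (fun t i t' j h s => by
    have h' : L.Adj t i t' j := Or.inl h
    have e1 : a t i = a t' (j + 1) := by
      simp only [a]; rw [pt_cornerPt_eq_iff.2 h'.vert_left]
    have e2 : a t (i + 1) = a t' j := by
      simp only [a]; rw [pt_cornerPt_eq_iff.2 h'.vert_right]
    rw [hFs, hFs, e1, e2, max_comm, unitInterval.coe_symm_eq, sub_sub_cancel])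
  refine ⟨f, hf, fun p => ?_, fun t p r h => ?_⟩
  · rw [hfF]
    refine Finset.sup'_le _ _ fun i _ => ?_
    simp only [a, level_self]
    simp [dist_nonneg]
  -- A point of the tile has distance at most 2 from corner 0, so half of the level there is at most
  -- r + 2 and the level at most 2r + 4; the tile itself is one step further.
  · rw [hfF] at h
    have h1 := hF t 0 p
    have h2 := dist_le_two p (cornerPt 0)
    have h3 : (L.level t₀ (L.pt t (cornerPt 0)) : ℝ) ≤ (⌈2 * r⌉₊ + 4 : ℕ) := by
      push_cast
      have := Nat.le_ceil (2 * r)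
      simp only [a] at h1
      linarith
    exact tball_mono t₀ (Nat.succ_le_succ (Nat.cast_le.1 h3)) (hL.mem_tball_level t₀ t (cornerPt 0))

open Classical in
/-- The capped distance from a point. -/
theorem exists_separating (hinj : ∀ t, Function.Injective (L.pt t)) (y : L.Realization)
    (hfin : {x : L.Tile × pentagon | L.pt x.1 x.2 = y}.Finite) :
    ∃ f : L.Realization → ℝ, L.TileLipschitz f ∧ f y = 0 ∧ ∀ z, f z = 0 → z = y := by
  -- The cap `δ` is at most the distance of every preimage of `y` from the sides of its tile that do
  -- not contain it. It is positive because there are finitely many preimages.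
  have hδ : ∃ δ > 0, ∀ t p, L.pt t p = y → ∀ i, p ∉ Set.range (sidePt i) →
      ∀ s, δ ≤ dist p (sidePt i s) := by
    have h1 : ∀ x : L.Tile × pentagon, ∃ δ > 0, ∀ i, x.2 ∉ Set.range (sidePt i) →
        ∀ s, δ ≤ dist x.2 (sidePt i s) := by
      intro x
      have h2 : ∀ i, ∃ δ > 0, x.2 ∉ Set.range (sidePt i) → ∀ s, δ ≤ dist x.2 (sidePt i s) := by
        intro i
        by_cases hx : x.2 ∈ Set.range (sidePt i)
        · exact ⟨1, one_pos, fun h => absurd hx h⟩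
        · have hcl : IsClosed (Set.range (sidePt i)) :=
            (isCompact_range (continuous_sidePt i)).isClosed
          have hne : (Set.range (sidePt i)).Nonempty := ⟨_, 0, rfl⟩
          exact ⟨Metric.infDist x.2 (Set.range (sidePt i)), (hcl.notMem_iff_infDist_pos hne).1 hx,
            fun _ s => Metric.infDist_le_dist_of_mem ⟨s, rfl⟩⟩
      choose d hd hd' using h2
      obtain ⟨i, -, hi⟩ := Finset.exists_min_image Finset.univ d ⟨0, Finset.mem_univ _⟩
      exact ⟨d i, hd i, fun j hj s => (hi j (Finset.mem_univ _)).trans (hd' j hj s)⟩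
    choose d hd hd' using h1
    rcases Set.eq_empty_or_nonempty {x : L.Tile × pentagon | L.pt x.1 x.2 = y} with h0 | h0
    · refine ⟨1, one_pos, fun t p h => ?_⟩
      have : ((t, p) : L.Tile × pentagon) ∈ {x : L.Tile × pentagon | L.pt x.1 x.2 = y} := h
      rw [h0] at this; exact this.elim
    · obtain ⟨x, -, hx⟩ := Set.exists_min_image _ d hfin h0
      exact ⟨d x, hd x, fun t p h i hi s => (hx (t, p) h).trans (hd' (t, p) i hi s)⟩
  obtain ⟨δ, hδ0, hδ⟩ := hδ
  -- On a side through `y` both tiles measure the same distance along the side; on a side that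
  -- misses `y` both give the constant `δ`. So the values agree under the gluings.
  let F : L.Tile → pentagon → ℝ := fun t p =>
    if h : ∃ q, L.pt t q = y then min δ (dist h.choose p) else δ
  have hF : ∀ t q p, L.pt t q = y → F t p = min δ (dist q p) := by
    intro t q p hq
    have h : ∃ q, L.pt t q = y := ⟨q, hq⟩
    simp only [F]
    rw [dif_pos h, hinj t (h.choose_spec.trans hq.symm)]
  have hF' : ∀ t p, (¬ ∃ q, L.pt t q = y) → F t p = δ := fun t p h => dif_neg h
  have hFar : ∀ t i s, (∀ q, L.pt t q = y → q ∉ Set.range (sidePt i)) →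
      F t (sidePt i s) = δ := by
    intro t i s h
    by_cases hy : ∃ q, L.pt t q = y
    · obtain ⟨q, hq⟩ := hy
      rw [hF t q _ hq, min_eq_left (hδ t q hq i (h q hq) s)]
    · exact hF' t _ hy
  obtain ⟨f, hf, hfF⟩ := lift_tileLipschitz F (fun t p q => by
    by_cases hy : ∃ q, L.pt t q = y
    · obtain ⟨w, hw⟩ := hy
      rw [hF t w _ hw, hF t w _ hw]
      have := dist_triangle w q p
      rw [dist_comm q p] at this
      rcases min_cases δ (dist w q) with ⟨h, -⟩ | ⟨h, -⟩ <;> rw [h]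
      · linarith [min_le_left δ (dist w p), dist_nonneg (x := p) (y := q)]
      · linarith [min_le_right δ (dist w p)]
    · rw [hF' t _ hy, hF' t _ hy]; linarith [dist_nonneg (x := p) (y := q)]) (fun t i t' j h s => by
    by_cases hc : ∃ s₀, L.pt t (sidePt i s₀) = y
    · obtain ⟨s₀, hs₀⟩ := hc
      have hs₁ := pt_eq_of_glued h s₀
      rw [hF _ _ _ hs₀, hF _ _ _ (hs₁.symm.trans hs₀), dist_sidePt, dist_sidePt,
        unitInterval.coe_symm_eq, unitInterval.coe_symm_eq, abs_sub_comm]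
      congr 2; ring
    · rw [hFar, hFar]
      · rintro q hq ⟨s₁, rfl⟩
        refine hc ⟨unitInterval.symm s₁, ?_⟩
        rw [pt_eq_of_glued h, unitInterval.symm_symm, hq]
      · rintro q hq ⟨s₁, rfl⟩
        exact hc ⟨s₁, hq⟩)
  refine ⟨f, hf, ?_, fun z hz => ?_⟩
  · obtain ⟨t, p, rfl⟩ := y.exists_pt
    rw [hfF, hF t p p rfl, dist_self, min_eq_right hδ0.le]
  · obtain ⟨t, p, rfl⟩ := z.exists_pt
    rw [hfF] at hz
    by_cases hy : ∃ q, L.pt t q = y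
    · obtain ⟨q, hq⟩ := hy
      rw [hF t q p hq] at hz
      rcases min_cases δ (dist q p) with ⟨h, -⟩ | ⟨h, -⟩ <;> rw [h] at hz
      · exact absurd hz hδ0.ne'
      · rw [← hq, dist_eq_zero.1 hz]
    · rw [hF' t p hy] at hz; exact absurd hz hδ0.ne'

end PentComplex

namespace PentComplex

variable {X : PentComplex}

/-! ### Regular complexes -/

/-- Every side is glued to some side. -/
def Complete (X : PentComplex) : Prop := ∀ t i, ∃ t' j, X.Adj t i t' j

/-- The local properties of the complexes `K_n`: sides are glued in pairs, the corners of a tile are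
different, two tiles have at most two common vertices, and vertices have at most four corners. -/
structure Regular (X : PentComplex) : Prop where
  edge : X.EdgeRegular
  vert_inj : ∀ ⦃t i j⦄, X.vert t i = X.vert t j → i = j
  share : ∀ ⦃t t'⦄, t ≠ t' → ∀ ⦃i₁ i₂ i₃⦄, (∃ j, X.vert t i₁ = X.vert t' j) →
    (∃ j, X.vert t i₂ = X.vert t' j) → (∃ j, X.vert t i₃ = X.vert t' j) →
    i₁ = i₂ ∨ i₁ = i₃ ∨ i₂ = i₃
  deg : ∀ (v : X.Vertex) (s : Finset (X.Tile × ZMod 5)),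
    (∀ a ∈ s, X.vert a.1 a.2 = v) → s.card ≤ 4

/-- The edges of a complex. -/
def EdgeCls (X : PentComplex) : Type :=
  Quot fun a b : X.Tile × ZMod 5 => X.Glued a.1 a.2 b.1 b.2

/-- The class of the `i`-th side of `t`. -/
def edgeCls (X : PentComplex) (t : X.Tile) (i : ZMod 5) : X.EdgeCls := Quot.mk _ (t, i)

theorem Adj.edgeCls_eq {t t' : X.Tile} {i j : ZMod 5} (h : X.Adj t i t' j) :
    X.edgeCls t i = X.edgeCls t' j := by
  rcases h with h | h
  · exact Quot.sound h
  · exact (Quot.sound h).symm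

theorem EdgeRegular.edgeCls_eq_iff (hX : X.EdgeRegular) {t t' : X.Tile} {i j : ZMod 5} :
    X.edgeCls t i = X.edgeCls t' j ↔ (t = t' ∧ i = j) ∨ X.Adj t i t' j := by
  constructor
  · intro h
    have h := Quot.eqvGen_exact h
    suffices ∀ a b : X.Tile × ZMod 5, Relation.EqvGen
        (fun a b : X.Tile × ZMod 5 => X.Glued a.1 a.2 b.1 b.2) a b →
        (a.1 = b.1 ∧ a.2 = b.2) ∨ X.Adj a.1 a.2 b.1 b.2 from this _ _ h
    intro a b h
    induction h with
    | rel x y h => exact Or.inr (Or.inl h)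
    | refl x => exact Or.inl ⟨rfl, rfl⟩
    | symm x y _ h =>
      rcases h with ⟨h1, h2⟩ | h
      · exact Or.inl ⟨h1.symm, h2.symm⟩
      · exact Or.inr h.symm
    | trans x y z _ _ h h' =>
      obtain ⟨x1, x2⟩ := x; obtain ⟨y1, y2⟩ := y; obtain ⟨z1, z2⟩ := z
      rcases h with ⟨rfl, rfl⟩ | h
      · exact h'
      · rcases h' with ⟨rfl, rfl⟩ | h'
        · exact Or.inr h
        · exact Or.inl (hX h.symm h')
  · rintro (⟨rfl, rfl⟩ | h)
    · rfl
    · exact h.edgeCls_eq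

/-- The endpoints of an edge. -/
def ends (X : PentComplex) : X.EdgeCls → Set X.Vertex :=
  Quot.lift (fun a => {X.vert a.1 a.2, X.vert a.1 (a.2 + 1)}) (by
    rintro ⟨t, i⟩ ⟨t', j⟩ h
    have h : X.Adj t i t' j := Or.inl h
    simp only
    rw [h.vert_left, h.vert_right, Set.pair_comm])

theorem zmod_five_ne_add {k : ZMod 5} (hk : k ≠ 0) (i : ZMod 5) : i + k ≠ i := by
  simpa using hk

/-- Gluings reverse sides, so `i = j + 1` and `i + 1 = j`, that is, 2 = 0 modulo 5. -/
theorem Regular.not_adj_self (hX : X.Regular) (t : X.Tile) (i j : ZMod 5) : ¬ X.Adj t i t j := by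
  intro h
  have h1 := hX.vert_inj h.vert_left
  have h2 := hX.vert_inj h.vert_right
  subst h1
  rw [add_assoc] at h2
  exact zmod_five_ne_add (by decide) _ h2

theorem Regular.edgeCls_inj (hX : X.Regular) {t : X.Tile} {i j : ZMod 5}
    (h : X.edgeCls t i = X.edgeCls t j) : i = j := by
  rcases hX.edge.edgeCls_eq_iff.1 h with h | h
  · exact h.2
  · exact absurd h (hX.not_adj_self t i j)

/-! ### The vertices of the subdivision -/

/-- The kinds of vertices of the subdivision: old vertices, midpoints of edges, and corners of
central pentagons. -/
inductive VertexKind (X : PentComplex)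
  | old (v : X.Vertex)
  | mid (e : X.EdgeCls)
  | inner (t : X.Tile) (i : ZMod 5)

/-- The kind of a corner of a tile of the subdivision. -/
def cornerKind (X : PentComplex) (a : (X.Tile × Option (ZMod 5)) × ZMod 5) : X.VertexKind :=
  match a.1.2 with
  | none => .inner a.1.1 a.2
  | some i =>
    if a.2 = 0 then .old (X.vert a.1.1 i)
    else if a.2 = 1 then .mid (X.edgeCls a.1.1 i)
    else if a.2 = 2 then .inner a.1.1 i
    else if a.2 = 3 then .inner a.1.1 (i - 1)
    else .mid (X.edgeCls a.1.1 (i - 1))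

theorem cornerKind_none (t : X.Tile) (i : ZMod 5) :
    X.cornerKind ((t, none), i) = .inner t i := rfl
theorem cornerKind_zero (t : X.Tile) (i : ZMod 5) :
    X.cornerKind ((t, some i), 0) = .old (X.vert t i) := rfl
theorem cornerKind_one (t : X.Tile) (i : ZMod 5) :
    X.cornerKind ((t, some i), 1) = .mid (X.edgeCls t i) := rfl
theorem cornerKind_two (t : X.Tile) (i : ZMod 5) :
    X.cornerKind ((t, some i), 2) = .inner t i := rfl
theorem cornerKind_three (t : X.Tile) (i : ZMod 5) :
    X.cornerKind ((t, some i), 3) = .inner t (i - 1) := rfl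
theorem cornerKind_four (t : X.Tile) (i : ZMod 5) :
    X.cornerKind ((t, some i), 4) = .mid (X.edgeCls t (i - 1)) := rfl

/-- Invariance under gluings shows that corners of different kinds are at different vertices. Only
this direction is needed to bound the vertices of the subdivision. -/
theorem cornerKind_of_glued {A B : X.Tile × Option (ZMod 5)} {a b : ZMod 5}
    (h : X.SubGlued A a B b) : X.cornerKind (A, a) = X.cornerKind (B, b + 1) ∧
      X.cornerKind (A, a + 1) = X.cornerKind (B, b) := by
  cases h with
  | central t i =>
    rw [show (2 + 1 : ZMod 5) = 3 from rfl, cornerKind_three, cornerKind_none,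
      add_sub_cancel_right, cornerKind_two, cornerKind_none]
    exact ⟨rfl, rfl⟩
  | spoke t i =>
    rw [show (3 + 1 : ZMod 5) = 4 from rfl, show (1 + 1 : ZMod 5) = 2 from rfl, cornerKind_one,
      cornerKind_four, cornerKind_two, cornerKind_three, add_sub_cancel_right]
    exact ⟨rfl, rfl⟩
  | firstHalf t i t' j h =>
    rw [show (4 + 1 : ZMod 5) = 0 from rfl, show (0 + 1 : ZMod 5) = 1 from rfl, cornerKind_zero,
      cornerKind_zero, cornerKind_four, cornerKind_one, add_sub_cancel_right,
      Adj.vert_left (Or.inl h), Adj.edgeCls_eq (Or.inl h)]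
    exact ⟨rfl, rfl⟩
  | secondHalf t i t' j h =>
    rw [show (4 + 1 : ZMod 5) = 0 from rfl, show (0 + 1 : ZMod 5) = 1 from rfl, cornerKind_zero,
      cornerKind_zero, cornerKind_four, cornerKind_one, add_sub_cancel_right,
      Adj.vert_right (Or.inl h), Adj.edgeCls_eq (Or.inl h)]
    exact ⟨rfl, rfl⟩

/-- The kind of a vertex of the subdivision. -/
def kind (X : PentComplex) : X.subdivide.Vertex → X.VertexKind :=
  Quot.lift X.cornerKind (by
    rintro _ _ (⟨h⟩ | ⟨h⟩)
    · exact (cornerKind_of_glued h).1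
    · exact (cornerKind_of_glued h).2)

theorem SubGlued.elim {A B : X.Tile × Option (ZMod 5)} {a b : ZMod 5} (h : X.SubGlued A a B b) :
    (∃ t, A = (t, none) ∧ B = (t, some (a + 1)) ∧ b = 2) ∨
    (∃ t i, A = (t, some i) ∧ a = 1 ∧ B = (t, some (i + 1)) ∧ b = 3) ∨
    (∃ t i t' j, X.Glued t i t' j ∧ A = (t, some i) ∧ a = 0 ∧ B = (t', some (j + 1)) ∧ b = 4) ∨
    (∃ t i t' j, X.Glued t i t' j ∧ A = (t, some (i + 1)) ∧ a = 4 ∧ B = (t', some j) ∧ b = 0) := by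
  cases h with
  | central t i => exact Or.inl ⟨t, rfl, rfl, rfl⟩
  | spoke t i => exact Or.inr (Or.inl ⟨t, i, rfl, rfl, rfl, rfl⟩)
  | firstHalf t i t' j h => exact Or.inr (Or.inr (Or.inl ⟨t, i, t', j, h, rfl, rfl, rfl, rfl⟩))
  | secondHalf t i t' j h => exact Or.inr (Or.inr (Or.inr ⟨t, i, t', j, h, rfl, rfl, rfl, rfl⟩))

/-- The adjacency in the subdivision, from the point of view of one tile. -/
theorem Adj.subdivide_elim {A B : X.Tile × Option (ZMod 5)} {a b : ZMod 5}
    (h : X.subdivide.Adj A a B b) :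
    (∃ t, A = (t, none) ∧ B = (t, some (a + 1)) ∧ b = 2) ∨
    (∃ t i, A = (t, some i) ∧ a = 2 ∧ B = (t, none) ∧ b = i - 1) ∨
    (∃ t i, A = (t, some i) ∧ a = 1 ∧ B = (t, some (i + 1)) ∧ b = 3) ∨
    (∃ t i, A = (t, some i) ∧ a = 3 ∧ B = (t, some (i - 1)) ∧ b = 1) ∨
    (∃ t i t' j, X.Adj t i t' j ∧ A = (t, some i) ∧ a = 0 ∧ B = (t', some (j + 1)) ∧ b = 4) ∨
    (∃ t i t' j, X.Adj t (i - 1) t' j ∧ A = (t, some i) ∧ a = 4 ∧ B = (t', some j) ∧ b = 0) := by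
  rcases h with h | h
  · rcases SubGlued.elim h with h | h | ⟨t, i, t', j, h, h'⟩ | ⟨t, i, t', j, h, h'⟩
    · exact Or.inl h
    · exact Or.inr (Or.inr (Or.inl h))
    · exact Or.inr (Or.inr (Or.inr (Or.inr (Or.inl ⟨t, i, t', j, Or.inl h, h'⟩))))
    · exact Or.inr (Or.inr (Or.inr (Or.inr (Or.inr ⟨t, i + 1, t', j,
        by rw [add_sub_cancel_right]; exact Or.inl h, h'⟩))))
  · rcases SubGlued.elim h with ⟨t, h1, h2, h3⟩ | ⟨t, i, h1, h2, h3, h4⟩ |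
      ⟨t, i, t', j, h, h1, h2, h3, h4⟩ | ⟨t, i, t', j, h, h1, h2, h3, h4⟩
    · exact Or.inr (Or.inl ⟨t, b + 1, h2, h3, h1, by ring⟩)
    · exact Or.inr (Or.inr (Or.inr (Or.inl ⟨t, i + 1, h3, h4, by rw [h1]; simp, h2⟩)))
    · exact Or.inr (Or.inr (Or.inr (Or.inr (Or.inr ⟨t', j + 1, t, i,
        by rw [add_sub_cancel_right]; exact Or.inr h, h3, h4, h1, h2⟩))))
    · exact Or.inr (Or.inr (Or.inr (Or.inr (Or.inl ⟨t', j, t, i, Or.inr h, h3, h4, h1, h2⟩))))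

theorem EdgeRegular.subdivide (hX : X.EdgeRegular) : X.subdivide.EdgeRegular := by
  intro A a B b B' b' h h'
  have n1 : (0 : ZMod 5) ≠ 1 := by decide
  have n2 : (0 : ZMod 5) ≠ 2 := by decide
  have n3 : (0 : ZMod 5) ≠ 3 := by decide
  have n4 : (0 : ZMod 5) ≠ 4 := by decide
  have n5 : (1 : ZMod 5) ≠ 2 := by decide
  have n6 : (1 : ZMod 5) ≠ 3 := by decide
  have n7 : (1 : ZMod 5) ≠ 4 := by decide
  have n8 : (2 : ZMod 5) ≠ 3 := by decide
  have n9 : (2 : ZMod 5) ≠ 4 := by decide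
  have n10 : (3 : ZMod 5) ≠ 4 := by decide
  rcases h.subdivide_elim with ⟨t, rfl, rfl, rfl⟩ | ⟨t, i, rfl, rfl, rfl, rfl⟩ |
    ⟨t, i, rfl, rfl, rfl, rfl⟩ | ⟨t, i, rfl, rfl, rfl, rfl⟩ | ⟨t, i, t', j, hg, rfl, rfl, rfl, rfl⟩ |
    ⟨t, i, t', j, hg, rfl, rfl, rfl, rfl⟩ <;>
  rcases h'.subdivide_elim with ⟨u, e1, rfl, rfl⟩ | ⟨u, k, e1, e2, rfl, rfl⟩ |
    ⟨u, k, e1, e2, rfl, rfl⟩ | ⟨u, k, e1, e2, rfl, rfl⟩ | ⟨u, k, u', l, hg', e1, e2, rfl, rfl⟩ |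
    ⟨u, k, u', l, hg', e1, e2, rfl, rfl⟩ <;>
  simp only [Prod.mk.injEq, Option.some.injEq, reduceCtorEq, and_false] at e1 <;>
  first
  | exact absurd e2 (by assumption)
  | exact absurd e2.symm (by assumption)
  | (obtain ⟨rfl, rfl⟩ := e1; first | exact ⟨rfl, rfl⟩ | (obtain ⟨rfl, rfl⟩ := hX hg hg'; exact ⟨rfl, rfl⟩))
  | (cases e1.1; exact ⟨rfl, rfl⟩)

/-- `kind_inner`, `kind_mid` and `kind_old` enumerate the corners of each kind, and thereby all
corners that can lie at one vertex. -/
theorem kind_inner {T : X.Tile × Option (ZMod 5)} {j : ZMod 5} {t : X.Tile} {i : ZMod 5}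
    (h : X.cornerKind (T, j) = .inner t i) :
    (T = (t, none) ∧ j = i) ∨ (T = (t, some i) ∧ j = 2) ∨ (T = (t, some (i + 1)) ∧ j = 3) := by
  obtain ⟨u, _ | k⟩ := T
  · rw [cornerKind_none] at h; cases h; exact Or.inl ⟨rfl, rfl⟩
  · obtain rfl | rfl | rfl | rfl | rfl := Pentagon.zmod_five_cases j
    · rw [cornerKind_zero] at h; cases h
    · rw [cornerKind_one] at h; cases h
    · rw [cornerKind_two] at h; cases h; exact Or.inr (Or.inl ⟨rfl, rfl⟩)
    · rw [cornerKind_three] at h; cases h; right; right; simp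
    · rw [cornerKind_four] at h; cases h

theorem kind_mid {T : X.Tile × Option (ZMod 5)} {j : ZMod 5} {e : X.EdgeCls}
    (h : X.cornerKind (T, j) = .mid e) : ∃ t i, X.edgeCls t i = e ∧
    ((T = (t, some i) ∧ j = 1) ∨ (T = (t, some (i + 1)) ∧ j = 4)) := by
  obtain ⟨u, _ | k⟩ := T
  · rw [cornerKind_none] at h; cases h
  · obtain rfl | rfl | rfl | rfl | rfl := Pentagon.zmod_five_cases j
    · rw [cornerKind_zero] at h; cases h
    · rw [cornerKind_one] at h; cases h; exact ⟨_, _, rfl, Or.inl ⟨rfl, rfl⟩⟩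
    · rw [cornerKind_two] at h; cases h
    · rw [cornerKind_three] at h; cases h
    · rw [cornerKind_four] at h; cases h; exact ⟨_, _, rfl, Or.inr ⟨by simp, rfl⟩⟩

theorem kind_old {T : X.Tile × Option (ZMod 5)} {j : ZMod 5} {v : X.Vertex}
    (h : X.cornerKind (T, j) = .old v) : ∃ t i, X.vert t i = v ∧ T = (t, some i) ∧ j = 0 := by
  obtain ⟨u, _ | k⟩ := T
  · rw [cornerKind_none] at h; cases h
  · obtain rfl | rfl | rfl | rfl | rfl := Pentagon.zmod_five_cases j
    · rw [cornerKind_zero] at h; cases h; exact ⟨_, _, rfl, rfl, rfl⟩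
    · rw [cornerKind_one] at h; cases h
    · rw [cornerKind_two] at h; cases h
    · rw [cornerKind_three] at h; cases h
    · rw [cornerKind_four] at h; cases h

theorem Regular.subdivide_vert_inj (hX : X.Regular) {T : X.Tile × Option (ZMod 5)} {i j : ZMod 5}
    (h : X.subdivide.vert T i = X.subdivide.vert T j) : i = j := by
  have h : X.cornerKind (T, i) = X.cornerKind (T, j) := congrArg X.kind h
  cases hk : X.cornerKind (T, i) with
  | old v =>
    obtain ⟨t, k, -, rfl, rfl⟩ := kind_old hk
    obtain ⟨t, k, -, -, rfl⟩ := kind_old (h.symm.trans hk)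
    rfl
  | mid e =>
    obtain ⟨t, k, h1, h2⟩ := kind_mid hk
    obtain ⟨t', k', h1', h2'⟩ := kind_mid (h.symm.trans hk)
    have h3 := h1.trans h1'.symm
    rcases h2 with ⟨rfl, rfl⟩ | ⟨rfl, rfl⟩ <;> rcases h2' with ⟨e, rfl⟩ | ⟨e, rfl⟩
    · rfl
    · simp only [Prod.mk.injEq, Option.some.injEq] at e
      obtain ⟨rfl, rfl⟩ := e
      exact absurd (hX.edgeCls_inj h3) (zmod_five_ne_add (by decide) _)
    · simp only [Prod.mk.injEq, Option.some.injEq] at e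
      obtain ⟨rfl, rfl⟩ := e
      exact absurd (hX.edgeCls_inj h3).symm (zmod_five_ne_add (by decide) _)
    · rfl
  | inner t k =>
    have e1 := kind_inner hk
    have e2 := kind_inner (h.symm.trans hk)
    rcases e1 with ⟨rfl, rfl⟩ | ⟨rfl, rfl⟩ | ⟨rfl, rfl⟩ <;> rcases e2 with ⟨e, rfl⟩ | ⟨e, rfl⟩ | ⟨e, rfl⟩ <;>
      first
      | rfl
      | (simp at e; done)
      | (exfalso; simp only [Prod.mk.injEq, Option.some.injEq, true_and] at e
         first
         | exact zmod_five_ne_add (by decide) _ e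
         | exact zmod_five_ne_add (by decide) _ e.symm)

theorem Regular.subdivide_share_aux (hX : X.Regular) {t t' : X.Tile} {i i' : ZMod 5}
    (hne : ((t, some i) : X.Tile × Option (ZMod 5)) ≠ (t', some i')) {a b c : ZMod 5}
    (hab : a ≠ b) (hac : a ≠ c) (hbc : b ≠ c)
    (h : ∀ k ∈ ({a, b, c} : Set (ZMod 5)),
      ∃ j, X.cornerKind ((t, some i), k) = X.cornerKind ((t', some i'), j)) : False := by
  have hq : ∀ j u l, X.cornerKind ((t', some i'), j) = .inner u l → u = t' ∧ (l = i' ∨ l = i' - 1) := by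
    intro j u l hj
    rcases kind_inner hj with ⟨e, -⟩ | ⟨e, -⟩ | ⟨e, -⟩ <;>
      simp only [Prod.mk.injEq, Option.some.injEq, reduceCtorEq, and_false] at e
    · exact ⟨e.1.symm, Or.inl e.2.symm⟩
    · exact ⟨e.1.symm, Or.inr (by rw [e.2]; ring)⟩
  have hm : ∀ j e, X.cornerKind ((t', some i'), j) = .mid e →
      e = X.edgeCls t' i' ∨ e = X.edgeCls t' (i' - 1) := by
    intro j e hj
    obtain ⟨u, l, rfl, ⟨e, -⟩ | ⟨e, -⟩⟩ := kind_mid hj <;>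
      simp only [Prod.mk.injEq, Option.some.injEq] at e <;> obtain ⟨rfl, rfl⟩ := e
    · exact Or.inl rfl
    · exact Or.inr (by rw [add_sub_cancel_right])
  have ho : ∀ j v, X.cornerKind ((t', some i'), j) = .old v → v = X.vert t' i' := by
    intro j v hj
    obtain ⟨u, l, rfl, e, -⟩ := kind_old hj
    simp only [Prod.mk.injEq, Option.some.injEq] at e
    obtain ⟨rfl, rfl⟩ := e; rfl
  have h0 : (0 : ZMod 5) ∈ ({a, b, c} : Set (ZMod 5)) → X.vert t i = X.vert t' i' := fun hk => by
    obtain ⟨j, hj⟩ := h 0 hk; exact ho j _ hj.symm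
  have h1 : (1 : ZMod 5) ∈ ({a, b, c} : Set (ZMod 5)) →
      X.edgeCls t i = X.edgeCls t' i' ∨ X.edgeCls t i = X.edgeCls t' (i' - 1) := fun hk => by
    obtain ⟨j, hj⟩ := h 1 hk; exact hm j _ hj.symm
  have h4 : (4 : ZMod 5) ∈ ({a, b, c} : Set (ZMod 5)) →
      X.edgeCls t (i - 1) = X.edgeCls t' i' ∨ X.edgeCls t (i - 1) = X.edgeCls t' (i' - 1) :=
    fun hk => by obtain ⟨j, hj⟩ := h 4 hk; exact hm j _ hj.symm
  have h2 : (2 : ZMod 5) ∈ ({a, b, c} : Set (ZMod 5)) → t = t' ∧ (i = i' ∨ i = i' - 1) :=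
    fun hk => by obtain ⟨j, hj⟩ := h 2 hk; exact hq j _ _ hj.symm
  have h3 : (3 : ZMod 5) ∈ ({a, b, c} : Set (ZMod 5)) → t = t' ∧ (i - 1 = i' ∨ i - 1 = i' - 1) :=
    fun hk => by obtain ⟨j, hj⟩ := h 3 hk; exact hq j _ _ hj.symm
  have fin1 : ∀ i i' : ZMod 5, (i = i' ∨ i = i' - 1) → (i - 1 = i' ∨ i - 1 = i' - 1) → i = i' := by
    decide
  -- Inside one parent, corner 0 is not shared, and at most one of the corners 1, 4 and at most one
  -- of 2, 3 is: too few. For different parents 2 and 3 are excluded, so 0, 1 and 4 are shared; then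
  -- the sides `i - 1` and `i` of `t` are sides of `t'`, and their ends `i - 1`, `i`, `i + 1` are
  -- three common vertices of `t` and `t'`.
  by_cases ht : t = t'
  · subst ht
    have hii : i ≠ i' := fun e => hne (by rw [e])
    have k0 : (0 : ZMod 5) ∉ ({a, b, c} : Set (ZMod 5)) := fun hk => hii (hX.vert_inj (h0 hk))
    have k14 : ¬ ((1 : ZMod 5) ∈ ({a, b, c} : Set (ZMod 5)) ∧ (4 : ZMod 5) ∈ ({a, b, c} : Set (ZMod 5))) :=
      fun hk => hii (fin1 i i' ((h1 hk.1).imp hX.edgeCls_inj hX.edgeCls_inj)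
        ((h4 hk.2).imp hX.edgeCls_inj hX.edgeCls_inj))
    have k23 : ¬ ((2 : ZMod 5) ∈ ({a, b, c} : Set (ZMod 5)) ∧ (3 : ZMod 5) ∈ ({a, b, c} : Set (ZMod 5))) :=
      fun hk => hii (fin1 i i' (h2 hk.1).2 (h3 hk.2).2)
    clear h h0 h1 h2 h3 h4
    simp only [Set.mem_insert_iff, Set.mem_singleton_iff] at k0 k14 k23
    revert a b c; decide
  · have k2 : (2 : ZMod 5) ∉ ({a, b, c} : Set (ZMod 5)) := fun hk => ht (h2 hk).1
    have k3 : (3 : ZMod 5) ∉ ({a, b, c} : Set (ZMod 5)) := fun hk => ht (h3 hk).1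
    have hall : (0 : ZMod 5) ∈ ({a, b, c} : Set (ZMod 5)) ∧ (1 : ZMod 5) ∈ ({a, b, c} : Set (ZMod 5)) ∧
        (4 : ZMod 5) ∈ ({a, b, c} : Set (ZMod 5)) := by
      clear h h0 h1 h2 h3 h4
      simp only [Set.mem_insert_iff, Set.mem_singleton_iff] at k2 k3 ⊢
      revert a b c; decide
    have hends : ∀ k, (X.edgeCls t k = X.edgeCls t' i' ∨ X.edgeCls t k = X.edgeCls t' (i' - 1)) →
        ∀ v ∈ X.ends (X.edgeCls t k), ∃ j, v = X.vert t' j := by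
      rintro k (e | e) v hv <;> rw [e] at hv <;> rcases hv with rfl | rfl <;> exact ⟨_, rfl⟩
    have s1 := hends i (h1 hall.2.1) (X.vert t (i + 1)) (Or.inr rfl)
    have s4 := hends (i - 1) (h4 hall.2.2) (X.vert t (i - 1)) (Or.inl rfl)
    rcases hX.share ht ⟨_, h0 hall.1⟩ s1 s4 with e | e | e
    · exact zmod_five_ne_add (by decide) _ e.symm
    · exact zmod_five_ne_add (k := 1) (by decide) (i - 1) (by rw [sub_add_cancel]; exact e)
    · exact zmod_five_ne_add (k := 2) (by decide) (i - 1)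
        ((show i - 1 + 2 = i + 1 by ring).trans e)

theorem Regular.subdivide_share (hX : X.Regular) {T T' : X.Tile × Option (ZMod 5)} (hne : T ≠ T')
    {a b c : ZMod 5} (hab : a ≠ b) (hac : a ≠ c) (hbc : b ≠ c)
    (ha : ∃ j, X.subdivide.vert T a = X.subdivide.vert T' j)
    (hb : ∃ j, X.subdivide.vert T b = X.subdivide.vert T' j)
    (hc : ∃ j, X.subdivide.vert T c = X.subdivide.vert T' j) : False := by
  -- Corner `k` of the central pentagon lies in just two other tiles, at the corners `k` and `k + 1`
  -- of the parent. So no other tile contains three corners of the central pentagon.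
  have none_case : ∀ (t : X.Tile) (T' : X.Tile × Option (ZMod 5)), (t, none) ≠ T' → ∀ {a b c : ZMod 5},
      a ≠ b → a ≠ c → b ≠ c → (∃ j, X.subdivide.vert (t, none) a = X.subdivide.vert T' j) →
      (∃ j, X.subdivide.vert (t, none) b = X.subdivide.vert T' j) →
      (∃ j, X.subdivide.vert (t, none) c = X.subdivide.vert T' j) → False := by
    intro t T' hne a b c hab hac hbc ha hb hc
    have key : ∀ k, (∃ j, X.subdivide.vert (t, none) k = X.subdivide.vert T' j) →
        T' = (t, some k) ∨ T' = (t, some (k + 1)) := by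
      rintro k ⟨j, hj⟩
      have hj : X.cornerKind ((t, none), k) = X.cornerKind (T', j) := congrArg X.kind hj
      rcases kind_inner hj.symm with ⟨e, -⟩ | ⟨e, -⟩ | ⟨e, -⟩
      · exact absurd e.symm hne
      · exact Or.inl e
      · exact Or.inr e
    obtain ⟨u, d⟩ := T'
    have key' : ∀ k, (∃ j, X.subdivide.vert (t, none) k = X.subdivide.vert (u, d) j) →
        d = some k ∨ d = some (k + 1) := fun k hk =>
      (key k hk).imp (fun e => (Prod.mk.inj e).2) (fun e => (Prod.mk.inj e).2)
    have ka := key' a ha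
    have kb := key' b hb
    have kc := key' c hc
    clear key key' ha hb hc hne
    revert a b c d; decide
  obtain ⟨t, _ | i⟩ := T
  · exact none_case t T' hne hab hac hbc ha hb hc
  obtain ⟨t', _ | i'⟩ := T'
  · obtain ⟨a', ha⟩ := ha
    obtain ⟨b', hb⟩ := hb
    obtain ⟨c', hc⟩ := hc
    refine none_case t' (t, some i) hne.symm (a := a') (b := b') (c := c') ?_ ?_ ?_
      ⟨_, ha.symm⟩ ⟨_, hb.symm⟩ ⟨_, hc.symm⟩
    · rintro rfl; exact hab (hX.subdivide_vert_inj (ha.trans hb.symm))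
    · rintro rfl; exact hac (hX.subdivide_vert_inj (ha.trans hc.symm))
    · rintro rfl; exact hbc (hX.subdivide_vert_inj (hb.trans hc.symm))
  · refine hX.subdivide_share_aux hne hab hac hbc ?_
    rintro k (rfl | rfl | rfl)
    · obtain ⟨j, hj⟩ := ha; exact ⟨j, congrArg X.kind hj⟩
    · obtain ⟨j, hj⟩ := hb; exact ⟨j, congrArg X.kind hj⟩
    · obtain ⟨j, hj⟩ := hc; exact ⟨j, congrArg X.kind hj⟩

-- The corners at an old vertex correspond to corners of the original complex; at a midpoint each of
-- the at most two tiles along the edge contributes two; at a corner of a central pentagon there are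
-- three. So the bound four reproduces itself.
open Classical in
theorem Regular.subdivide_deg (hX : X.Regular) (v : X.subdivide.Vertex)
    (s : Finset ((X.Tile × Option (ZMod 5)) × ZMod 5))
    (hs : ∀ a ∈ s, X.subdivide.vert a.1 a.2 = v) : s.card ≤ 4 := by
  have hs : ∀ a ∈ s, X.cornerKind a = X.kind v := fun a ha => congrArg X.kind (hs a ha)
  cases hk : X.kind v with
  | old w =>
    rw [hk] at hs
    have h1 : ∀ a ∈ s, ∃ t i, X.vert t i = w ∧ a = ((t, some i), 0) := by
      rintro ⟨T, j⟩ ha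
      obtain ⟨t, i, h, rfl, rfl⟩ := kind_old (hs _ ha)
      exact ⟨t, i, h, rfl⟩
    rw [← Finset.card_image_of_injOn (f := fun a => (a.1.1, a.1.2.getD 0)) (s := s)]
    · refine hX.deg w _ fun a ha => ?_
      obtain ⟨b, hb, rfl⟩ := Finset.mem_image.1 ha
      obtain ⟨t, i, h, rfl⟩ := h1 b hb
      exact h
    · intro a ha b hb hab
      obtain ⟨t, i, h, rfl⟩ := h1 a ha
      obtain ⟨t', i', h', rfl⟩ := h1 b hb
      simp only [Option.getD_some, Prod.mk.injEq] at hab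
      rw [hab.1, hab.2]
  | mid e =>
    rw [hk] at hs
    rcases s.eq_empty_or_nonempty with rfl | ⟨⟨T, j⟩, ha⟩
    · simp
    obtain ⟨t, i, rfl, -⟩ := kind_mid (hs _ ha)
    have h2 : ∃ (t' : X.Tile) (i' : ZMod 5), ∀ u k, X.edgeCls u k = X.edgeCls t i →
        (u = t ∧ k = i) ∨ (u = t' ∧ k = i') := by
      by_cases h : ∃ t' i', X.Adj t i t' i'
      · obtain ⟨t', i', h⟩ := h
        refine ⟨t', i', fun u k e => (hX.edge.edgeCls_eq_iff.1 e).imp id fun e => ?_⟩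
        exact hX.edge e.symm h
      · exact ⟨t, i, fun u k e => (hX.edge.edgeCls_eq_iff.1 e).imp id fun e => absurd ⟨u, k, e.symm⟩ h⟩
    obtain ⟨t', i', h2⟩ := h2
    have h3 : s ⊆ {((t, some i), 1), ((t, some (i + 1)), 4), ((t', some i'), 1),
        ((t', some (i' + 1)), 4)} := by
      rintro ⟨T, j⟩ ha
      obtain ⟨u, k, e, h⟩ := kind_mid (hs _ ha)
      rcases h2 u k e with ⟨rfl, rfl⟩ | ⟨rfl, rfl⟩ <;> rcases h with ⟨rfl, rfl⟩ | ⟨rfl, rfl⟩ <;> simp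
    exact (Finset.card_le_card h3).trans Finset.card_le_four
  | inner t i =>
    rw [hk] at hs
    have h3 : s ⊆ {((t, none), i), ((t, some i), 2), ((t, some (i + 1)), 3)} := by
      rintro ⟨T, j⟩ ha
      rcases kind_inner (hs _ ha) with ⟨rfl, rfl⟩ | ⟨rfl, rfl⟩ | ⟨rfl, rfl⟩ <;> simp
    exact ((Finset.card_le_card h3).trans Finset.card_le_three).trans (by norm_num)

theorem Regular.subdivide (hX : X.Regular) : X.subdivide.Regular where
  edge := hX.edge.subdivide
  vert_inj := fun _ _ _ h => hX.subdivide_vert_inj h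
  share := fun T T' hne a b c ha hb hc => by
    by_contra! hn
    exact hX.subdivide_share hne hn.1 hn.2.1 hn.2.2 ha hb hc
  deg := hX.subdivide_deg

/-! ### Carriers of vertices of the subdivision -/

/-- The vertices of a tile. -/
def verts (X : PentComplex) (t : X.Tile) : Set X.Vertex := Set.range (X.vert t)

/-- The vertices of the complex that carry a vertex of its subdivision. -/
def VertexKind.carrier : X.VertexKind → Set X.Vertex
  | .old v => {v}
  | .mid e => X.ends e
  | .inner t i => {X.vert t i, X.vert t (i + 1)}

theorem carrier_eq (T : X.Tile × Option (ZMod 5)) (j : ZMod 5) :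
    (∃ i, (X.cornerKind (T, j)).carrier = {X.vert T.1 i, X.vert T.1 (i + 1)}) ∨
      ∃ i, (X.cornerKind (T, j)).carrier = {X.vert T.1 i} := by
  obtain ⟨u, _ | k⟩ := T
  · exact Or.inl ⟨j, rfl⟩
  · obtain rfl | rfl | rfl | rfl | rfl := Pentagon.zmod_five_cases j
    · exact Or.inr ⟨k, rfl⟩
    · exact Or.inl ⟨k, rfl⟩
    · exact Or.inl ⟨k, rfl⟩
    · exact Or.inl ⟨k - 1, rfl⟩
    · exact Or.inl ⟨k - 1, rfl⟩

theorem carrier_subset (T : X.Tile × Option (ZMod 5)) (j : ZMod 5) :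
    (X.cornerKind (T, j)).carrier ⊆ X.verts T.1 := by
  rcases carrier_eq T j with ⟨i, h⟩ | ⟨i, h⟩ <;> rw [h]
  · rintro _ (rfl | rfl) <;> exact ⟨_, rfl⟩
  · rintro _ rfl; exact ⟨_, rfl⟩

theorem vert_mem_carrier (t : X.Tile) (i j : ZMod 5) :
    X.vert t i ∈ (X.cornerKind ((t, some i), j)).carrier := by
  have h : X.vert t i ∈ ({X.vert t (i - 1), X.vert t (i - 1 + 1)} : Set X.Vertex) := by simp
  obtain rfl | rfl | rfl | rfl | rfl := Pentagon.zmod_five_cases j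
  · exact rfl
  · exact Or.inl rfl
  · exact Or.inl rfl
  · exact h
  · exact h

/-- The parents of the tiles near a vertex of the subdivision meet the carrier of the vertex. -/
theorem exists_carrier_of_star {T T'' T' : X.Tile × Option (ZMod 5)} {j a b j' : ZMod 5}
    (h1 : X.subdivide.vert T'' a = X.subdivide.vert T j)
    (h2 : X.subdivide.vert T'' b = X.subdivide.vert T' j') :
    ∃ u ∈ (X.cornerKind (T, j)).carrier, u ∈ X.verts T'.1 := by
  have h1 : X.cornerKind (T'', a) = X.cornerKind (T, j) := congrArg X.kind h1
  have h2 : X.cornerKind (T'', b) = X.cornerKind (T', j') := congrArg X.kind h2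
  rw [← h1]
  obtain ⟨t, _ | i⟩ := T''
  · refine ⟨X.vert t a, Or.inl rfl, ?_⟩
    rcases kind_inner h2.symm with ⟨rfl, -⟩ | ⟨rfl, -⟩ | ⟨rfl, -⟩ <;> exact ⟨_, rfl⟩
  · refine ⟨X.vert t i, vert_mem_carrier t i a, carrier_subset T' j' ?_⟩
    rw [← h2]
    exact vert_mem_carrier t i b

theorem exists_carrier_adjacent (T : X.Tile × Option (ZMod 5)) (j : ZMod 5) :
    ∃ u, u ∈ (X.cornerKind (T, j)).carrier ∧ u ∈ (X.cornerKind (T, j + 1)).carrier := by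
  obtain ⟨t, _ | i⟩ := T
  · exact ⟨X.vert t (j + 1), Or.inr rfl, Or.inl rfl⟩
  · exact ⟨X.vert t i, vert_mem_carrier t i j, vert_mem_carrier t i (j + 1)⟩

theorem carrier_subset_of_vert_eq {T T' : X.Tile × Option (ZMod 5)} {j j' : ZMod 5}
    (h : X.subdivide.vert T j = X.subdivide.vert T' j') :
    (X.cornerKind (T, j)).carrier ⊆ X.verts T'.1 := by
  have h : X.cornerKind (T, j) = X.cornerKind (T', j') := congrArg X.kind h
  rw [h]; exact carrier_subset T' j'

end PentComplex

namespace PentComplex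

/-! ### The supertiles -/

theorem supertile_regular : ∀ n, (supertile n).Regular
  | 0 => by
    have hv : ∀ a b : Unit × ZMod 5, (Quot.mk (supertile 0).CornerRel a : (supertile 0).Vertex) =
        Quot.mk _ b → a = b := by
      intro a b h
      replace h := Quot.eqvGen_exact h
      induction h with
      | rel x y h => rcases h with ⟨h⟩ | ⟨h⟩ <;> exact h.elim
      | refl x => rfl
      | symm x y _ h => exact h.symm
      | trans x y z _ _ h h' => exact h.trans h'
    exact
      { edge := fun t i t₁ j₁ t₂ j₂ h => by rcases h with h | h <;> exact h.elim
        vert_inj := fun t i j h => (Prod.mk.inj (hv _ _ h)).2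
        share := fun t t' h => absurd rfl h
        deg := fun v s hs => by
          have : s.card ≤ 1 := Finset.card_le_one.2 fun a ha b hb =>
            hv _ _ ((hs a ha).trans (hs b hb).symm)
          omega }
  | n + 1 => (supertile_regular n).subdivide

theorem iota_glued : ∀ (n : ℕ) {t t' : (supertile n).Tile} {i j : ZMod 5},
    (supertile n).Glued t i t' j → (supertile (n + 1)).Glued (iota n t) i (iota n t') j
  | 0, _, _, _, _, h => h.elim
  | n + 1, _, _, _, _, h => by
    cases h with
    | central t => exact SubGlued.central (iota n t) _
    | spoke t i => exact SubGlued.spoke (iota n t) i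
    | firstHalf t i t' j h => exact SubGlued.firstHalf (iota n t) i (iota n t') j (iota_glued n h)
    | secondHalf t i t' j h => exact SubGlued.secondHalf (iota n t) i (iota n t') j (iota_glued n h)

/-- Tiles of `K_n` may have free sides, but not inside `K_{n+1}`: for `n = 0` the tile becomes a
central pentagon, and later half of an old side is glued as soon as the side of the parent is. This
makes the limit complete. -/
theorem iota_complete : ∀ (n : ℕ) (t : (supertile n).Tile) (i : ZMod 5),
    ∃ t' j, (supertile (n + 1)).Adj (iota n t) i t' j
  | 0, t, i => ⟨_, _, Or.inl (SubGlued.central t i)⟩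
  | n + 1, (t, none), i => ⟨_, _, Or.inl (SubGlued.central (iota n t) i)⟩
  | n + 1, (t, some k), i => by
    change ∃ t' j, ((supertile (n + 1)).subdivide).Adj (iota n t, some k) i t' j
    obtain rfl | rfl | rfl | rfl | rfl := Pentagon.zmod_five_cases i
    · obtain ⟨t', j, h | h⟩ := iota_complete n t k
      · exact ⟨_, _, Or.inl (SubGlued.firstHalf _ _ _ _ h)⟩
      · exact ⟨_, _, Or.inr (SubGlued.secondHalf _ _ _ _ h)⟩
    · exact ⟨_, _, Or.inl (SubGlued.spoke _ _)⟩
    · refine ⟨(iota n t, none), k - 1, Or.inr ?_⟩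
      have := SubGlued.central (L := supertile (n + 1)) (iota n t) (k - 1)
      rwa [sub_add_cancel] at this
    · refine ⟨(iota n t, some (k - 1)), 1, Or.inr ?_⟩
      have := SubGlued.spoke (L := supertile (n + 1)) (iota n t) (k - 1)
      rwa [sub_add_cancel] at this
    · obtain ⟨t', j, h | h⟩ := iota_complete n t (k - 1)
      · have := SubGlued.secondHalf _ _ _ _ h
        rw [sub_add_cancel] at this
        exact ⟨_, _, Or.inl this⟩
      · have := SubGlued.firstHalf _ _ _ _ h
        rw [sub_add_cancel] at this
        exact ⟨_, _, Or.inr this⟩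

/-! ### The tiles of `K` -/

/-- The embedding of `K_n` in `K`. -/
def embed (n : ℕ) (t : (supertile n).Tile) : tilingK.Tile := Quot.mk _ ⟨n, t⟩

theorem embed_iota (n : ℕ) (t : (supertile n).Tile) : embed (n + 1) (iota n t) = embed n t :=
  (Quot.sound (LimRel.step n t)).symm

/-- The parent of a tile of `K`, and its position in the parent. -/
def descend : tilingK.Tile → tilingK.Tile × Option (ZMod 5) :=
  Quot.lift (fun x => match x with
    | ⟨0, _⟩ => (embed 0 (), none)
    | ⟨n + 1, t⟩ => (embed n t.1, t.2)) (by
    rintro _ _ ⟨n, t⟩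
    cases n with
    | zero => rfl
    | succ n => exact Prod.ext (embed_iota n t.1).symm rfl)

/-- The child of a tile of `K` in a given position. -/
def ascend (a : tilingK.Tile × Option (ZMod 5)) : tilingK.Tile :=
  Quot.lift (fun x : Σ n, (supertile n).Tile => embed (x.1 + 1) (x.2, a.2)) (by
    rintro _ _ ⟨n, t⟩
    exact (embed_iota (n + 1) (t, a.2)).symm) a.1

theorem descend_embed (n : ℕ) (t : (supertile n).Tile) (c : Option (ZMod 5)) :
    descend (embed (n + 1) (t, c)) = (embed n t, c) := rfl

theorem exists_embed (a : tilingK.Tile) : ∃ n t, a = embed n t :=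
  Quot.ind (β := fun a => ∃ n t, a = embed n t) (fun x => ⟨x.1, x.2, rfl⟩) a

/-- The self-similarity of `K` on tiles. -/
def descendEquiv : tilingK.Tile ≃ tilingK.Tile × Option (ZMod 5) where
  toFun := descend
  invFun := ascend
  left_inv a := by
    obtain ⟨n, t, rfl⟩ := exists_embed a
    cases n with
    | zero => exact embed_iota 0 ()
    | succ n => rfl
  right_inv a := by
    obtain ⟨a, c⟩ := a
    obtain ⟨n, t, rfl⟩ := exists_embed a
    rfl

theorem embed_injective : ∀ n, Function.Injective (embed n)
  | 0 => fun _ _ _ => rfl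
  | n + 1 => by
    rintro ⟨t, c⟩ ⟨t', c'⟩ h
    have h := congrArg descend h
    rw [descend_embed, descend_embed, Prod.mk.injEq] at h
    rw [embed_injective n h.1, h.2]

theorem embed_raise {n : ℕ} {t : (supertile n).Tile} {m : ℕ} (h : n ≤ m) :
    ∃ t', embed n t = embed m t' := by
  induction m, h using Nat.le_induction with
  | base => exact ⟨t, rfl⟩
  | succ m _ ih =>
    obtain ⟨t', h⟩ := ih
    exact ⟨iota m t', h.trans (embed_iota m t').symm⟩

theorem glued_raise {n : ℕ} {t t' : (supertile n).Tile} {i j : ZMod 5}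
    (hg : (supertile n).Glued t i t' j) {m : ℕ} (h : n ≤ m) {s s' : (supertile m).Tile}
    (hs : embed m s = embed n t) (hs' : embed m s' = embed n t') :
    (supertile m).Glued s i s' j := by
  induction m, h using Nat.le_induction with
  | base => rwa [embed_injective n hs, embed_injective n hs']
  | succ m hm ih =>
    obtain ⟨u, hu⟩ := embed_raise (t := t) hm
    obtain ⟨u', hu'⟩ := embed_raise (t := t') hm
    have h1 := iota_glued m (ih hu.symm hu'.symm)
    rwa [embed_injective (m + 1) (hs.trans (hu.trans (embed_iota m u).symm)),
      embed_injective (m + 1) (hs'.trans (hu'.trans (embed_iota m u').symm))]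

theorem adj_raise {a b : tilingK.Tile} {i j : ZMod 5} (h : tilingK.Adj a i b j) :
    ∃ n, ∀ m ≥ n, ∀ s s', embed m s = a → embed m s' = b → (supertile m).Adj s i s' j := by
  rcases h with ⟨n, t, t', h, rfl, rfl⟩ | ⟨n, t, t', h, rfl, rfl⟩
  · exact ⟨n, fun m hm s s' hs hs' => Or.inl (glued_raise h hm hs hs')⟩
  · exact ⟨n, fun m hm s s' hs hs' => Or.inr (glued_raise h hm hs' hs)⟩

theorem embed_adj {n : ℕ} {t t' : (supertile n).Tile} {i j : ZMod 5}
    (h : (supertile n).Adj t i t' j) : tilingK.Adj (embed n t) i (embed n t') j :=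
  h.imp (fun h => ⟨n, t, t', h, rfl, rfl⟩) (fun h => ⟨n, t', t, h, rfl, rfl⟩)

/-- An equality of vertices is a finite chain of gluings, and all of them are present in `K_m` for
large `m`. -/
theorem vert_raise {a b : tilingK.Tile} {i j : ZMod 5} (h : tilingK.vert a i = tilingK.vert b j) :
    ∃ n, ∀ m ≥ n, ∀ s s', embed m s = a → embed m s' = b →
      (supertile m).vert s i = (supertile m).vert s' j := by
  replace h := Quot.eqvGen_exact h
  suffices ∀ x y : tilingK.Tile × ZMod 5, Relation.EqvGen tilingK.CornerRel x y →
      ∃ n, ∀ m ≥ n, ∀ s s', embed m s = x.1 → embed m s' = y.1 →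
      (supertile m).vert s x.2 = (supertile m).vert s' y.2 from this _ _ h
  intro x y h
  induction h with
  | rel x y h =>
    rcases h with ⟨h⟩ | ⟨h⟩
    · obtain ⟨n, hn⟩ := adj_raise (Or.inl h)
      exact ⟨n, fun m hm s s' hs hs' => (hn m hm s s' hs hs').vert_left⟩
    · obtain ⟨n, hn⟩ := adj_raise (Or.inl h)
      exact ⟨n, fun m hm s s' hs hs' => (hn m hm s s' hs hs').vert_right⟩
  | refl x => exact ⟨0, fun m _ s s' hs hs' => by rw [embed_injective m (hs.trans hs'.symm)]⟩
  | symm x y _ h =>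
    obtain ⟨n, hn⟩ := h
    exact ⟨n, fun m hm s s' hs hs' => (hn m hm s' s hs' hs).symm⟩
  | trans x y z _ _ h h' =>
    obtain ⟨n, hn⟩ := h
    obtain ⟨n', hn'⟩ := h'
    obtain ⟨k, u, hu⟩ := exists_embed y.1
    refine ⟨max k (max n n'), fun m hm s s' hs hs' => ?_⟩
    obtain ⟨w, hw⟩ := embed_raise (t := u) (show k ≤ m by omega)
    have hw : embed m w = y.1 := (hu.trans hw).symm
    exact (hn m (by omega) s w hs hw).trans (hn' m (by omega) w s' hw hs')

theorem eventually_embed (a : tilingK.Tile) : ∃ n, ∀ m ≥ n, ∃ s, embed m s = a := by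
  obtain ⟨n, t, rfl⟩ := exists_embed a
  exact ⟨n, fun m hm => by obtain ⟨s, hs⟩ := embed_raise (t := t) hm; exact ⟨s, hs.symm⟩⟩

/-- Each clause involves finitely many tiles, gluings and equalities of vertices, so it can be
verified inside a single `K_m`. -/
theorem tilingK_regular : tilingK.Regular where
  edge := by
    intro a i b j b' j' h h'
    obtain ⟨n1, h1⟩ := adj_raise h
    obtain ⟨n2, h2⟩ := adj_raise h'
    obtain ⟨n3, h3⟩ := eventually_embed a
    obtain ⟨n4, h4⟩ := eventually_embed b
    obtain ⟨n5, h5⟩ := eventually_embed b'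
    let m := n1 + n2 + n3 + n4 + n5
    obtain ⟨s, hs⟩ := h3 m (by omega)
    obtain ⟨u, hu⟩ := h4 m (by omega)
    obtain ⟨u', hu'⟩ := h5 m (by omega)
    have := (supertile_regular m).edge (h1 m (by omega) s u hs hu) (h2 m (by omega) s u' hs hu')
    exact ⟨by rw [← hu, ← hu', this.1], this.2⟩
  vert_inj := by
    intro a i j h
    obtain ⟨n1, h1⟩ := vert_raise h
    obtain ⟨n2, h2⟩ := eventually_embed a
    let m := n1 + n2
    obtain ⟨s, hs⟩ := h2 m (by omega)
    exact (supertile_regular m).vert_inj (h1 m (by omega) s s hs hs)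
  share := by
    rintro a b hab i₁ i₂ i₃ ⟨j₁, h₁⟩ ⟨j₂, h₂⟩ ⟨j₃, h₃⟩
    obtain ⟨n1, h1⟩ := vert_raise h₁
    obtain ⟨n2, h2⟩ := vert_raise h₂
    obtain ⟨n3, h3⟩ := vert_raise h₃
    obtain ⟨n4, h4⟩ := eventually_embed a
    obtain ⟨n5, h5⟩ := eventually_embed b
    let m := n1 + n2 + n3 + n4 + n5
    obtain ⟨s, hs⟩ := h4 m (by omega)
    obtain ⟨u, hu⟩ := h5 m (by omega)
    exact (supertile_regular m).share (fun e => hab (by rw [← hs, ← hu, e]))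
      ⟨_, h1 m (by omega) s u hs hu⟩ ⟨_, h2 m (by omega) s u hs hu⟩ ⟨_, h3 m (by omega) s u hs hu⟩
  deg := by
    classical
    intro v s hs
    have h1 : ∀ x : (tilingK.Tile × ZMod 5) × (tilingK.Tile × ZMod 5),
        ∃ n, x.1 ∈ s → x.2 ∈ s → ∀ m ≥ n, ∀ u u', embed m u = x.1.1 → embed m u' = x.2.1 →
          (supertile m).vert u x.1.2 = (supertile m).vert u' x.2.2 := by
      intro x
      by_cases hx : x.1 ∈ s ∧ x.2 ∈ s
      · obtain ⟨n, hn⟩ := vert_raise ((hs _ hx.1).trans (hs _ hx.2).symm)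
        exact ⟨n, fun _ _ => hn⟩
      · exact ⟨0, fun h h' => absurd ⟨h, h'⟩ hx⟩
    choose n hn using h1
    choose k hk using eventually_embed
    let m := (s ×ˢ s).sup n + s.sup fun a => k a.1
    have hm1 : ∀ x ∈ s, ∀ y ∈ s, n (x, y) ≤ m := fun x hx y hy =>
      (Finset.le_sup (f := n) (Finset.mk_mem_product hx hy)).trans (Nat.le_add_right _ _)
    have hm2 : ∀ x ∈ s, k x.1 ≤ m := fun x hx =>
      (Finset.le_sup (f := fun a : tilingK.Tile × ZMod 5 => k a.1) hx).trans (Nat.le_add_left _ _)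
    rcases s.eq_empty_or_nonempty with rfl | ⟨a₀, ha₀⟩
    · simp
    have hr : ∀ x : tilingK.Tile × ZMod 5, ∃ u : (supertile m).Tile, x ∈ s → embed m u = x.1 := by
      intro x
      by_cases hx : x ∈ s
      · obtain ⟨u, hu⟩ := hk x.1 m (hm2 x hx)
        exact ⟨u, fun _ => hu⟩
      · obtain ⟨u, hu⟩ := hk a₀.1 m (hm2 a₀ ha₀)
        exact ⟨u, fun h => absurd h hx⟩
    choose u hu using hr
    rw [← Finset.card_image_of_injOn (f := fun x => (u x, x.2)) (s := s)]
    · refine (supertile_regular m).deg ((supertile m).vert (u a₀) a₀.2) _ fun a ha => ?_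
      obtain ⟨b, hb, rfl⟩ := Finset.mem_image.1 ha
      exact hn (b, a₀) hb ha₀ m (hm1 b hb a₀ ha₀) _ _ (hu b hb) (hu a₀ ha₀)
    · intro x hx y hy hxy
      simp only [Prod.mk.injEq] at hxy
      exact Prod.ext (by rw [← hu x hx, ← hu y hy, hxy.1]) hxy.2

theorem tilingK_complete : tilingK.Complete := by
  intro a i
  obtain ⟨n, t, rfl⟩ := exists_embed a
  obtain ⟨t', j, h⟩ := iota_complete n t i
  rw [← embed_iota]
  exact ⟨_, _, embed_adj h⟩

/-! ### The self-similarity of `K` -/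

theorem glued_descend {a b : tilingK.Tile} {i j : ZMod 5} (h : tilingK.Glued a i b j) :
    tilingK.SubGlued (descend a) i (descend b) j := by
  obtain ⟨n, t, t', h, rfl, rfl⟩ := h
  cases n with
  | zero => exact h.elim
  | succ n =>
    cases h with
    | central t => exact SubGlued.central (embed n t) _
    | spoke t i => exact SubGlued.spoke (embed n t) i
    | firstHalf t i t' j h =>
      exact SubGlued.firstHalf (embed n t) i (embed n t') j ⟨n, t, t', h, rfl, rfl⟩
    | secondHalf t i t' j h =>
      exact SubGlued.secondHalf (embed n t) i (embed n t') j ⟨n, t, t', h, rfl, rfl⟩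

theorem glued_ascend {A B : tilingK.Tile × Option (ZMod 5)} {i j : ZMod 5}
    (h : tilingK.SubGlued A i B j) : tilingK.Glued (ascend A) i (ascend B) j := by
  cases h with
  | central a i =>
    obtain ⟨n, t, rfl⟩ := exists_embed a
    exact ⟨n + 1, _, _, SubGlued.central t i, rfl, rfl⟩
  | spoke a i =>
    obtain ⟨n, t, rfl⟩ := exists_embed a
    exact ⟨n + 1, _, _, SubGlued.spoke t i, rfl, rfl⟩
  | firstHalf a i b j h =>
    obtain ⟨n, t, t', h, rfl, rfl⟩ := h
    exact ⟨n + 1, _, _, SubGlued.firstHalf t i t' j h, rfl, rfl⟩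
  | secondHalf a i b j h =>
    obtain ⟨n, t, t', h, rfl, rfl⟩ := h
    exact ⟨n + 1, _, _, SubGlued.secondHalf t i t' j h, rfl, rfl⟩

theorem vert_descend {a b : tilingK.Tile} {i j : ZMod 5} (h : tilingK.vert a i = tilingK.vert b j) :
    tilingK.subdivide.vert (descend a) i = tilingK.subdivide.vert (descend b) j := by
  replace h := Quot.eqvGen_exact h
  suffices ∀ x y : tilingK.Tile × ZMod 5, Relation.EqvGen tilingK.CornerRel x y →
      tilingK.subdivide.vert (descend x.1) x.2 = tilingK.subdivide.vert (descend y.1) y.2 from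
    this _ _ h
  intro x y h
  induction h with
  | rel x y h =>
    rcases h with ⟨h⟩ | ⟨h⟩
    · exact Adj.vert_left (L := tilingK.subdivide) (Or.inl (glued_descend h))
    · exact Adj.vert_right (L := tilingK.subdivide) (Or.inl (glued_descend h))
  | refl x => rfl
  | symm x y _ h => exact h.symm
  | trans x y z _ _ h h' => exact h.trans h'

/-- The parent of a tile of `K`. -/
def parent (a : tilingK.Tile) : tilingK.Tile := (descend a).1

/-- The vertices of `K` that carry a vertex of `K`, seen as a vertex of the subdivision of `K`. -/
def cornerCarrier (a : tilingK.Tile) (i : ZMod 5) : Set tilingK.Vertex :=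
  (tilingK.cornerKind (descend a, i)).carrier

theorem cornerCarrier_subset {a b : tilingK.Tile} {i j : ZMod 5}
    (h : tilingK.vert a i = tilingK.vert b j) : cornerCarrier a i ⊆ tilingK.verts (parent b) :=
  carrier_subset_of_vert_eq (vert_descend h)

theorem touch_parent {a b : tilingK.Tile} (h : tilingK.Touch a b) :
    tilingK.Touch (parent a) (parent b) := by
  obtain ⟨i, j, h⟩ := tilingK_regular.edge.exists_vert_eq h
  have h1 : (cornerCarrier a i).Nonempty := by
    rcases carrier_eq (descend a) i with ⟨k, e⟩ | ⟨k, e⟩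
    · exact ⟨tilingK.vert (descend a).1 k, by rw [cornerCarrier, e]; exact Or.inl rfl⟩
    · exact ⟨tilingK.vert (descend a).1 k, by rw [cornerCarrier, e]; rfl⟩
  obtain ⟨v, hv⟩ := h1
  obtain ⟨k, rfl⟩ := cornerCarrier_subset h hv
  obtain ⟨l, hl⟩ := cornerCarrier_subset (a := a) rfl hv
  exact touch_of_vert_eq hl

/-- The tiles that touch the tiles at a vertex are in the second order supertiles at a vertex. -/
theorem exists_vertex_of_star (v : tilingK.Vertex) : ∃ x : tilingK.Vertex, ∀ a b,
    v ∈ tilingK.verts a → tilingK.Touch a b → x ∈ tilingK.verts (parent (parent b)) := by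
  obtain ⟨c, i, rfl⟩ : ∃ c i, v = tilingK.vert c i :=
    Vertex.ind (P := fun v => ∃ c i, v = tilingK.vert c i) (fun c i => ⟨c, i, rfl⟩) v
  -- The carrier is one vertex or the two ends of a side of `parent c`. Regarded as vertices of a
  -- subdivision, the ends of a side have carriers with a common vertex `x`, and `x` lies in the
  -- parent of every tile at one of the ends.
  have key : ∃ x : tilingK.Vertex, ∀ b, (∃ u ∈ cornerCarrier c i, u ∈ tilingK.verts b) →
      x ∈ tilingK.verts (parent b) := by
    rcases carrier_eq (descend c) i with ⟨k, e⟩ | ⟨k, e⟩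
    · obtain ⟨x, hx, hx'⟩ := exists_carrier_adjacent (descend (parent c)) k
      refine ⟨x, fun b => ?_⟩
      rintro ⟨u, hu, l, hl⟩
      rw [cornerCarrier, e] at hu
      rcases hu with rfl | rfl
      · exact cornerCarrier_subset hl.symm hx
      · exact cornerCarrier_subset hl.symm hx'
    · obtain ⟨x, hx, -⟩ := exists_carrier_adjacent (descend (parent c)) k
      refine ⟨x, fun b => ?_⟩
      rintro ⟨u, hu, l, hl⟩
      rw [cornerCarrier, e] at hu
      cases hu
      exact cornerCarrier_subset hl.symm hx
  obtain ⟨x, hx⟩ := key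
  refine ⟨x, fun a b ha hab => hx _ ?_⟩
  obtain ⟨k, hk⟩ := ha
  obtain ⟨l, m, hlm⟩ := tilingK_regular.edge.exists_vert_eq hab
  exact exists_carrier_of_star (vert_descend hk) (vert_descend hlm)

/-- Every ball is contained in the star of a vertex of the supertiles of some order. -/
theorem exists_supertile_star (r : ℕ) : ∃ n : ℕ, ∀ a : tilingK.Tile, ∃ x : tilingK.Vertex,
    ∀ b ∈ tilingK.tball a r, x ∈ tilingK.verts (parent^[n] b) := by
  induction r with
  | zero => exact ⟨0, fun a => ⟨tilingK.vert a 0, fun b hb => by cases hb; exact ⟨0, rfl⟩⟩⟩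
  | succ r ih =>
    obtain ⟨n, hn⟩ := ih
    -- Touching tiles have touching ancestors, so a further layer of tiles is absorbed by two
    -- further orders of supertiles.
    refine ⟨n + 1 + 1, fun a => ?_⟩
    obtain ⟨v, hv⟩ := hn a
    obtain ⟨x, hx⟩ := exists_vertex_of_star v
    refine ⟨x, fun b hb => ?_⟩
    obtain ⟨c, hc, hcb⟩ := hb
    have h1 : ∀ n, tilingK.Touch (parent^[n] c) (parent^[n] b) := by
      intro n
      induction n with
      | zero => exact hcb
      | succ n ih => rw [Function.iterate_succ_apply', Function.iterate_succ_apply']; exact touch_parent ih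
    rw [Function.iterate_succ_apply', Function.iterate_succ_apply']
    exact hx _ _ (hv c hc) (h1 n)

end PentComplex

/-! ### Plane topology: unions of open cells, and boundary points -/

namespace PlaneTopology

open Set Metric Topology Filter

section Radial

variable {E : Type*} [NormedAddCommGroup E] [NormedSpace ℝ E]

/-- The homeomorphism that changes the norms of the vectors according to `o`. -/
theorem exists_homeomorph_norm (o : ℝ ≃o ℝ) {δ : ℝ} (hδ : 0 < δ) (ho : ∀ t ≤ δ, o t = t) :
    ∃ ψ : E ≃ₜ E, (∀ x, ‖ψ x‖ = o ‖x‖) ∧ (∀ x, ‖ψ.symm x‖ = o.symm ‖x‖) ∧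
      ∀ x, o ‖x‖ = ‖x‖ → ψ x = x := by
  have key : ∀ o : ℝ ≃o ℝ, (∀ t ≤ δ, o t = t) → ∃ f : E → E, Continuous f ∧
      (∀ x, ‖f x‖ = o ‖x‖) ∧ (∀ x, x ≠ 0 → f x = (o ‖x‖ / ‖x‖) • x) ∧ f 0 = 0 := by
    intro o ho
    have hpos : ∀ x : E, 0 < max ‖x‖ δ := fun x => lt_max_of_lt_right hδ
    have hk : ∀ x : E, o (max ‖x‖ δ) / max ‖x‖ δ * ‖x‖ = o ‖x‖ := by
      intro x
      rcases le_total ‖x‖ δ with h | h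
      · rw [max_eq_right h, ho δ le_rfl, ho _ h, div_self hδ.ne', one_mul]
      · rw [max_eq_left h]
        exact div_mul_cancel₀ _ (hδ.trans_le h).ne'
    -- Since `o` is the identity up to `δ`, the maximum does not change the factor away from 0, and
    -- it removes the quotient 0/0 at the origin.
    refine ⟨fun x => (o (max ‖x‖ δ) / max ‖x‖ δ) • x, ?_, ?_, ?_, by simp⟩
    · have : Continuous fun x : E => o (max ‖x‖ δ) :=
        o.continuous.comp (by fun_prop)
      exact (this.div (by fun_prop) fun x => (hpos x).ne').smul continuous_id
    · intro x
      have h0 : 0 ≤ o (max ‖x‖ δ) := by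
        rw [← ho 0 hδ.le]
        exact o.monotone (hpos x).le
      rw [norm_smul, Real.norm_of_nonneg (div_nonneg h0 (hpos x).le), hk]
    · intro x hx
      have := hk x
      rw [← this, mul_div_assoc, div_self (norm_ne_zero_iff.2 hx), mul_one]
  have ho' : ∀ t ≤ δ, o.symm t = t := fun t ht => by
    rw [OrderIso.symm_apply_eq, ho t ht]
  have inv : ∀ o : ℝ ≃o ℝ, (∀ t ≤ δ, o t = t) → ∀ f g : E → E, (∀ x, ‖f x‖ = o ‖x‖) →
      (∀ x, x ≠ 0 → f x = (o ‖x‖ / ‖x‖) • x) → f 0 = 0 →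
      (∀ x, x ≠ 0 → g x = (o.symm ‖x‖ / ‖x‖) • x) → g 0 = 0 → ∀ x, g (f x) = x := by
    intro o ho f g hf hf' hf0 hg hg0 x
    rcases eq_or_ne x 0 with rfl | hx
    · rw [hf0, hg0]
    have hx' : 0 < ‖x‖ := norm_pos_iff.2 hx
    have hox : 0 < o ‖x‖ := by
      rw [← ho 0 hδ.le]
      exact o.strictMono hx'
    have hfx : f x ≠ 0 := norm_pos_iff.1 (by rw [hf]; exact hox)
    rw [hg _ hfx, hf, o.symm_apply_apply, hf' x hx, smul_smul,
      div_mul_div_cancel₀ hox.ne', div_self hx'.ne', one_smul]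
  obtain ⟨f, fc, fn, f1, f0⟩ := key o ho
  obtain ⟨g, gc, gn, g1, g0⟩ := key o.symm ho'
  refine ⟨⟨⟨f, g, inv o ho f g fn f1 f0 g1 g0, inv o.symm ho' g f gn g1 g0 f1 f0⟩, fc, gc⟩,
    fn, gn, fun x hx => ?_⟩
  rcases eq_or_ne x 0 with rfl | h
  · exact f0
  · exact (f1 x h).trans (by rw [hx, div_self (norm_ne_zero_iff.2 h), one_smul])

/-- A homeomorphism supported in a ball that expands a given small ball over a given large one. -/
theorem exists_radial_expansion {η M : ℝ} (hη : 0 < η) (hM : η ≤ M) :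
    ∃ ψ : E ≃ₜ E, (∀ x, ‖x‖ ≤ η / 2 → ψ x = x) ∧ (∀ x, M + 1 ≤ ‖x‖ → ψ x = x) ∧
      (∀ x, ‖x‖ ≤ M → ‖ψ.symm x‖ ≤ η) ∧
      (∀ x, ‖x‖ ≤ M + 1 → ‖ψ x‖ ≤ M + 1) ∧ ∀ x, ‖x‖ ≤ M + 1 → ‖ψ.symm x‖ ≤ M + 1 := by
  set c : ℝ := (M - η / 2) / (η / 2) with hc
  have hc1 : 1 ≤ c := by
    rw [hc, le_div_iff₀ (by linarith)]
    linarith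
  have hd : 1 ≤ M + 1 - η := by linarith
  -- Piecewise linear: steep from (η/2, η/2) to (η, M), then flat from (η, M) to (M + 1, M + 1); the
  -- outer maximum makes it the identity elsewhere.
  set φ : ℝ → ℝ := fun t => max t (min (η / 2 + c * (t - η / 2)) (M + (t - η) / (M + 1 - η)))
    with hφ
  have hmono : StrictMono φ := by
    intro a b hab
    refine max_lt_max hab (min_lt_min ?_ ?_)
    · nlinarith
    · have : (a - η) / (M + 1 - η) < (b - η) / (M + 1 - η) :=
        div_lt_div_of_pos_right (by linarith) (by linarith)
      linarith
  have hcont : Continuous φ := by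
    rw [hφ]
    fun_prop
  have hlow : ∀ t ≤ η / 2, φ t = t := by
    intro t ht
    exact max_eq_left ((min_le_left _ _).trans (by nlinarith))
  have hhigh : ∀ t, M + 1 ≤ t → φ t = t := by
    intro t ht
    refine max_eq_left ((min_le_right _ _).trans ?_)
    have h1 : (t - η) / (M + 1 - η) ≤ t - M := by
      rw [div_le_iff₀ (by linarith)]
      nlinarith
    linarith
  have hat : M ≤ φ η := by
    refine le_max_of_le_right (le_min ?_ (by simp))
    have h1 : c * (η / 2) = M - η / 2 := div_mul_cancel₀ _ (by linarith)
    linarith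
  have hsurj : Function.Surjective φ := by
    refine hcont.surjective (tendsto_atTop_mono (fun t => le_max_left _ _) tendsto_id) ?_
    refine tendsto_id.congr' ?_
    filter_upwards [eventually_le_atBot (η / 2)] with t ht using (hlow t ht).symm
  set o : ℝ ≃o ℝ := hmono.orderIsoOfSurjective φ hsurj with ho
  have hoφ : ∀ t, o t = φ t := fun t => rfl
  obtain ⟨ψ, h1, h2, h3⟩ := exists_homeomorph_norm (E := E) o (half_pos hη) hlow
  refine ⟨ψ, fun x hx => h3 x (hlow _ hx), fun x hx => h3 x (hhigh _ hx), fun x hx => ?_,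
    fun x hx => ?_, fun x hx => ?_⟩
  · rw [h2, OrderIso.symm_apply_le, hoφ]
    exact hx.trans hat
  · rw [h1, ← hhigh (M + 1) le_rfl]
    exact hmono.monotone hx
  · rw [h2, OrderIso.symm_apply_le, hoφ, hhigh (M + 1) le_rfl]
    exact hx

end Radial

section Extension

variable {E X : Type*} [NormedAddCommGroup E] [NormedSpace ℝ E] [ProperSpace E]
  [TopologicalSpace X] [T2Space X]

omit [NormedSpace ℝ E] in
/-- A homeomorphism with support in a ball of a chart extends to the space. -/
theorem exists_homeomorph_extend {f : E → X} (hf : IsOpenEmbedding f) (g : E ≃ₜ E) {R : ℝ}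
    (hg : ∀ x, R ≤ ‖x‖ → g x = x) :
    ∃ G : X ≃ₜ X, (∀ v, G (f v) = f (g v)) ∧ ∀ x, x ∉ range f → G x = x := by
  classical
  have key : ∀ g : E ≃ₜ E, (∀ x, R ≤ ‖x‖ → g x = x) →
      ∃ G : X → X, Continuous G ∧ (∀ v, G (f v) = f (g v)) ∧ ∀ x, x ∉ range f → G x = x := by
    intro g hg
    let G : X → X := fun x => if h : ∃ v, f v = x then f (g h.choose) else x
    have h1 : ∀ v, G (f v) = f (g v) := by
      intro v
      have h : ∃ w, f w = f v := ⟨v, rfl⟩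
      simp only [G, dif_pos h]
      rw [hf.injective h.choose_spec]
    have h2 : ∀ x, x ∉ range f → G x = x := fun x hx => dif_neg hx
    refine ⟨G, continuous_iff_continuousAt.2 fun x => ?_, h1, h2⟩
    by_cases hx : x ∈ range f
    · obtain ⟨v, rfl⟩ := hx
      rw [← hf.continuousAt_iff]
      have : G ∘ f = f ∘ g := funext h1
      rw [this]
      exact (hf.continuous.comp g.continuous).continuousAt
    -- The support of `G` lies in a compact, hence closed, subset of the range, so `G` is the
    -- identity near a point outside the range.
    · have hcl : IsClosed (f '' closedBall 0 R) :=
        ((isCompact_closedBall 0 R).image hf.continuous).isClosed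
      have hmem : (f '' closedBall 0 R)ᶜ ∈ 𝓝 x :=
        hcl.isOpen_compl.mem_nhds fun ⟨v, _, hv⟩ => hx ⟨v, hv⟩
      refine continuousAt_id.congr ?_
      filter_upwards [hmem] with y hy
      by_cases hyr : y ∈ range f
      · obtain ⟨v, rfl⟩ := hyr
        have : R ≤ ‖v‖ := by
          by_contra hlt
          exact hy ⟨v, by simpa using (not_le.1 hlt).le, rfl⟩
        rw [h1, hg v this, id]
      · rw [h2 y hyr, id]
  have inv : ∀ g g' : E → E, (∀ v, g' (g v) = v) → ∀ G G' : X → X, (∀ v, G (f v) = f (g v)) →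
      (∀ x, x ∉ range f → G x = x) → (∀ v, G' (f v) = f (g' v)) →
      (∀ x, x ∉ range f → G' x = x) → ∀ x, G' (G x) = x := by
    intro g g' hgg G G' h1 h2 h1' h2' x
    by_cases hx : x ∈ range f
    · obtain ⟨v, rfl⟩ := hx
      rw [h1, h1', hgg]
    · rw [h2 x hx, h2' x hx]
  obtain ⟨G, Gc, h1, h2⟩ := key g hg
  obtain ⟨G', Gc', h1', h2'⟩ := key g.symm fun x hx => by
    rw [Homeomorph.symm_apply_eq, hg x hx]
  exact ⟨⟨⟨G, G', inv g g.symm (by simp) G G' h1 h2 h1' h2',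
    inv g.symm g (by simp) G' G h1' h2' h1 h2⟩, Gc, Gc'⟩, h1, h2⟩

/-- A chart can be changed outside of a ball such that it covers a compact set contained
in another chart. -/
theorem exists_engulf {f e : E → X} (hf : IsOpenEmbedding f) (he : IsOpenEmbedding e)
    {C : Set X} (hC : IsCompact C) (hCe : C ⊆ range e) {R : ℝ} (hR : 0 ≤ R)
    (hfe : f '' closedBall 0 (R + 2) ⊆ range e) :
    ∃ f' : E → X, IsOpenEmbedding f' ∧ (∀ x, ‖x‖ ≤ R → f' x = f x) ∧
      C ⊆ f' '' closedBall 0 (R + 2) := by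
  obtain ⟨a, ha⟩ := hfe ⟨0, by simp; linarith, rfl⟩
  set e0 : E → X := fun v => e (a + v) with he0'
  have he0 : IsOpenEmbedding e0 := he.comp (Homeomorph.addLeft a).isOpenEmbedding
  have hr : range e0 = range e := by
    rw [he0']
    exact (Homeomorph.addLeft a).surjective.range_comp e
  have h00 : e0 0 = f 0 := by simp [he0', ha]
  obtain ⟨η₁, hη₁, h1⟩ : ∃ η > 0, e0 '' closedBall 0 η ⊆ f '' closedBall 0 (R + 1) := by
    have : e0 ⁻¹' (f '' ball 0 (R + 1)) ∈ 𝓝 (0 : E) := by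
      refine ((hf.isOpenMap _ isOpen_ball).preimage he0.continuous).mem_nhds ?_
      exact ⟨0, by simp; linarith, h00.symm⟩
    obtain ⟨η, hη, h⟩ := nhds_basis_closedBall.mem_iff.1 this
    exact ⟨η, hη, image_subset_iff.2 (h.trans (preimage_mono (image_mono ball_subset_closedBall)))⟩
  obtain ⟨η₂, hη₂, hη₂', h2⟩ :
      ∃ η > 0, η ≤ R + 1 ∧ f '' closedBall 0 η ⊆ e0 '' closedBall 0 (η₁ / 2) := by
    have : f ⁻¹' (e0 '' ball 0 (η₁ / 2)) ∈ 𝓝 (0 : E) := by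
      refine ((he0.isOpenMap _ isOpen_ball).preimage hf.continuous).mem_nhds ?_
      exact ⟨0, by simp; linarith, h00⟩
    obtain ⟨η, hη, h⟩ := nhds_basis_closedBall.mem_iff.1 this
    refine ⟨min η (R + 1), lt_min hη (by linarith), min_le_right _ _, ?_⟩
    exact image_subset_iff.2 ((closedBall_subset_closedBall (min_le_left _ _)).trans
      (h.trans (preimage_mono (image_mono ball_subset_closedBall))))
  obtain ⟨M, hM, h3⟩ :
      ∃ M, η₁ ≤ M ∧ C ∪ f '' closedBall 0 (R + 2) ⊆ e0 '' closedBall 0 M := by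
    have hK : IsCompact (C ∪ f '' closedBall 0 (R + 2)) :=
      hC.union ((isCompact_closedBall _ _).image hf.continuous)
    have hsub : C ∪ f '' closedBall 0 (R + 2) ⊆ range e0 := by
      rw [hr]
      exact union_subset hCe hfe
    have hK' : IsCompact (e0 ⁻¹' (C ∪ f '' closedBall 0 (R + 2))) :=
      he0.toIsInducing.isCompact_preimage' hK hsub
    obtain ⟨M, hM⟩ := hK'.isBounded.subset_closedBall 0
    refine ⟨max M η₁, le_max_right _ _, fun x hx => ?_⟩
    obtain ⟨v, rfl⟩ := hsub hx
    exact ⟨v, closedBall_subset_closedBall (le_max_left _ _) (hM hx), rfl⟩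
  obtain ⟨ψ₁, p1, p2, p3, -, -⟩ := exists_radial_expansion (E := E) hη₁ hM
  obtain ⟨ψ₂, q1, q2, q3, q4, q5⟩ := exists_radial_expansion (E := E) hη₂ hη₂'
  obtain ⟨H, H1, H2⟩ := exists_homeomorph_extend he0 ψ₁ p2
  obtain ⟨G, G1, G2⟩ := exists_homeomorph_extend hf ψ₂ q2
  have e2 : R + 1 + 1 = R + 2 := by ring
  rw [e2] at q2 q4 q5
  have Hs : ∀ v, H.symm (e0 v) = e0 (ψ₁.symm v) := fun v => by
    rw [Homeomorph.symm_apply_eq, H1, Homeomorph.apply_symm_apply]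
  have Gs : ∀ v, G.symm (f v) = f (ψ₂.symm v) := fun v => by
    rw [Homeomorph.symm_apply_eq, G1, Homeomorph.apply_symm_apply]
  -- The conjugate of `H` by `G` is applied to `f`. `G.symm` shrinks the `f`-ball of radius `R + 1`
  -- into the `e0`-ball of radius `η₁ / 2`, where `H` is the identity; so `f` is unchanged on radius
  -- `R`. On the other hand `H` stretches the `e0`-ball of radius `η₁`, which lies in the `f`-ball
  -- of radius `R + 1`, over the `e0`-ball of radius `M`, which contains `C` and the support of `G`.
  refine ⟨fun x => G (H (G.symm (f x))), G.isOpenEmbedding.comp (H.isOpenEmbedding.comp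
    (G.symm.isOpenEmbedding.comp hf)), fun x hx => ?_, fun c hc => ?_⟩
  · obtain ⟨v, hv, hv'⟩ := h2 ⟨ψ₂.symm x, by simpa using q3 x (by linarith), rfl⟩
    have h : H (G.symm (f x)) = G.symm (f x) := by
      rw [Gs, ← hv', H1, p1 v (by simpa using hv)]
    change G (H (G.symm (f x))) = f x
    rw [h, Homeomorph.apply_symm_apply]
  · have hG : G.symm c ∈ e0 '' closedBall 0 M := by
      by_cases hcf : c ∈ f '' closedBall 0 (R + 2)
      · obtain ⟨v, hv, rfl⟩ := hcf
        rw [Gs]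
        exact h3 (Or.inr ⟨_, by simpa using q5 v (by simpa using hv), rfl⟩)
      · have : G.symm c = c := by
          rw [Homeomorph.symm_apply_eq]
          by_cases hcr : c ∈ range f
          · obtain ⟨v, rfl⟩ := hcr
            rw [G1, q2 v]
            by_contra hlt
            exact hcf ⟨v, by simpa using (not_le.1 hlt).le, rfl⟩
          · exact (G2 c hcr).symm
        rw [this]
        exact h3 (Or.inl hc)
    obtain ⟨v, hv, hvc⟩ := hG
    obtain ⟨w, hw, hw'⟩ := h1 ⟨ψ₁.symm v, by simpa using p3 v (by simpa using hv), rfl⟩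
    refine ⟨ψ₂ w, by simpa using q4 w (by have : ‖w‖ ≤ R + 1 := by simpa using hw
                                          linarith), ?_⟩
    change G (H (G.symm (f (ψ₂ w)))) = c
    rw [← G1, Homeomorph.symm_apply_apply, hw', H1, Homeomorph.apply_symm_apply, hvc,
      Homeomorph.apply_symm_apply]

/-- An increasing union of open cells is an open cell. -/
theorem nonempty_homeomorph_of_iUnion {e : ℕ → E → X} (he : ∀ n, IsOpenEmbedding (e n))
    (hmono : ∀ n, range (e n) ⊆ range (e (n + 1))) (hcov : ∀ x, ∃ n, x ∈ range (e n)) :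
    Nonempty (X ≃ₜ E) := by
  have hmono' : Monotone fun n => range (e n) := monotone_nat_of_le_succ hmono
  set C : ℕ → Set X := fun n => ⋃ k ∈ Finset.range (n + 1), e k '' closedBall 0 n with hCdef
  have hC : ∀ n, IsCompact (C n) := fun n =>
    (Finset.range (n + 1)).isCompact_biUnion fun k _ =>
      (isCompact_closedBall _ _).image (he k).continuous
  -- Each new chart agrees with the previous one on radius 2n and covers `C n` by radius 2n + 2. The
  -- first property makes the charts converge, the second makes the limit surjective.
  have step : ∀ (n : ℕ) (f : {f : E → X // IsOpenEmbedding f}),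
      ∃ f' : {f : E → X // IsOpenEmbedding f}, (∀ x, ‖x‖ ≤ 2 * n → f'.1 x = f.1 x) ∧
        C n ⊆ f'.1 '' closedBall 0 (2 * n + 2) := by
    rintro n ⟨f, hf⟩
    have hK : IsCompact (C n ∪ f '' closedBall 0 (2 * n + 2)) :=
      (hC n).union ((isCompact_closedBall _ _).image hf.continuous)
    obtain ⟨m, hm⟩ := hK.elim_directed_cover (fun n => range (e n))
      (fun n => (he n).isOpen_range) (fun x _ => mem_iUnion.2 (hcov x)) hmono'.directed_le
    obtain ⟨f', h1, h2, h3⟩ := exists_engulf hf (he m) (hC n) (subset_union_left.trans hm)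
      (R := 2 * n) (by positivity) (subset_union_right.trans hm)
    exact ⟨⟨f', h1⟩, h2, h3⟩
  choose S hS1 hS2 using step
  let f : ℕ → {f : E → X // IsOpenEmbedding f} := fun n => Nat.rec ⟨e 0, he 0⟩ S n
  have hf1 : ∀ (n : ℕ) (x : E), ‖x‖ ≤ 2 * n → (f (n + 1)).1 x = (f n).1 x := fun n => hS1 n (f n)
  have hf2 : ∀ n, C n ⊆ (f (n + 1)).1 '' closedBall 0 (2 * n + 2) := fun n => hS2 n (f n)
  have hstab : ∀ (m n : ℕ) (x : E), m ≤ n → ‖x‖ ≤ 2 * m → (f n).1 x = (f m).1 x := by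
    intro m n x hmn hx
    induction n, hmn using Nat.le_induction with
    | base => rfl
    | succ n hmn ih =>
      rw [← ih]
      refine hf1 n x (hx.trans ?_)
      have : (m : ℝ) ≤ n := by exact_mod_cast hmn
      linarith
  -- As ‖x‖ ≤ 2⌈‖x‖⌉, the value at `x` no longer changes from this index on. Near every point the
  -- limit coincides with a single chart, so it is continuous and open.
  let F : E → X := fun x => (f ⌈‖x‖⌉₊).1 x
  have hF : ∀ (n : ℕ) (x : E), ‖x‖ ≤ 2 * n → F x = (f n).1 x := by
    intro n x hx
    have h : ‖x‖ ≤ 2 * (⌈‖x‖⌉₊ : ℝ) := by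
      have := Nat.le_ceil ‖x‖
      have := norm_nonneg x
      linarith
    rcases le_total n ⌈‖x‖⌉₊ with hn | hn
    · exact hstab n _ x hn hx
    · exact (hstab _ n x hn h).symm
  have hloc : ∀ x, map F (𝓝 x) = 𝓝 (F x) := by
    intro x
    set n := ⌈‖x‖⌉₊ + 1 with hn
    have hlt : ‖x‖ < 2 * (n : ℝ) := by
      have := Nat.le_ceil ‖x‖
      have := norm_nonneg x
      push_cast [hn]
      linarith
    have hev : F =ᶠ[𝓝 x] (f n).1 := by
      filter_upwards [(continuous_norm.tendsto x).eventually_lt_const hlt] with y hy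
        using hF n y hy.le
    rw [map_congr hev, (f n).2.map_nhds_eq, hF n x hlt.le]
  have hinj : Function.Injective F := by
    intro x y hxy
    set n := ⌈max ‖x‖ ‖y‖⌉₊
    have h := Nat.le_ceil (max ‖x‖ ‖y‖)
    have hx : ‖x‖ ≤ 2 * (n : ℝ) := by
      have := le_max_left ‖x‖ ‖y‖
      have := norm_nonneg x
      linarith
    have hy : ‖y‖ ≤ 2 * (n : ℝ) := by
      have := le_max_right ‖x‖ ‖y‖
      have := norm_nonneg y
      linarith
    rw [hF n x hx, hF n y hy] at hxy
    exact (f n).2.injective hxy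
  have hsurj : Function.Surjective F := by
    intro x
    obtain ⟨k, v, rfl⟩ := hcov x
    set n := max k ⌈‖v‖⌉₊
    have hx : e k v ∈ C n := by
      refine mem_biUnion (x := k) (by simp [n])
        ⟨v, ?_, rfl⟩
      have h1 := Nat.le_ceil ‖v‖
      have h2 : (⌈‖v‖⌉₊ : ℝ) ≤ n := by exact_mod_cast le_max_right _ _
      simpa using h1.trans h2
    obtain ⟨w, hw, hw'⟩ := hf2 n hx
    refine ⟨w, ?_⟩
    rw [← hw']
    refine hF (n + 1) w ?_
    push_cast
    have : ‖w‖ ≤ 2 * n + 2 := by simpa using hw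
    linarith
  have hcont : Continuous F := continuous_iff_continuousAt.2 fun x => (hloc x).le
  have hopen : IsOpenMap F := isOpenMap_iff_nhds_le.2 fun x => (hloc x).ge
  exact ⟨((Equiv.ofBijective F ⟨hinj, hsurj⟩).toHomeomorphOfContinuousOpen hcont hopen).symm⟩

end Extension

section HalfDisc

/-- The multiples of 2π form a discrete set, and the domain is connected. -/
theorem continuous_int_of_cast {Y : Type*} [TopologicalSpace Y] [PreconnectedSpace Y] {k : Y → ℝ}
    (hk : Continuous k) (h : ∀ y, ∃ m : ℤ, k y = m * (2 * Real.pi)) (y z : Y) : k y = k z := by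
  choose m hm using h
  have hc : Continuous m := by
    rw [Int.isClosedEmbedding_coe_real.continuous_iff]
    have : (fun y => ((m y : ℤ) : ℝ)) = fun y => k y / (2 * Real.pi) := by
      funext y
      rw [hm, mul_div_cancel_right₀ _ Real.two_pi_pos.ne']
    exact (congrArg Continuous this).mpr (hk.div_const _)
  rw [hm, hm, PreconnectedSpace.constant inferInstance hc (x := y) (y := z)]

/-- A set that contracts radially, in the complement of one of its points, is not homeomorphic to
an open set of the plane. -/
theorem not_isOpenEmbedding_of_contractible {V : Set ℂ} {m : ℂ} (hm : m ∈ V)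
    (hV : ∀ p ∈ V, p ≠ m → ∀ r : ℝ, 0 ≤ r → r ≤ 1 → r • p ∈ V ∧ r • p ≠ m) (h : V → ℂ) :
    ¬ IsOpenEmbedding h := by
  intro hh
  set b := h ⟨m, hm⟩ with hb
  obtain ⟨ρ, hρ, hball⟩ := nhds_basis_closedBall.mem_iff.1
    (hh.isOpen_range.mem_nhds ⟨⟨m, hm⟩, rfl⟩ : range h ∈ 𝓝 b)
  -- A circle around the image `b` of `m`. Its preimage `γ` is a loop in `V` that avoids `m` and can
  -- be contracted radially without meeting `m`.
  let c : I → ℂ := fun θ => b + ρ * (Circle.exp (2 * Real.pi * (θ : ℝ)) : ℂ)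
  have hc : Continuous c := by
    have : Continuous fun θ : I => ((Circle.exp (2 * Real.pi * (θ : ℝ)) : Circle) : ℂ) :=
      continuous_subtype_val.comp (Circle.exp.continuous.comp (by fun_prop))
    exact continuous_const.add (continuous_const.mul this)
  have hcr : ∀ θ, c θ ∈ range h := fun θ => hball (by
    rw [mem_closedBall, dist_eq_norm]
    simp only [c, add_sub_cancel_left, norm_mul, Circle.norm_coe, mul_one, Complex.norm_real,
      Real.norm_of_nonneg hρ.le]
    exact le_rfl)
  obtain ⟨γ, hγ⟩ : ∃ γ : I → V, ∀ θ, h (γ θ) = c θ :=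
    ⟨fun θ => (hcr θ).choose, fun θ => (hcr θ).choose_spec⟩
  have hγc : Continuous γ := by
    rw [hh.continuous_iff]
    exact (funext hγ : h ∘ γ = c) ▸ hc
  have hγm : ∀ θ, ((γ θ : V) : ℂ) ≠ m := by
    intro θ hθ
    have : γ θ = ⟨m, hm⟩ := Subtype.ext hθ
    have h1 := hγ θ
    rw [this, ← hb] at h1
    have : (ρ : ℂ) * (Circle.exp (2 * Real.pi * (θ : ℝ)) : ℂ) = 0 := by
      have := h1
      simp only [c] at this
      simpa using this
    simp [hρ.ne'] at this
  let P : I × I → V := fun x =>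
    ⟨(x.1 : ℝ) • ((γ x.2 : V) : ℂ), (hV _ (γ x.2).2 (hγm _) _ x.1.2.1 x.1.2.2).1⟩
  have hPc : Continuous P := Continuous.subtype_mk (by fun_prop) _
  have hPm : ∀ x, h (P x) - b ≠ 0 := by
    intro x hx
    have h1 := hh.injective (sub_eq_zero.1 hx)
    exact (hV _ (γ x.2).2 (hγm _) _ x.1.2.1 x.1.2.2).2 (congrArg Subtype.val h1)
  have hhP : Continuous fun x => h (P x) - b := (hh.continuous.comp hPc).sub continuous_const
  -- The direction of `h ∘ P` as seen from `b`: a homotopy of loops in the circle, from a constant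
  -- loop to the loop of degree one.
  let N : C(I × I, Circle) :=
    ⟨fun x => ⟨(h (P x) - b) / (‖h (P x) - b‖ : ℂ), by
      simp [Submonoid.unitSphere, hPm x]⟩, by
      refine Continuous.subtype_mk (hhP.div (Complex.continuous_ofReal.comp hhP.norm)
        fun x => ?_) _
      simpa using hPm x⟩
  have hN : ∀ x, (N x : ℂ) = (h (P x) - b) / (‖h (P x) - b‖ : ℂ) := fun x => rfl
  have N0 : ∀ θ, N (0, θ) = N (0, 0) := by
    intro θ
    have : P (0, θ) = P (0, 0) := Subtype.ext (by simp [P])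
    refine Subtype.ext ?_
    rw [hN, hN, this]
  have N1 : ∀ θ : I, N (1, θ) = Circle.exp (2 * Real.pi * (θ : ℝ)) := by
    intro θ
    have : P (1, θ) = γ θ := Subtype.ext (by simp [P])
    refine Subtype.ext ?_
    have hρ' : (ρ : ℂ) ≠ 0 := by exact_mod_cast hρ.ne'
    rw [hN, this, hγ]
    simp only [c, add_sub_cancel_left, norm_mul,
      Circle.norm_coe, mul_one, Complex.norm_real, Real.norm_of_nonneg hρ.le]
    rw [mul_div_cancel_left₀ _ hρ']
  have Ns : ∀ s, N (s, 1) = N (s, 0) := by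
    intro s
    have h1 : γ 1 = γ 0 := by
      apply hh.injective
      rw [hγ, hγ]
      simp [c]
    have : P (s, 1) = P (s, 0) := Subtype.ext (by simp [P, h1])
    refine Subtype.ext ?_
    rw [hN, hN, this]
  -- The increment of the lift `F` along a loop is a multiple of 2π and so is constant during the
  -- homotopy. It is 0 at the constant loop and 2π at the loop of degree one.
  obtain ⟨a, ha⟩ := Circle.exp_surjective (N (0, 0))
  let F := Circle.isCoveringMap_exp.liftHomotopy N (ContinuousMap.const I a)
    fun θ => by rw [N0 θ, ContinuousMap.const_apply, ha]
  have F0 : ∀ θ, F (0, θ) = a := fun θ => Circle.isCoveringMap_exp.liftHomotopy_zero N _ _ θ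
  have FN : ∀ x, Circle.exp (F x) = N x := fun x =>
    congrFun (Circle.isCoveringMap_exp.liftHomotopy_lifts N _ _) x
  have k1 : F (1, 1) - F (1, 0) = F (0, 1) - F (0, 0) := by
    refine continuous_int_of_cast (k := fun s : I => F (s, 1) - F (s, 0)) (by fun_prop)
      (fun s => ?_) 1 0
    obtain ⟨n, hn⟩ := Circle.exp_eq_exp.1 ((FN (s, 1)).trans ((Ns s).trans (FN (s, 0)).symm))
    exact ⟨n, by rw [hn]; ring⟩
  have k2 : F (1, 1) - 2 * Real.pi * ((1 : I) : ℝ) = F (1, 0) - 2 * Real.pi * ((0 : I) : ℝ) := by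
    refine continuous_int_of_cast (k := fun s : I => F (1, s) - 2 * Real.pi * (s : ℝ))
      (by fun_prop) (fun s => ?_) 1 0
    obtain ⟨n, hn⟩ := Circle.exp_eq_exp.1 ((FN (1, s)).trans (N1 s))
    exact ⟨n, by rw [hn]; ring⟩
  rw [F0, F0] at k1
  have := Real.pi_pos
  simp only [Icc.coe_one, Icc.coe_zero] at k2
  linarith

end HalfDisc

end PlaneTopology

/-! ### Polar coordinates -/

namespace Pentagon

/-- The point of the unit circle at the angle of `x` full turns. -/
def turn (x : ℝ) : ℂ := Complex.exp (((2 * Real.pi * x : ℝ) : ℂ) * Complex.I)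

theorem turn_add (x y : ℝ) : turn (x + y) = turn x * turn y := by
  rw [turn, turn, turn, ← Complex.exp_add]
  congr 1
  push_cast
  ring

theorem turn_eq_turn {x y : ℝ} : turn x = turn y ↔ ∃ n : ℤ, x = y + n := by
  rw [turn, turn, Complex.exp_eq_exp_iff_exists_int]
  refine exists_congr fun n => ?_
  have hI : ((2 * Real.pi : ℝ) : ℂ) * Complex.I ≠ 0 :=
    mul_ne_zero (by exact_mod_cast Real.two_pi_pos.ne') Complex.I_ne_zero
  constructor
  · intro h
    have : ((2 * Real.pi : ℝ) : ℂ) * Complex.I * (x : ℂ) =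
        ((2 * Real.pi : ℝ) : ℂ) * Complex.I * ((y + n : ℝ) : ℂ) := by
      push_cast at h ⊢
      linear_combination h
    exact_mod_cast mul_left_cancel₀ hI this
  · rintro rfl
    push_cast
    ring

@[simp] theorem norm_turn (x : ℝ) : ‖turn x‖ = 1 := Complex.norm_exp_ofReal_mul_I _

@[fun_prop] theorem continuous_turn : Continuous turn := by
  unfold turn
  fun_prop

theorem smul_turn_eq {r r' x y : ℝ} (hr : 0 ≤ r) (hr' : 0 ≤ r') :
    r • turn x = r' • turn y ↔ r = r' ∧ (r = 0 ∨ ∃ n : ℤ, x = y + n) := by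
  constructor
  · intro h
    have h1 := congrArg norm h
    rw [norm_smul, norm_smul, norm_turn, norm_turn, mul_one, mul_one, Real.norm_of_nonneg hr,
      Real.norm_of_nonneg hr'] at h1
    subst h1
    refine ⟨rfl, or_iff_not_imp_left.2 fun h0 => turn_eq_turn.1 (smul_right_injective _ h0 h)⟩
  · rintro ⟨rfl, rfl | h⟩
    · simp
    · rw [turn_eq_turn.2 h]

theorem exists_smul_turn (z : ℂ) : ∃ x : ℝ, 0 ≤ x ∧ x < 1 ∧ ‖z‖ • turn x = z := by
  have h2 := Real.two_pi_pos
  refine ⟨Int.fract (z.arg / (2 * Real.pi)), Int.fract_nonneg _, Int.fract_lt_one _, ?_⟩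
  have h : turn (Int.fract (z.arg / (2 * Real.pi))) = turn (z.arg / (2 * Real.pi)) :=
    turn_eq_turn.2 ⟨-⌊z.arg / (2 * Real.pi)⌋, by rw [Int.fract]; push_cast; ring⟩
  rw [h, turn, mul_div_cancel₀ _ h2.ne', Complex.real_smul, Complex.norm_mul_exp_arg_mul_I]

theorem val_add_one (i : ZMod 5) : (i + 1).val = i.val + 1 ∨ (i + 1).val + 5 = i.val + 1 := by
  revert i; decide

/-- This is the arithmetic of passing from one arc of a circle to the next: parameters in [0, 1]
that agree modulo 1 are equal or are opposite ends. -/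
theorem int_of_sub_mem {s s' : I} {m : ℤ} (h : (s : ℝ) - s' = m) :
    (m = 0 ∧ s = s') ∨ (m = 1 ∧ s = 1 ∧ s' = 0) ∨ (m = -1 ∧ s = 0 ∧ s' = 1) := by
  have a := s.2.1
  have b := s.2.2
  have c := s'.2.1
  have d := s'.2.2
  have h1 : m ≤ 1 := by
    have : (m : ℝ) ≤ 1 := by linarith
    exact_mod_cast this
  have h2 : -1 ≤ m := by
    have : (-1 : ℝ) ≤ m := by linarith
    exact_mod_cast this
  obtain rfl | rfl | rfl : m = 0 ∨ m = 1 ∨ m = -1 := by omega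
  · exact Or.inl ⟨rfl, Subtype.ext (by push_cast at h; linarith)⟩
  · push_cast at h
    exact Or.inr (Or.inl ⟨rfl, Subtype.ext (by rw [Set.Icc.coe_one]; linarith),
      Subtype.ext (by rw [Set.Icc.coe_zero]; linarith)⟩)
  · push_cast at h
    exact Or.inr (Or.inr ⟨rfl, Subtype.ext (by rw [Set.Icc.coe_zero]; linarith),
      Subtype.ext (by rw [Set.Icc.coe_one]; linarith)⟩)

theorem sidePt_eq_iff_turn {i j : ZMod 5} {s s' : I} :
    turn ((i.val + s) / 5) = turn ((j.val + s') / 5) ↔ sidePt i s = sidePt j s' := by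
  have aux : ∀ i : ZMod 5, turn ((i.val + 1) / 5) = turn (((i + 1).val + 0) / 5) := by
    intro i
    rw [turn_eq_turn]
    rcases val_add_one i with h | h
    · exact ⟨0, by rw [h]; push_cast; ring⟩
    · refine ⟨1, ?_⟩
      have : ((i + 1).val : ℝ) + 5 = i.val + 1 := by exact_mod_cast h
      rw [← this]
      push_cast
      ring
  constructor
  · intro h
    obtain ⟨n, hn⟩ := turn_eq_turn.1 h
    have h1 : (s : ℝ) - s' = ((j.val - i.val + 5 * n : ℤ) : ℝ) := by
      push_cast
      linarith
    have h2 : ((j.val - i.val + 5 * n : ℤ) : ZMod 5) = j - i := by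
      push_cast
      rw [ZMod.natCast_zmod_val, ZMod.natCast_zmod_val, show (5 : ZMod 5) = 0 from rfl]
      ring
    rcases int_of_sub_mem h1 with ⟨h3, rfl⟩ | ⟨h3, rfl, rfl⟩ | ⟨h3, rfl, rfl⟩ <;>
      rw [h3] at h2
    · rw [sub_eq_zero.1 h2.symm]
    · rw [sidePt_one, sidePt_zero, sub_eq_iff_eq_add'.1 h2.symm]
      simp
    · rw [sidePt_one, sidePt_zero, sub_eq_iff_eq_add'.1 h2.symm]
      simp
  · intro h
    rcases sidePt_eq_sidePt h with ⟨rfl, rfl⟩ | ⟨rfl, rfl, rfl⟩ | ⟨rfl, rfl, rfl⟩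
    · rfl
    · exact aux i
    · exact (aux j).symm

/-- The pentagon in polar coordinates. -/
theorem exists_disc : ∃ h : pentagon → ℂ, Continuous h ∧ Function.Injective h ∧
    Set.range h = Metric.closedBall 0 1 ∧
    ∀ i s r, h (cone i s r) = (r : ℝ) • turn ((i.val + s) / 5) := by
  refine exists_coneMap (fun i s => turn ((i.val + s) / 5)) (fun i => by fun_prop) (fun i s => by simp)
    (fun i j s s' => sidePt_eq_iff_turn) fun z hz => ?_
  obtain ⟨x, h0, h1, hx⟩ := exists_smul_turn z
  rw [hz, one_smul] at hx
  have hn : ⌊5 * x⌋₊ < 5 := by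
    rw [Nat.floor_lt (by linarith)]
    push_cast
    linarith
  have hf1 := Nat.floor_le (show 0 ≤ 5 * x by linarith)
  have hf2 := Nat.lt_floor_add_one (5 * x)
  refine ⟨(⌊5 * x⌋₊ : ZMod 5), ⟨5 * x - ⌊5 * x⌋₊, by linarith, by linarith⟩, ?_⟩
  rw [ZMod.val_natCast_of_lt hn, ← hx]
  congr 1
  simp

/-- The boundary of a square as a pentagon. -/
def squareSide (i : ZMod 5) (s : I) : ℝ × ℝ :=
  if i = 0 then (s, 1) else if i = 1 then (1, 1 - 2 * s) else if i = 2 then (1 - 2 * s, -1) else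
    if i = 3 then (-1, -1 + 2 * s) else (-1 + s, 1)

theorem squareSide_zero (s : I) : squareSide 0 s = ((s : ℝ), 1) := rfl
theorem squareSide_one (s : I) : squareSide 1 s = (1, 1 - 2 * (s : ℝ)) := rfl
theorem squareSide_two (s : I) : squareSide 2 s = (1 - 2 * (s : ℝ), -1) := rfl
theorem squareSide_three (s : I) : squareSide 3 s = (-1, -1 + 2 * (s : ℝ)) := rfl
theorem squareSide_four (s : I) : squareSide 4 s = (-1 + (s : ℝ), 1) := rfl

theorem eq_of_squareSide_eq {i j : ZMod 5} {s s' : I} (h : squareSide i s = squareSide j s') :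
    (i = j ∧ (s : ℝ) = s') ∨ (j = i + 1 ∧ (s : ℝ) = 1 ∧ (s' : ℝ) = 0) ∨
      (i = j + 1 ∧ (s : ℝ) = 0 ∧ (s' : ℝ) = 1) := by
  have a := s.2.1
  have b := s.2.2
  have a' := s'.2.1
  have b' := s'.2.2
  generalize hx : (s : ℝ) = x at *
  generalize hy : (s' : ℝ) = y at *
  obtain ⟨h1, h2⟩ := Prod.ext_iff.1 h
  obtain rfl | rfl | rfl | rfl | rfl := zmod_five_cases i <;>
  obtain rfl | rfl | rfl | rfl | rfl := zmod_five_cases j <;>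
  simp only [squareSide_zero, squareSide_one, squareSide_two, squareSide_three,
    squareSide_four, hx, hy] at h1 h2 <;>
  first
  | (exfalso; linarith)
  | exact Or.inl ⟨by decide, by linarith⟩
  | exact Or.inr (Or.inl ⟨by decide, by linarith, by linarith⟩)
  | exact Or.inr (Or.inr ⟨by decide, by linarith, by linarith⟩)

/-- Corner 0 is put at the middle of the top edge, which consists of the sides 4 and 0; the sides 1,
2, 3 are the right, bottom and left edges. This form serves both `nonempty_refinement` and
`nonempty_sector`. -/
theorem exists_square : ∃ h : pentagon → ℝ × ℝ, Continuous h ∧ Function.Injective h ∧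
    Set.range h = Metric.closedBall 0 1 ∧
    ∀ i s r, h (cone i s r) = (r : ℝ) • squareSide i s := by
  refine exists_coneMap squareSide (fun i => ?_) (fun i s => ?_) (fun i j s s' => ?_) fun z hz => ?_
  · unfold squareSide
    split_ifs <;> fun_prop
  · have a := s.2.1
    have b := s.2.2
    obtain rfl | rfl | rfl | rfl | rfl := zmod_five_cases i <;>
    simp only [squareSide_zero, squareSide_one, squareSide_two, squareSide_three, squareSide_four,
      Prod.norm_def, Real.norm_eq_abs, abs_neg, abs_one, sup_eq_right, sup_eq_left, abs_le] <;>
    constructor <;> linarith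
  · constructor
    · intro h
      rcases eq_of_squareSide_eq h with ⟨rfl, e⟩ | ⟨rfl, e, e'⟩ | ⟨rfl, e, e'⟩
      · rw [show s = s' from Subtype.ext e]
      · rw [show s = 1 from Subtype.ext e, show s' = 0 from Subtype.ext e', sidePt_zero, sidePt_one]
      · rw [show s = 0 from Subtype.ext e, show s' = 1 from Subtype.ext e', sidePt_zero, sidePt_one]
    · intro h
      have aux : ∀ i : ZMod 5, squareSide i 1 = squareSide (i + 1) 0 := by
        intro i
        obtain rfl | rfl | rfl | rfl | rfl := zmod_five_cases i
        · change squareSide 0 1 = squareSide 1 0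
          norm_num [squareSide_zero, squareSide_one]
        · change squareSide 1 1 = squareSide 2 0
          norm_num [squareSide_two, squareSide_one]
        · change squareSide 2 1 = squareSide 3 0
          norm_num [squareSide_two, squareSide_three]
        · change squareSide 3 1 = squareSide 4 0
          norm_num [squareSide_four, squareSide_three]
        · change squareSide 4 1 = squareSide 0 0
          norm_num [squareSide_four, squareSide_zero]
      rcases sidePt_eq_sidePt h with ⟨rfl, rfl⟩ | ⟨rfl, rfl, rfl⟩ | ⟨rfl, rfl, rfl⟩
      · rfl
      · exact aux i
      · exact (aux j).symm
  · obtain ⟨x, y⟩ := z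
    rw [Prod.norm_def, Real.norm_eq_abs, Real.norm_eq_abs] at hz
    have hx : |x| ≤ 1 := hz ▸ le_max_left _ _
    have hy : |y| ≤ 1 := hz ▸ le_max_right _ _
    rw [abs_le] at hx hy
    dsimp only at hz
    rcases max_choice |x| |y| with h | h <;> rw [h] at hz
    · rcases eq_or_eq_neg_of_abs_eq hz with rfl | rfl
      · refine ⟨1, ⟨(1 - y) / 2, by linarith, by linarith⟩, ?_⟩
        rw [squareSide_one]; ext <;> dsimp only; ring
      · refine ⟨3, ⟨(1 + y) / 2, by linarith, by linarith⟩, ?_⟩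
        rw [squareSide_three]; ext <;> dsimp only; ring
    · rcases eq_or_eq_neg_of_abs_eq hz with rfl | rfl
      · rcases le_total 0 x with h0 | h0
        · exact ⟨0, ⟨x, by linarith, by linarith⟩, rfl⟩
        · refine ⟨4, ⟨1 + x, by linarith, by linarith⟩, ?_⟩
          rw [squareSide_four]; ext <;> dsimp only; ring
      · refine ⟨2, ⟨(1 - x) / 2, by linarith, by linarith⟩, ?_⟩
        rw [squareSide_two]; ext <;> dsimp only; ring

end Pentagon

/-! ### A geometric model of the subdivision of one pentagon -/

namespace Pentagon

/-- The division of the pentagon into six pentagons. -/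
structure Refinement where
  map : Option (ZMod 5) → pentagon → pentagon
  continuous_map : ∀ c, Continuous (map c)
  surjective : ∀ q, ∃ c p, map c p = q
  central : ∀ i s, map none (sidePt i s) = map (some (i + 1)) (sidePt 2 (unitInterval.symm s))
  spoke : ∀ i s, map (some i) (sidePt 1 s) = map (some (i + 1)) (sidePt 3 (unitInterval.symm s))
  firstHalf : ∀ i (s s' : I), (s' : ℝ) = s / 2 → map (some i) (sidePt 0 s) = sidePt i s'
  secondHalf : ∀ i (s s' : I), (s' : ℝ) = (1 + s) / 2 →
    map (some (i + 1)) (sidePt 4 s) = sidePt i s'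
  fibre : ∀ {c c' p p'}, map c p = map c' p' →
    (c = c' ∧ p = p') ∨
    (∃ i s, (c = none ∧ p = sidePt i s ∧ c' = some (i + 1) ∧
      p' = sidePt 2 (unitInterval.symm s))) ∨
    (∃ i s, (c' = none ∧ p' = sidePt i s ∧ c = some (i + 1) ∧
      p = sidePt 2 (unitInterval.symm s))) ∨
    (∃ i s, (c = some i ∧ p = sidePt 1 s ∧ c' = some (i + 1) ∧
      p' = sidePt 3 (unitInterval.symm s))) ∨
    (∃ i s, (c' = some i ∧ p' = sidePt 1 s ∧ c = some (i + 1) ∧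
      p = sidePt 3 (unitInterval.symm s)))

theorem turn_val_add_one (i : ZMod 5) (x : ℝ) :
    turn (((i + 1).val + x) / 5) = turn ((i.val + (1 + x)) / 5) := by
  rw [turn_eq_turn]
  rcases val_add_one i with h | h
  · exact ⟨0, by rw [h]; push_cast; ring⟩
  · refine ⟨-1, ?_⟩
    have : ((i + 1).val : ℝ) + 5 = i.val + 1 := by exact_mod_cast h
    rw [← add_assoc, ← this]
    push_cast
    ring

/-- In polar coordinates the central pentagon becomes the disc of radius 1/2, turned by 1/10 so that
its corners point to the midpoints of the sides. The pentagon at `c_i` becomes the sector of the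
annulus 1/2 ≤ r ≤ 1 that reaches half a side to both sides of `c_i`; it is parametrized by the
square, with the corner `c_i` at the middle of the top edge. -/
theorem nonempty_refinement : Nonempty Refinement := by
  obtain ⟨ρ, ρc, ρi, ρr, ρcone⟩ := exists_disc
  obtain ⟨H, Hc, Hi, Hr, Hcone⟩ := exists_square
  have hρ : ∀ i s, ρ (sidePt i s) = turn ((i.val + s) / 5) := fun i s => by
    rw [← cone_one, ρcone, Set.Icc.coe_one, one_smul]
  have hH : ∀ i s, H (sidePt i s) = squareSide i s := fun i s => by
    rw [← cone_one, Hcone, Set.Icc.coe_one, one_smul]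
  have hb : ∀ p, (|(H p).1| ≤ 1) ∧ |(H p).2| ≤ 1 := by
    intro p
    have : H p ∈ Metric.closedBall 0 1 := Hr ▸ ⟨p, rfl⟩
    rw [mem_closedBall_zero_iff, Prod.norm_def] at this
    exact ⟨(le_max_left _ _).trans this, (le_max_right _ _).trans this⟩
  simp only [abs_le] at hb
  have hHs : ∀ x y : ℝ, -1 ≤ x → x ≤ 1 → -1 ≤ y → y ≤ 1 → ∃ p, H p = (x, y) := by
    intro x y h1 h2 h3 h4
    have : (x, y) ∈ Metric.closedBall (0 : ℝ × ℝ) 1 := by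
      rw [mem_closedBall_zero_iff, Prod.norm_def]
      exact max_le (abs_le.2 ⟨h1, h2⟩) (abs_le.2 ⟨h3, h4⟩)
    rwa [← Hr] at this
  have hρs : ∀ z : ℂ, ‖z‖ ≤ 1 → ∃ p, ρ p = z := by
    intro z hz
    have : z ∈ Metric.closedBall (0 : ℂ) 1 := by simpa using hz
    rwa [← ρr] at this
  have hρn : ∀ p, ‖ρ p‖ ≤ 1 := by
    intro p
    have : ρ p ∈ Metric.closedBall 0 1 := ρr ▸ ⟨p, rfl⟩
    simpa using this
  let F : Option (ZMod 5) → pentagon → ℂ := fun c p =>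
    c.elim ((1 / 2 : ℝ) • (turn (1 / 10) * ρ p))
      fun i => ((3 + (H p).2) / 4) • turn ((i.val + (H p).1 / 2) / 5)
  have F0 : ∀ p, F none p = (1 / 2 : ℝ) • (turn (1 / 10) * ρ p) := fun p => rfl
  have F1 : ∀ i p, F (some i) p = ((3 + (H p).2) / 4) • turn ((i.val + (H p).1 / 2) / 5) :=
    fun i p => rfl
  have Fn0 : ∀ p, ‖F none p‖ = ‖ρ p‖ / 2 := fun p => by
    rw [F0, norm_smul, norm_mul, norm_turn]
    norm_num
    ring
  have Fn1 : ∀ i p, ‖F (some i) p‖ = (3 + (H p).2) / 4 := fun i p => by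
    rw [F1, norm_smul, norm_turn, mul_one, Real.norm_of_nonneg]
    linarith [(hb p).2.1]
  have Fn : ∀ c p, ‖F c p‖ ≤ 1 := by
    rintro (_ | i) p
    · rw [Fn0]
      linarith [hρn p]
    · rw [Fn1]
      linarith [(hb p).2.2]
  choose f hf using fun c p => hρs (F c p) (Fn c p)
  have ext : ∀ {c c' p p'}, F c p = F c' p' → f c p = f c' p' := by
    intro c c' p p' h
    apply ρi
    rw [hf, hf, h]
  have Fcentral : ∀ i s, F none (sidePt i s) = F (some (i + 1)) (sidePt 2 (unitInterval.symm s)) := by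
    intro i s
    rw [F0, F1, hρ, hH, squareSide_two, turn_val_add_one, ← turn_add]
    dsimp only
    rw [show ((3 : ℝ) + -1) / 4 = 1 / 2 by norm_num, unitInterval.coe_symm_eq]
    congr 2
    ring
  have Fspoke : ∀ i s,
      F (some i) (sidePt 1 s) = F (some (i + 1)) (sidePt 3 (unitInterval.symm s)) := by
    intro i s
    rw [F1, F1, hH, hH, squareSide_one, squareSide_three, turn_val_add_one]
    congr 2
    · rw [unitInterval.coe_symm_eq]
      dsimp only
      ring
    · dsimp only
      ring
  have hspoke : ∀ (i j : ZMod 5) p p', F (some i) p = F (some j) p' → (H p).1 = 1 →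
      (H p').1 = -1 → (H p).2 = (H p').2 → i + 1 = j → ∃ s, p = sidePt 1 s ∧
        p' = sidePt 3 (unitInterval.symm s) := by
    intro i j p p' h h1 h2 h3 h4
    refine ⟨⟨(1 - (H p).2) / 2, by linarith [(hb p).2.2], by linarith [(hb p).2.1]⟩, Hi ?_, Hi ?_⟩
    · rw [hH, squareSide_one]
      ext
      · exact h1
      · dsimp only
        ring
    · rw [hH, squareSide_three, unitInterval.coe_symm_eq]
      ext
      · exact h2
      · dsimp only
        rw [h3]
        ring
  have hcentral : ∀ (j : ZMod 5) p p', F none p = F (some j) p' → ∃ i s, p = sidePt i s ∧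
      j = i + 1 ∧ p' = sidePt 2 (unitInterval.symm s) := by
    intro j p p' h
    have hn := congrArg norm h
    rw [Fn0, Fn1] at hn
    have h1 := hρn p
    have h2 := (hb p').2.1
    have hv : (H p').2 = -1 := by linarith
    have hr : ‖ρ p‖ = 1 := by linarith
    obtain ⟨i, s, r, rfl⟩ := cone_surjective p
    have r1 : r = 1 := by
      rw [ρcone, norm_smul, norm_turn, mul_one, Real.norm_of_nonneg r.2.1] at hr
      exact Subtype.ext hr
    subst r1
    rw [cone_one] at *
    obtain ⟨s', hs'⟩ : ∃ s' : I, p' = sidePt 2 (unitInterval.symm s') := by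
      refine ⟨⟨(1 + (H p').1) / 2, by linarith [(hb p').1.1], by linarith [(hb p').1.2]⟩, Hi ?_⟩
      rw [hH, squareSide_two, unitInterval.coe_symm_eq]
      ext
      · dsimp only
        ring
      · exact hv
    refine ⟨j - 1, s', ?_, by ring, hs'⟩
    have h3 := Fcentral (j - 1) s'
    rw [sub_add_cancel, ← hs', ← h, F0, F0] at h3
    have h4 := smul_right_injective ℂ (show (1 / 2 : ℝ) ≠ 0 by norm_num) h3
    have ht : turn (1 / 10) ≠ 0 := norm_ne_zero_iff.1 (by simp)
    exact (ρi (mul_left_cancel₀ ht h4)).symm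
  refine ⟨⟨f, fun c => ?_, fun q => ?_, fun i s => ext (Fcentral i s), fun i s => ext (Fspoke i s),
    fun i s s' h => ?_, fun i s s' h => ?_, fun {c c' p p'} h => ?_⟩⟩
  · rw [(ρc.isClosedEmbedding ρi).isInducing.continuous_iff]
    have : ρ ∘ f c = F c := funext fun p => hf c p
    rw [this]
    rcases c with _ | i
    · change Continuous fun p => (1 / 2 : ℝ) • (turn (1 / 10) * ρ p)
      fun_prop
    · have h1 : Continuous fun p => (H p).1 := continuous_fst.comp Hc
      have h2 : Continuous fun p => (H p).2 := continuous_snd.comp Hc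
      change Continuous fun p => ((3 + (H p).2) / 4) • turn ((i.val + (H p).1 / 2) / 5)
      fun_prop
  · obtain ⟨i, s, r, rfl⟩ := cone_surjective q
    have hsurj : ∀ c p, F c p = ρ (cone i s r) → ∃ c p, f c p = cone i s r := fun c p h =>
      ⟨c, p, ρi (by rw [hf, h])⟩
    have s0 := s.2.1
    have s1 := s.2.2
    have r1 := r.2.2
    rcases le_total (r : ℝ) (1 / 2) with hr | hr
    · obtain ⟨p, hp⟩ := hρs ((2 : ℝ) • (turn (-(1 / 10)) * ρ (cone i s r))) (by
        rw [norm_smul, norm_mul, norm_turn, ρcone, norm_smul, norm_turn,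
          Real.norm_of_nonneg r.2.1]
        norm_num
        linarith)
      refine hsurj none p ?_
      have ht : turn (1 / 10) * turn (-(1 / 10)) = 1 := by
        rw [← turn_add, add_neg_cancel]
        simp [turn]
      rw [F0, hp, mul_smul_comm, ← mul_assoc, ht, one_mul, smul_smul]
      norm_num
    · rcases le_total (s : ℝ) (1 / 2) with hs | hs
      · obtain ⟨p, hp⟩ := hHs (2 * s) (4 * r - 3) (by linarith) (by linarith) (by linarith)
          (by linarith)
        refine hsurj (some i) p ?_
        rw [F1, hp, ρcone]
        congr 2
        · dsimp only
          ring
        · dsimp only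
          ring
      · obtain ⟨p, hp⟩ := hHs (2 * s - 2) (4 * r - 3) (by linarith) (by linarith) (by linarith)
          (by linarith)
        refine hsurj (some (i + 1)) p ?_
        rw [F1, hp, ρcone, turn_val_add_one]
        congr 2
        · dsimp only
          ring
        · dsimp only
          ring
  · apply ρi
    rw [hf, hρ, F1, hH, squareSide_zero, h]
    norm_num
  · apply ρi
    rw [hf, hρ, F1, hH, squareSide_four, h, turn_val_add_one]
    dsimp only
    rw [show ((3 : ℝ) + 1) / 4 = 1 by norm_num, one_smul]
    congr 1
    ring
  · have h : F c p = F c' p' := by rw [← hf, ← hf, h]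
    rcases c with _ | i <;> rcases c' with _ | j
    · rw [F0, F0] at h
      have h4 := smul_right_injective ℂ (show (1 / 2 : ℝ) ≠ 0 by norm_num) h
      have ht : turn (1 / 10) ≠ 0 := norm_ne_zero_iff.1 (by simp)
      exact Or.inl ⟨rfl, ρi (mul_left_cancel₀ ht h4)⟩
    · obtain ⟨i, s, h1, h2, h3⟩ := hcentral j p p' h
      exact Or.inr (Or.inl ⟨i, s, rfl, h1, congrArg _ h2, h3⟩)
    · obtain ⟨i, s, h1, h2, h3⟩ := hcentral i p' p h.symm
      exact Or.inr (Or.inr (Or.inl ⟨i, s, rfl, h1, congrArg _ h2, h3⟩))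
    · have hb1 := (hb p).1
      have hb2 := (hb p').1
      have h' := h
      rw [F1, F1, smul_turn_eq (by linarith [(hb p).2.1]) (by linarith [(hb p').2.1])] at h'
      obtain ⟨hv, h' | ⟨n, hn⟩⟩ := h'
      · exfalso
        linarith [(hb p).2.1]
      have hv : (H p).2 = (H p').2 := by linarith
      have hm : (((H p).1 + 1) / 2) - (((H p').1 + 1) / 2) = ((j.val - i.val + 5 * n : ℤ) : ℝ) := by
        push_cast
        linarith
      have h2 : ((j.val - i.val + 5 * n : ℤ) : ZMod 5) = j - i := by
        push_cast
        rw [ZMod.natCast_zmod_val, ZMod.natCast_zmod_val, show (5 : ZMod 5) = 0 from rfl]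
        ring
      rcases int_of_sub_mem (s := ⟨((H p).1 + 1) / 2, by linarith, by linarith⟩)
        (s' := ⟨((H p').1 + 1) / 2, by linarith, by linarith⟩) hm with
        ⟨h3, h4⟩ | ⟨h3, h4, h5⟩ | ⟨h3, h4, h5⟩ <;> rw [h3] at h2
      · have h4 := congrArg Subtype.val h4
        refine Or.inl ⟨congrArg _ (sub_eq_zero.1 h2.symm).symm, Hi (Prod.ext ?_ hv)⟩
        dsimp only at h4
        linarith
      · have h4 : ((H p).1 + 1) / 2 = 1 := congrArg Subtype.val h4
        have h5 : ((H p').1 + 1) / 2 = 0 := congrArg Subtype.val h5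
        have h6 : i + 1 = j := by
          rw [sub_eq_iff_eq_add'.1 h2.symm]
          simp
        obtain ⟨s, h7, h8⟩ := hspoke i j p p' h (by linarith) (by linarith) hv h6
        exact Or.inr (Or.inr (Or.inr (Or.inl ⟨i, s, rfl, h7, congrArg _ h6.symm, h8⟩)))
      · have h4 : ((H p).1 + 1) / 2 = 0 := congrArg Subtype.val h4
        have h5 : ((H p').1 + 1) / 2 = 1 := congrArg Subtype.val h5
        have h6 : j + 1 = i := by
          rw [sub_eq_iff_eq_add'.1 h2.symm]
          simp
        obtain ⟨s, h7, h8⟩ := hspoke j i p' p h.symm (by linarith) (by linarith) hv.symm h6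
        exact Or.inr (Or.inr (Or.inr (Or.inr ⟨j, s, rfl, h7, congrArg _ h6.symm, h8⟩)))

end Pentagon

/-! ### Polar coordinates at a corner -/

namespace Pentagon

/-- Polar coordinates of the pentagon at its corner `2`. -/
structure Sector where
  map : I → I → pentagon
  continuous_map : Continuous fun x : I × I => map x.1 x.2
  surjective : ∀ p, ∃ w r, map w r = p
  eq_iff : ∀ {w r w' r'}, map w r = map w' r' ↔ r = r' ∧ (r = 0 ∨ w = w')
  one : ∀ s, map 1 s = sidePt 2 s
  zero : ∀ s, map 0 s = sidePt 1 (unitInterval.symm s)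
  far : ∀ w, ∃ j s, (j = 0 ∨ j = 3 ∨ j = 4) ∧ map w 1 = sidePt j s
  exists_far : ∀ j s, (j = 0 ∨ j = 3 ∨ j = 4) → ∃ w, map w 1 = sidePt j s

/-- In the square, corner 2 is the point (1, -1), and the sides 2 and 1 are the bottom and right
edges there. The radius is half of the larger coordinate displacement from this point, and `w`
measures the direction; dividing by the maximum of `w` and `1 - w` makes r = 1 exactly the two
opposite edges. -/
theorem nonempty_sector : Nonempty Sector := by
  obtain ⟨H, Hc, Hi, Hr, Hcone⟩ := exists_square
  have hH : ∀ i s, H (sidePt i s) = squareSide i s := fun i s => by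
    rw [← cone_one, Hcone, Set.Icc.coe_one, one_smul]
  have hb : ∀ p, (|(H p).1| ≤ 1) ∧ |(H p).2| ≤ 1 := by
    intro p
    have : H p ∈ Metric.closedBall 0 1 := Hr ▸ ⟨p, rfl⟩
    rw [mem_closedBall_zero_iff, Prod.norm_def] at this
    exact ⟨(le_max_left _ _).trans this, (le_max_right _ _).trans this⟩
  simp only [abs_le] at hb
  have hHs : ∀ x y : ℝ, -1 ≤ x → x ≤ 1 → -1 ≤ y → y ≤ 1 → ∃ p, H p = (x, y) := by
    intro x y h1 h2 h3 h4
    have : (x, y) ∈ Metric.closedBall (0 : ℝ × ℝ) 1 := by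
      rw [mem_closedBall_zero_iff, Prod.norm_def]
      exact max_le (abs_le.2 ⟨h1, h2⟩) (abs_le.2 ⟨h3, h4⟩)
    rwa [← Hr] at this
  have hM : ∀ w : I, 0 < max (w : ℝ) (1 - w) := fun w => by
    rcases le_total (w : ℝ) (1 / 2) with h | h
    · exact lt_max_of_lt_right (by linarith)
    · exact lt_max_of_lt_left (by linarith)
  have hx : ∀ w r : I, 0 ≤ (r : ℝ) * (w / max (w : ℝ) (1 - w)) ∧
      (r : ℝ) * (w / max (w : ℝ) (1 - w)) ≤ r := fun w r =>
    ⟨mul_nonneg r.2.1 (div_nonneg w.2.1 (hM w).le),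
      mul_le_of_le_one_right r.2.1 ((div_le_one (hM w)).2 (le_max_left _ _))⟩
  have hy : ∀ w r : I, 0 ≤ (r : ℝ) * ((1 - w) / max (w : ℝ) (1 - w)) ∧
      (r : ℝ) * ((1 - w) / max (w : ℝ) (1 - w)) ≤ r := fun w r =>
    ⟨mul_nonneg r.2.1 (div_nonneg (by linarith [w.2.2]) (hM w).le),
      mul_le_of_le_one_right r.2.1 ((div_le_one (hM w)).2 (le_max_right _ _))⟩
  have hxy : ∀ w r : I, (r : ℝ) * (w / max (w : ℝ) (1 - w)) = r ∨
      (r : ℝ) * ((1 - w) / max (w : ℝ) (1 - w)) = r := fun w r => by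
    rcases max_choice (w : ℝ) (1 - w) with h | h <;> have := hM w <;> rw [h] at this ⊢
    · exact Or.inl (by rw [div_self this.ne', mul_one])
    · exact Or.inr (by rw [div_self this.ne', mul_one])
  choose f hf using fun w r : I => hHs (1 - 2 * (r * (w / max (w : ℝ) (1 - w))))
    (2 * (r * ((1 - w) / max (w : ℝ) (1 - w))) - 1) (by linarith [(hx w r).2, r.2.2])
    (by linarith [hx w r]) (by linarith [hy w r]) (by linarith [(hy w r).2, r.2.2])
  have surj : ∀ p, ∃ w r, f w r = p := by
    intro p
    obtain ⟨⟨x, hx0⟩, hx2⟩ : ∃ x : I, (H p).1 = 1 - 2 * x :=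
      ⟨⟨(1 - (H p).1) / 2, by linarith [(hb p).1.2], by linarith [(hb p).1.1]⟩, by dsimp only; ring⟩
    obtain ⟨⟨y, hy0⟩, hy2⟩ : ∃ y : I, (H p).2 = 2 * y - 1 :=
      ⟨⟨(1 + (H p).2) / 2, by linarith [(hb p).2.1], by linarith [(hb p).2.2]⟩, by dsimp only; ring⟩
    dsimp only at hx2 hy2
    rcases (add_nonneg hx0.1 hy0.1).eq_or_lt with h0 | h0
    · have h1 : x = 0 := by linarith [hx0.1, hy0.1]
      have h2 : y = 0 := by linarith [hx0.1, hy0.1]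
      refine ⟨0, 0, Hi ?_⟩
      rw [hf]
      refine Prod.ext ?_ ?_
      · simp [hx2, h1]
      · simp [hy2, h2]
    · have e1 : 1 - x / (x + y) = y / (x + y) := by
        rw [eq_div_iff h0.ne', sub_mul, div_mul_cancel₀ _ h0.ne']
        ring
      have e2 : max (x / (x + y)) (y / (x + y)) = max x y / (x + y) :=
        (max_div_div_right h0.le x y)
      have hpos : 0 < max x y := by
        by_contra h
        linarith [le_max_left x y, le_max_right x y]
      refine ⟨⟨x / (x + y), div_nonneg hx0.1 h0.le, (div_le_one h0).2 (by linarith [hy0.1])⟩,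
        ⟨max x y, hpos.le, max_le hx0.2 hy0.2⟩, Hi ?_⟩
      rw [hf]
      dsimp only
      rw [e1, e2, div_div_div_cancel_right₀ h0.ne', div_div_div_cancel_right₀ h0.ne',
        mul_div_cancel₀ _ hpos.ne', mul_div_cancel₀ _ hpos.ne']
      exact Prod.ext hx2.symm hy2.symm
  have heq : ∀ {w r w' r'}, f w r = f w' r' ↔ r = r' ∧ (r = 0 ∨ w = w') := by
    intro w r w' r'
    constructor
    · intro h
      have h1 := congrArg H h
      rw [hf, hf, Prod.mk.injEq] at h1
      obtain ⟨h1, h2⟩ := h1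
      have h1 : (r : ℝ) * (w / max (w : ℝ) (1 - w)) = r' * (w' / max (w' : ℝ) (1 - w')) := by linarith
      have h2 : (r : ℝ) * ((1 - w) / max (w : ℝ) (1 - w)) =
        r' * ((1 - w') / max (w' : ℝ) (1 - w')) := by linarith
      have hr : r = r' := by
        refine Subtype.ext (le_antisymm ?_ ?_)
        · rcases hxy w r with e | e
          · rw [← e, h1]; exact (hx w' r').2
          · rw [← e, h2]; exact (hy w' r').2
        · rcases hxy w' r' with e | e
          · rw [← e, ← h1]; exact (hx w r).2
          · rw [← e, ← h2]; exact (hy w r).2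
      subst hr
      refine ⟨rfl, or_iff_not_imp_left.2 fun h0 => ?_⟩
      have h0 : (r : ℝ) ≠ 0 := fun h => h0 (Subtype.ext h)
      have h1 := mul_left_cancel₀ h0 h1
      have h2 := mul_left_cancel₀ h0 h2
      have h3 : 1 / max (w : ℝ) (1 - w) = 1 / max (w' : ℝ) (1 - w') := by
        have : ∀ w : I, 1 / max (w : ℝ) (1 - w) =
            w / max (w : ℝ) (1 - w) + (1 - w) / max (w : ℝ) (1 - w) := fun w => by
          rw [← add_div, add_sub_cancel]
        rw [this w, this w', h1, h2]
      have h4 : max (w : ℝ) (1 - w) = max (w' : ℝ) (1 - w') := by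
        simpa using h3
      rw [h4] at h1
      exact Subtype.ext ((div_left_inj' (hM w').ne').1 h1)
    · rintro ⟨rfl, rfl | rfl⟩
      · apply Hi
        rw [hf, hf]
        simp
      · rfl
  refine ⟨⟨f, ?_, surj, heq, fun s => Hi ?_, fun s => Hi ?_, fun w => ?_, fun j s hj => ?_⟩⟩
  · rw [(Hc.isClosedEmbedding Hi).isInducing.continuous_iff]
    have : (H ∘ fun x : I × I => f x.1 x.2) = fun x : I × I =>
      (1 - 2 * (x.2 * (x.1 / max (x.1 : ℝ) (1 - x.1))),
        2 * ((x.2 : ℝ) * ((1 - x.1) / max (x.1 : ℝ) (1 - x.1))) - 1) := funext fun x => hf x.1 x.2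
    rw [this]
    have hd : Continuous fun x : I × I => max (x.1 : ℝ) (1 - x.1) := by fun_prop
    have h1 : Continuous fun x : I × I => (x.1 : ℝ) / max (x.1 : ℝ) (1 - x.1) :=
      Continuous.div (by fun_prop) hd fun x => (hM x.1).ne'
    have h2 : Continuous fun x : I × I => (1 - (x.1 : ℝ)) / max (x.1 : ℝ) (1 - x.1) :=
      Continuous.div (by fun_prop) hd fun x => (hM x.1).ne'
    have h3 : Continuous fun x : I × I => (x.2 : ℝ) := by fun_prop
    exact (continuous_const.sub (continuous_const.mul (h3.mul h1))).prodMk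
      ((continuous_const.mul (h3.mul h2)).sub continuous_const)
  · rw [hf, hH, squareSide_two]
    norm_num
  · rw [hf, hH, squareSide_one, unitInterval.coe_symm_eq]
    refine Prod.ext ?_ ?_
    · norm_num
    · norm_num
      ring
  · have a := (hx w 1)
    have b := (hy w 1)
    have c := hf w 1
    rw [Set.Icc.coe_one] at a b c
    rcases hxy w 1 with h | h <;> rw [Set.Icc.coe_one] at h
    · refine ⟨3, ⟨_, b⟩, by simp, Hi ?_⟩
      rw [c, hH, squareSide_three, h]
      refine Prod.ext (by norm_num) ?_
      dsimp only
      ring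
    · rcases le_total (1 * ((w : ℝ) / max (w : ℝ) (1 - w))) (1 / 2) with h' | h'
      · refine ⟨0, ⟨1 - 2 * (1 * (w / max (w : ℝ) (1 - w))), by linarith, by linarith⟩, by simp, Hi ?_⟩
        rw [c, hH, squareSide_zero, h]
        refine Prod.ext ?_ ?_ <;> dsimp only <;> ring
      · refine ⟨4, ⟨2 - 2 * (1 * (w / max (w : ℝ) (1 - w))), by linarith, by linarith⟩, by simp, Hi ?_⟩
        rw [c, hH, squareSide_four, h]
        refine Prod.ext ?_ ?_ <;> dsimp only <;> ring
  · obtain ⟨w, r, h⟩ := surj (sidePt j s)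
    refine ⟨w, ?_⟩
    have h1 := hf w r
    rw [h, hH] at h1
    have hr : (r : ℝ) = 1 := by
      refine le_antisymm r.2.2 ?_
      rcases hj with rfl | rfl | rfl
      · rw [squareSide_zero, Prod.mk.injEq] at h1
        linarith [(hy w r).2, h1.2]
      · rw [squareSide_three, Prod.mk.injEq] at h1
        linarith [(hx w r).2, h1.1]
      · rw [squareSide_four, Prod.mk.injEq] at h1
        linarith [(hy w r).2, h1.2]
    rw [← h, show r = 1 from Subtype.ext hr]

end Pentagon

namespace PentComplex
open Pentagon Topology

variable {X : PentComplex}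

/-! ### The realization of the subdivision -/

theorem subdivide_pt_eq (R : Refinement) (t : X.Tile) {c c' : Option (ZMod 5)} {p p' : pentagon}
    (h : R.map c p = R.map c' p') : X.subdivide.pt (t, c) p = X.subdivide.pt (t, c') p' := by
  rcases R.fibre h with ⟨rfl, rfl⟩ | ⟨i, s, rfl, rfl, rfl, rfl⟩ | ⟨i, s, rfl, rfl, rfl, rfl⟩ |
    ⟨i, s, rfl, rfl, rfl, rfl⟩ | ⟨i, s, rfl, rfl, rfl, rfl⟩
  · rfl
  · exact pt_eq_of_glued (L := X.subdivide) (SubGlued.central t i) s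
  · exact (pt_eq_of_glued (L := X.subdivide) (SubGlued.central t i) s).symm
  · exact pt_eq_of_glued (L := X.subdivide) (SubGlued.spoke t i) s
  · exact (pt_eq_of_glued (L := X.subdivide) (SubGlued.spoke t i) s).symm

/-- The subdivision does not change the space. -/
theorem exists_subdivide_homeomorph (R : Refinement) (X : PentComplex) :
    ∃ Φ : X.subdivide.Realization ≃ₜ X.Realization,
      ∀ t c p, Φ (X.subdivide.pt (t, c) p) = X.pt t (R.map c p) := by
  let F : X.subdivide.Realization → X.Realization :=
    Quot.lift (fun x => X.pt x.1.1 (R.map x.1.2 x.2)) (by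
      rintro _ _ ⟨a, i, b, j, s, h⟩
      dsimp only
      cases h with
      | central t i => rw [R.central]
      | spoke t i => rw [R.spoke]
      | firstHalf t i t' j h =>
        rw [R.firstHalf i s ⟨s / 2, by linarith [s.2.1], by linarith [s.2.2]⟩ rfl,
          R.secondHalf j (unitInterval.symm s)
            (unitInterval.symm ⟨s / 2, by linarith [s.2.1], by linarith [s.2.2]⟩)
            (by rw [unitInterval.coe_symm_eq, unitInterval.coe_symm_eq]; dsimp only; ring)]
        exact pt_eq_of_glued h _
      | secondHalf t i t' j h =>
        rw [R.secondHalf i s ⟨(1 + s) / 2, by linarith [s.2.1], by linarith [s.2.2]⟩ rfl,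
          R.firstHalf j (unitInterval.symm s)
            (unitInterval.symm ⟨(1 + s) / 2, by linarith [s.2.1], by linarith [s.2.2]⟩)
            (by rw [unitInterval.coe_symm_eq, unitInterval.coe_symm_eq]; dsimp only; ring)]
        exact pt_eq_of_glued h _)
  have hF : ∀ t c p, F (X.subdivide.pt (t, c) p) = X.pt t (R.map c p) := fun t c p => rfl
  -- The inverse map uses an arbitrary preimage under the refinement; by `subdivide_pt_eq` the
  -- resulting point does not depend on the choice.
  choose c p hcp using R.surjective
  have hsec : ∀ t c' p', X.subdivide.pt (t, c (R.map c' p')) (p (R.map c' p')) =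
      X.subdivide.pt (t, c') p' := fun t c' p' => subdivide_pt_eq R t (hcp _)
  let G : X.Realization → X.subdivide.Realization :=
    Quot.lift (fun x => X.subdivide.pt (x.1, c x.2) (p x.2)) (by
      rintro _ _ ⟨t, i, t', j, s, h⟩
      dsimp only
      rcases le_total (s : ℝ) (1 / 2) with hs | hs
      · have s0 := s.2.1
        rw [← R.firstHalf i ⟨2 * s, by linarith, by linarith⟩ s (by dsimp only; ring),
          ← R.secondHalf j (unitInterval.symm ⟨2 * s, by linarith, by linarith⟩)
            (unitInterval.symm s)
            (by rw [unitInterval.coe_symm_eq, unitInterval.coe_symm_eq]; dsimp only; ring),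
          hsec, hsec]
        exact pt_eq_of_glued (L := X.subdivide) (SubGlued.firstHalf t i t' j h) _
      · have s0 := s.2.2
        rw [← R.secondHalf i ⟨2 * s - 1, by linarith, by linarith⟩ s (by dsimp only; ring),
          ← R.firstHalf j (unitInterval.symm ⟨2 * s - 1, by linarith, by linarith⟩)
            (unitInterval.symm s)
            (by rw [unitInterval.coe_symm_eq, unitInterval.coe_symm_eq]; dsimp only; ring),
          hsec, hsec]
        exact pt_eq_of_glued (L := X.subdivide) (SubGlued.secondHalf t i t' j h) _)
  have hG : ∀ t c p, G (X.pt t (R.map c p)) = X.subdivide.pt (t, c) p := hsec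
  have Fc : Continuous F := continuous_of_pt fun a =>
    (continuous_pt a.1).comp (R.continuous_map a.2)
  have Gc : Continuous G := by
    refine continuous_of_pt fun t => ?_
    let q : (Σ _ : Option (ZMod 5), pentagon) → pentagon := fun x => R.map x.1 x.2
    have qc : Continuous q := continuous_sigma fun c => R.continuous_map c
    have qs : Function.Surjective q := fun y => by
      obtain ⟨c, p, h⟩ := R.surjective y
      exact ⟨⟨c, p⟩, h⟩
    rw [(qc.isClosedMap.isQuotientMap qc qs).continuous_iff]
    refine continuous_sigma fun c => ?_
    exact (continuous_pt (L := X.subdivide) (t, c)).congr fun p => (hG t c p).symm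
  refine ⟨⟨⟨F, G, fun x => ?_, fun x => ?_⟩, Fc, Gc⟩, hF⟩
  · obtain ⟨⟨t, c⟩, p, rfl⟩ := x.exists_pt
    rw [hF, hG]
  · obtain ⟨t, q, rfl⟩ := x.exists_pt
    obtain ⟨c, p, rfl⟩ := R.surjective q
    rw [hG, hF]

/-- Complexes with the same pattern have homeomorphic realizations. -/
theorem exists_homeomorph_of_equiv {Y : PentComplex} (e : X.Tile ≃ Y.Tile)
    (h : ∀ t i t' j, X.Glued t i t' j → Y.Glued (e t) i (e t') j)
    (h' : ∀ t i t' j, Y.Glued t i t' j → X.Glued (e.symm t) i (e.symm t') j) :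
    ∃ Φ : X.Realization ≃ₜ Y.Realization, ∀ t p, Φ (X.pt t p) = Y.pt (e t) p := by
  let F : X.Realization → Y.Realization := Quot.lift (fun x => Y.pt (e x.1) x.2) (by
    rintro _ _ ⟨t, i, t', j, s, hg⟩
    exact pt_eq_of_glued (h _ _ _ _ hg) s)
  let G : Y.Realization → X.Realization := Quot.lift (fun x => X.pt (e.symm x.1) x.2) (by
    rintro _ _ ⟨t, i, t', j, s, hg⟩
    exact pt_eq_of_glued (h' _ _ _ _ hg) s)
  have hF : ∀ t p, F (X.pt t p) = Y.pt (e t) p := fun _ _ => rfl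
  have hG : ∀ t p, G (Y.pt t p) = X.pt (e.symm t) p := fun _ _ => rfl
  refine ⟨⟨⟨F, G, fun x => ?_, fun x => ?_⟩, continuous_of_pt fun t => continuous_pt (e t),
    continuous_of_pt fun t => continuous_pt (e.symm t)⟩, hF⟩
  · obtain ⟨t, p, rfl⟩ := x.exists_pt
    rw [hF, hG, Equiv.symm_apply_apply]
  · obtain ⟨t, p, rfl⟩ := x.exists_pt
    rw [hG, hF, Equiv.apply_symm_apply]

/-- The self-similarity of `K`. -/
theorem exists_tilingK_homeomorph : ∃ Φ : tilingK.Realization ≃ₜ tilingK.Realization,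
    (∀ t p, ∃ q, Φ (tilingK.pt t p) = tilingK.pt (parent t) q) ∧
    ∀ u q, ∃ t p, parent t = u ∧ Φ (tilingK.pt t p) = tilingK.pt u q := by
  obtain ⟨R⟩ := nonempty_refinement
  obtain ⟨Φ, hΦ⟩ := exists_subdivide_homeomorph R tilingK
  obtain ⟨Ψ, hΨ⟩ := exists_homeomorph_of_equiv (X := tilingK) (Y := tilingK.subdivide) descendEquiv
    (fun t i t' j h => glued_descend h) (fun t i t' j h => glued_ascend h)
  refine ⟨Ψ.trans Φ, fun t p => ⟨R.map (descend t).2 p, ?_⟩, fun u q => ?_⟩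
  · rw [Homeomorph.trans_apply, hΨ]
    exact hΦ _ _ _
  · obtain ⟨c, p, h⟩ := R.surjective q
    have e : descendEquiv (descendEquiv.symm (u, c)) = (u, c) := Equiv.apply_symm_apply _ _
    refine ⟨descendEquiv.symm (u, c), p, congrArg Prod.fst e, ?_⟩
    have e' : Ψ (tilingK.pt (descendEquiv.symm (u, c)) p) = tilingK.subdivide.pt (u, c) p :=
      (hΨ _ _).trans (congrArg (fun a => tilingK.subdivide.pt a p) e)
    rw [Homeomorph.trans_apply, e', hΦ, h]

/-! ### Separation -/

/-- Besides the point itself there is at most one partner across each of the five sides, and there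
are the finitely many corners at a vertex. -/
theorem EdgeRegular.finite_fibre (hE : X.EdgeRegular)
    (hV : ∀ v, {a : X.Tile × ZMod 5 | X.vert a.1 a.2 = v}.Finite) (y : X.Realization) :
    {x : X.Tile × pentagon | X.pt x.1 x.2 = y}.Finite := by
  obtain ⟨t, p, rfl⟩ := y.exists_pt
  have h1 : ∀ i, {x : X.Tile × pentagon | ∃ j s, X.Adj t i x.1 j ∧ p = sidePt i s ∧
      x.2 = sidePt j (unitInterval.symm s)}.Finite := by
    intro i
    refine Set.Subsingleton.finite ?_
    rintro ⟨t₁, p₁⟩ ⟨j₁, s₁, a₁, b₁, c₁⟩ ⟨t₂, p₂⟩ ⟨j₂, s₂, a₂, b₂, c₂⟩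
    obtain ⟨h1, rfl⟩ := hE a₁ a₂
    obtain rfl := sidePt_injective i (b₁.symm.trans b₂)
    exact Prod.ext h1 (c₁.trans c₂.symm)
  have h2 : ∀ i, ((fun a : X.Tile × ZMod 5 => (a.1, cornerPt a.2)) ''
      {a : X.Tile × ZMod 5 | X.vert a.1 a.2 = X.vert t i}).Finite := fun i => (hV _).image _
  refine (((Set.finite_singleton (t, p)).union (Set.finite_iUnion h1)).union
    (Set.finite_iUnion h2)).subset ?_
  rintro ⟨t', p'⟩ h
  rcases hE.pt_eq_iff.1 (Eq.symm h) with ⟨rfl, rfl⟩ | ⟨i, j, s, h, -, -, h3, h4⟩ | ⟨i, j, h3, h4, h5⟩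
  · exact Or.inl (Or.inl rfl)
  · exact Or.inl (Or.inr (Set.mem_iUnion.2 ⟨i, j, s, h, h3, h4⟩))
  · exact Or.inr (Set.mem_iUnion.2 ⟨i, (t', j), h5.symm, Prod.ext rfl h4.symm⟩)

/-- The function of `exists_separating` is continuous and vanishes at one point only. -/
theorem EdgeRegular.t2Space (hE : X.EdgeRegular)
    (hV : ∀ v, {a : X.Tile × ZMod 5 | X.vert a.1 a.2 = v}.Finite)
    (hinj : ∀ t, Function.Injective (X.pt t)) : T2Space X.Realization := by
  refine ⟨fun x y hxy => ?_⟩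
  obtain ⟨f, hf, h0, h1⟩ := exists_separating hinj x (hE.finite_fibre hV x)
  have hy : f x ≠ f y := fun h => hxy (h1 y (h.symm.trans h0)).symm
  obtain ⟨U, V, hU, hV, hxU, hyV, hd⟩ := t2_separation hy
  exact ⟨f ⁻¹' U, f ⁻¹' V, hU.preimage hf.continuous, hV.preimage hf.continuous, hxU, hyV,
    hd.preimage f⟩

theorem finite_corners_of_card_le {v : X.Vertex} {n : ℕ} (h : ∀ s : Finset (X.Tile × ZMod 5),
    (∀ a ∈ s, X.vert a.1 a.2 = v) → s.card ≤ n) :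
    {a : X.Tile × ZMod 5 | X.vert a.1 a.2 = v}.Finite := by
  by_contra hinf
  obtain ⟨s, hs, hc⟩ := Set.Infinite.exists_subset_card_eq hinf (n + 1)
  have := h s fun a ha => hs ha
  omega

theorem Regular.finite_corners (hX : X.Regular) (v : X.Vertex) :
    {a : X.Tile × ZMod 5 | X.vert a.1 a.2 = v}.Finite :=
  finite_corners_of_card_le (hX.deg v)

theorem Regular.pt_injective (hX : X.Regular) (t : X.Tile) : Function.Injective (X.pt t) := by
  intro p p' h
  rcases hX.edge.pt_eq_iff.1 h with ⟨-, h⟩ | ⟨i, j, s, h, -⟩ | ⟨i, j, rfl, rfl, hv⟩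
  · exact h
  · exact absurd h (hX.not_adj_self _ _ _)
  · rw [hX.vert_inj hv]

theorem Regular.t2Space (hX : X.Regular) : T2Space X.Realization :=
  hX.edge.t2Space hX.finite_corners hX.pt_injective

end PentComplex

namespace PentComplex
open Pentagon Topology

variable {X : PentComplex}

/-! ### The star of a vertex -/

/-- Polar coordinates at a corner of a tile. -/
def sectorPt (S : Sector) (a : X.Tile × ZMod 5) (w r : I) : X.Realization :=
  X.pt a.1 (rot (a.2 - 2) (S.map w r))

/-- The open star of a vertex. -/
def openStar (S : Sector) (v : X.Vertex) : Set X.Realization :=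
  {x | ∃ a w r, X.vert a.1 a.2 = v ∧ r < 1 ∧ x = sectorPt S a w r}

theorem exists_sectorPt (S : Sector) (i : ZMod 5) (p : pentagon) :
    ∃ w r, p = rot (i - 2) (S.map w r) := by
  obtain ⟨w, r, h⟩ := S.surjective (rot (-(i - 2)) p)
  exact ⟨w, r, by rw [h, rot_rot, neg_add_cancel, rot_zero]⟩

/-- The rotation around the vertices. -/
def IsTurn (X : PentComplex) (τ : X.Tile × ZMod 5 → X.Tile × ZMod 5) : Prop :=
  ∀ ⦃t i t' j⦄, X.Adj t i t' j → τ (t, i) = (t', j + 1)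

theorem Regular.exists_isTurn (hX : X.Regular) (hC : X.Complete) : ∃ τ, X.IsTurn τ := by
  choose n j h using hC
  refine ⟨fun a => (n a.1 a.2, j a.1 a.2 + 1), fun t i t' j' h' => ?_⟩
  obtain ⟨h1, h2⟩ := hX.edge (h t i) h'
  exact Prod.ext h1 (congrArg (· + 1) h2)

namespace IsTurn

variable {τ : X.Tile × ZMod 5 → X.Tile × ZMod 5}

theorem exists_eq (hτ : X.IsTurn τ) (hC : X.Complete) (a : X.Tile × ZMod 5) :
    ∃ t' j, X.Adj a.1 a.2 t' j ∧ τ a = (t', j + 1) := by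
  obtain ⟨t', j, h⟩ := hC a.1 a.2
  exact ⟨t', j, h, hτ h⟩

/-- The last ray of a sector runs along side `i` of the tile; across this side the next sector
begins with its first ray. -/
theorem sectorPt_one (hτ : X.IsTurn τ) (hC : X.Complete) (S : Sector) (a : X.Tile × ZMod 5)
    (s : I) : sectorPt S a 1 s = sectorPt S (τ a) 0 s := by
  obtain ⟨t', j, h, e⟩ := hτ.exists_eq hC a
  rw [e, sectorPt, sectorPt, S.one, S.zero, rot_sidePt, rot_sidePt, add_sub_cancel,
    show 1 + (j + 1 - 2) = j by ring, h.pt_eq s]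

theorem vert_eq (hτ : X.IsTurn τ) (hC : X.Complete) (a : X.Tile × ZMod 5) :
    X.vert (τ a).1 (τ a).2 = X.vert a.1 a.2 := by
  obtain ⟨t', j, h, e⟩ := hτ.exists_eq hC a
  rw [e, h.vert_left]

theorem injective (hτ : X.IsTurn τ) (hE : X.EdgeRegular) (hC : X.Complete) :
    Function.Injective τ := by
  rintro ⟨t, i⟩ ⟨u, k⟩ he
  obtain ⟨t', j, h, e⟩ := hτ.exists_eq hC (t, i)
  obtain ⟨u', l, h', e'⟩ := hτ.exists_eq hC (u, k)
  rw [e, e', Prod.mk.injEq, add_left_inj] at he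
  obtain ⟨rfl, rfl⟩ := he
  obtain ⟨h1, h2⟩ := hE h.symm h'.symm
  exact Prod.ext h1 h2

theorem iterate_vert (hτ : X.IsTurn τ) (hC : X.Complete) (a : X.Tile × ZMod 5) (n : ℕ) :
    X.vert (τ^[n] a).1 (τ^[n] a).2 = X.vert a.1 a.2 := by
  induction n with
  | zero => rfl
  | succ n ih => rw [Function.iterate_succ_apply', hτ.vert_eq hC, ih]

/-- The turn is injective and stays among the finitely many corners of one vertex, so its orbits
close up. -/
theorem mem_periodicPts (hτ : X.IsTurn τ) (hX : X.Regular) (hC : X.Complete)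
    (a : X.Tile × ZMod 5) : a ∈ Function.periodicPts τ := by
  have hinj := hτ.injective hX.edge hC
  have hfin := hX.finite_corners (X.vert a.1 a.2)
  have hni : ¬ Function.Injective fun n => τ^[n] a := fun h =>
    Set.infinite_of_injective_forall_mem h (fun n => hτ.iterate_vert hC a n) hfin
  rw [Function.not_injective_iff] at hni
  obtain ⟨m, n, h, hmn⟩ := hni
  wlog hlt : m < n generalizing m n
  · exact this n m h.symm hmn.symm (lt_of_le_of_ne (not_lt.1 hlt) hmn.symm)
  refine ⟨n - m, by omega, (hinj.iterate m) ?_⟩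
  rw [← Function.iterate_add_apply, Nat.add_sub_cancel' hlt.le]
  exact h.symm

/-- Every elementary identification of corners is a turn or the inverse of a turn, and by
periodicity the inverse is also an iterate. So the corners at a vertex form a single cycle, as they
must for the star to be a disc. -/
theorem exists_iterate (hτ : X.IsTurn τ) (hX : X.Regular) (hC : X.Complete)
    {a b : X.Tile × ZMod 5} (h : X.vert a.1 a.2 = X.vert b.1 b.2) : ∃ n, τ^[n] a = b := by
  have hsymm : ∀ a b, (∃ n, τ^[n] a = b) → ∃ n, τ^[n] b = a := by
    rintro a _ ⟨n, rfl⟩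
    obtain ⟨m, hm, hp⟩ := hτ.mem_periodicPts hX hC a
    refine ⟨m * n - n, ?_⟩
    rw [← Function.iterate_add_apply, Nat.sub_add_cancel (Nat.le_mul_of_pos_left n hm)]
    exact hp.mul_const n
  replace h : Relation.EqvGen X.CornerRel a b := Quot.eqvGen_exact h
  induction h with
  | rel a b h =>
    cases h with
    | @left t i t' j h => exact ⟨1, hτ (Or.inl h)⟩
    | @right t i t' j h => exact hsymm _ _ ⟨1, hτ (Or.inr h)⟩
  | refl a => exact ⟨0, rfl⟩
  | symm a b _ ih => exact hsymm _ _ ih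
  | trans a b c _ _ ih ih' =>
    obtain ⟨m, rfl⟩ := ih
    obtain ⟨n, rfl⟩ := ih'
    exact ⟨n + m, Function.iterate_add_apply _ _ _ _⟩

/-- The identifications of the points of the open star. -/
theorem sectorPt_eq_pt (hτ : X.IsTurn τ) (hX : X.Regular) (S : Sector) {b : X.Tile × ZMod 5}
    {w r : I} (hr : r < 1) {t : X.Tile} {p : pentagon} (h : sectorPt S b w r = X.pt t p) :
    ∃ i w', X.vert t i = X.vert b.1 b.2 ∧ p = rot (i - 2) (S.map w' r) ∧
      (r = 0 ∨ (b = (t, i) ∧ w = w') ∨ ((t, i) = τ b ∧ w = 1 ∧ w' = 0) ∨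
        (b = τ (t, i) ∧ w = 0 ∧ w' = 1)) := by
  obtain ⟨u, k⟩ := b
  have hlocal : ∀ j s, rot (k - 2) (S.map w r) = sidePt j s →
      S.map w r = sidePt (j - (k - 2)) s := by
    intro j s e
    apply rot_injective (k - 2)
    rw [e, rot_sidePt, sub_add_cancel]
  -- Points of radius less than 1 are not on the far sides, so they can be glued only along the two
  -- sides at the corner.
  have hnear : ∀ l s, S.map w r = sidePt l s → l = 1 ∨ l = 2 := by
    intro l s e
    by_contra hl
    have : l = 0 ∨ l = 3 ∨ l = 4 := by
      rcases zmod_five_cases l with h | h | h | h | h <;> simp_all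
    obtain ⟨w₁, h₁⟩ := S.exists_far l s this
    exact hr.ne (S.eq_iff.1 (e.trans h₁.symm)).1
  rcases hX.edge.pt_eq_iff.1 h with ⟨rfl, e⟩ | ⟨j, j', s, hA, -, -, e, e'⟩ | ⟨j, j', e, e', hv⟩
  · exact ⟨k, w, rfl, e.symm, Or.inr (Or.inl ⟨rfl, rfl⟩)⟩
  · have e1 := hlocal j s e
    rcases hnear _ _ e1 with hl | hl
    · rw [hl, ← unitInterval.symm_symm s, ← S.zero] at e1
      obtain ⟨h1, h2⟩ := S.eq_iff.1 e1
      have hj : j + 1 = k := by linear_combination hl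
      refine ⟨j', 1, ?_, ?_, ?_⟩
      · rw [← hj]
        exact hA.symm.vert_left
      · rw [e', h1, S.one, rot_sidePt, add_sub_cancel]
      · rcases h2 with h2 | h2
        · exact Or.inl h2
        · exact Or.inr (Or.inr (Or.inr ⟨by rw [hτ hA.symm, hj], h2, rfl⟩))
    · rw [hl, ← S.one] at e1
      obtain ⟨h1, h2⟩ := S.eq_iff.1 e1
      have hj : j = k := by linear_combination hl
      subst hj
      refine ⟨j' + 1, 0, hA.vert_left.symm, ?_, ?_⟩
      · rw [e', h1, S.zero, rot_sidePt]
        congr 1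
        ring
      · rcases h2 with h2 | h2
        · exact Or.inl h2
        · exact Or.inr (Or.inr (Or.inl ⟨(hτ hA).symm, h2, rfl⟩))
  · have e1 : rot (k - 2) (S.map w r) = sidePt j 0 := by rw [sidePt_zero]; exact e
    have e2 : rot (k - 2) (S.map w r) = sidePt (j - 1) 1 := by
      rw [sidePt_one, sub_add_cancel]
      exact e
    have e1 := hlocal _ _ e1
    have e2 := hlocal _ _ e2
    have hl : j - (k - 2) = 2 := by
      have h1 := hnear _ _ e1
      have h2 := hnear _ _ e2
      rw [show j - 1 - (k - 2) = j - (k - 2) - 1 by ring] at h2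
      generalize j - (k - 2) = l at h1 h2
      revert l
      decide
    have hj : j = k := by linear_combination hl
    subst hj
    rw [hl, ← S.one] at e1
    have hr0 := (S.eq_iff.1 e1).1
    refine ⟨j', 1, hv.symm, ?_, Or.inl hr0⟩
    rw [hr0, S.one, sidePt_zero, rot_cornerPt, add_sub_cancel]
    exact e'

/-- In one tile the star is the union, over the corners at `v`, of the complements of the far sides,
which are compact. By `sectorPt_eq_pt` the radius of a point of the star is the same in all its
tiles. -/
theorem isOpen_openStar (hτ : X.IsTurn τ) (hX : X.Regular) (S : Sector) (v : X.Vertex) :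
    IsOpen (openStar S v) := by
  refine isOpen_iff.2 fun t => ?_
  have key : X.pt t ⁻¹' openStar S v = ⋃ i ∈ {i | X.vert t i = v},
      (((fun x : I × I => rot (i - 2) (S.map x.1 x.2)) '' (Set.univ ×ˢ {1})))ᶜ := by
    ext p
    simp only [Set.mem_preimage, Set.mem_iUnion, Set.mem_ofPred_eq, Set.mem_compl_iff,
      Set.mem_image, Set.mem_prod, Set.mem_univ, Set.mem_singleton_iff, true_and, Prod.exists,
      not_exists, not_and]
    constructor
    · rintro ⟨b, w, r, rfl, hr, h⟩
      obtain ⟨i, w', hi, rfl, -⟩ := hτ.sectorPt_eq_pt hX S hr h.symm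
      refine ⟨i, hi, fun w₁ r₁ hr₁ e => ?_⟩
      have := (S.eq_iff.1 (rot_injective _ e)).1
      exact hr.ne (this.symm.trans hr₁)
    · rintro ⟨i, hi, h⟩
      obtain ⟨w, r, hp⟩ := exists_sectorPt S i p
      refine ⟨(t, i), w, r, hi, lt_of_le_of_ne unitInterval.le_one' fun e => ?_, congrArg _ hp⟩
      exact h w r e hp.symm
  rw [key]
  refine isOpen_biUnion fun i _ => IsClosed.isOpen_compl (self := ?_)
  refine IsCompact.isClosed ((isCompact_univ.prod isCompact_singleton).image ?_)
  exact (continuous_rot _).comp S.continuous_map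

end IsTurn

/-- A general construction of open embeddings of an open set of a compact quotient. -/
theorem isOpenEmbedding_of_quotient {W D Y : Type*} [TopologicalSpace W] [TopologicalSpace D]
    [TopologicalSpace Y] [CompactSpace W] [T2Space D] [T2Space Y] {Θ : W → D} {g : W → Y}
    (hΘ : Continuous Θ) (hΘs : Function.Surjective Θ) (hg : Continuous g)
    (h : ∀ x y, Θ x = Θ y → g x = g y) {O : Set D}
    (hO : ∀ x y, Θ x ∈ O → g x = g y → Θ x = Θ y)
    (hopen : IsOpen (g '' (Θ ⁻¹' O))) :
    ∃ f : O → Y, IsOpenEmbedding f ∧ Set.range f = g '' (Θ ⁻¹' O) := by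
  have hcl := hΘ.isClosedMap
  choose s hs using hΘs
  let G : D → Y := fun d => g (s d)
  have hG : ∀ x, G (Θ x) = g x := fun x => h _ _ (hs _)
  have Gc : Continuous G := by
    rw [(hcl.isQuotientMap hΘ fun d => ⟨s d, hs d⟩).continuous_iff]
    exact (funext hG : G ∘ Θ = g) ▸ hg
  have hinj : ∀ d d', d ∈ O → G d = G d' → d = d' := by
    intro d d' hd e
    rw [← hs d, ← hs d'] at *
    rw [hG, hG] at e
    exact hO _ _ hd e
  have : CompactSpace D := by
    refine ⟨?_⟩
    have := isCompact_range hΘ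
    rwa [Set.range_eq_univ.2 fun d => ⟨s d, hs d⟩] at this
  have himg : ∀ V ⊆ O, G '' V = g '' (Θ ⁻¹' V) := by
    intro V _
    ext y
    constructor
    · rintro ⟨d, hd, rfl⟩
      exact ⟨s d, by simpa [hs d] using hd, rfl⟩
    · rintro ⟨x, hx, rfl⟩
      exact ⟨Θ x, hx, hG x⟩
  refine ⟨fun d => G d, ?_, ?_⟩
  · refine .of_continuous_injective_isOpenMap (Gc.comp continuous_subtype_val)
      (fun d d' e => Subtype.ext (hinj d d' d.2 e)) fun V hV => ?_
    obtain ⟨V', hV', rfl⟩ := isOpen_induced_iff.1 hV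
    -- By injectivity over `O`, the image of a relatively open set is the open image of `O` without
    -- the compact image of a closed set.
    have e : (fun d : O => G d) '' (Subtype.val ⁻¹' V') = (g '' (Θ ⁻¹' O)) \ (G '' V'ᶜ) := by
      rw [← himg O le_rfl]
      ext y
      constructor
      · rintro ⟨d, hd, rfl⟩
        refine ⟨⟨d, d.2, rfl⟩, ?_⟩
        rintro ⟨d', hd', e⟩
        exact hd' ((hinj d d' d.2 e.symm) ▸ hd)
      · rintro ⟨⟨d, hd, rfl⟩, hn⟩
        exact ⟨⟨d, hd⟩, by_contra fun hd' => hn ⟨d, hd', rfl⟩, rfl⟩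
    rw [e]
    exact hopen.sdiff ((hV'.isClosed_compl.isCompact.image Gc).isClosed)
  · rw [← himg O le_rfl]
    ext y
    constructor
    · rintro ⟨d, rfl⟩
      exact ⟨d, d.2, rfl⟩
    · rintro ⟨d, hd, rfl⟩
      exact ⟨⟨d, hd⟩, rfl⟩

/-- The open star of a vertex is an open cell. -/
theorem Regular.exists_openStar_chart (hX : X.Regular) (hC : X.Complete) (S : Sector)
    (v : X.Vertex) :
    ∃ e : ℂ → X.Realization, IsOpenEmbedding e ∧ Set.range e = openStar S v := by
  have : T2Space X.Realization := hX.t2Space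
  obtain ⟨τ, hτ⟩ := hX.exists_isTurn hC
  obtain ⟨t₀, i₀, rfl⟩ : ∃ t i, v = X.vert t i := v.ind (P := fun v => ∃ t i, v = X.vert t i)
    fun t i => ⟨t, i, rfl⟩
  set a₀ : X.Tile × ZMod 5 := (t₀, i₀)
  set k := Function.minimalPeriod τ a₀ with hk
  have hk0 : 0 < k := Function.minimalPeriod_pos_of_mem_periodicPts (hτ.mem_periodicPts hX hC a₀)
  have hkR : (0 : ℝ) < k := by exact_mod_cast hk0
  let c : ℕ → X.Tile × ZMod 5 := fun n => τ^[n] a₀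
  have hcs : ∀ n, c (n + 1) = τ (c n) := fun n => Function.iterate_succ_apply' _ _ _
  have hceq : ∀ m n, c m = c n ↔ m ≡ n [MOD k] := by
    intro m n
    have hmod : ∀ n, c (n % k) = c n := fun n => Function.iterate_mod_minimalPeriod_eq
    rw [← hmod m, ← hmod n]
    exact Function.iterate_eq_iterate_iff_of_lt_minimalPeriod (Nat.mod_lt _ hk0) (Nat.mod_lt _ hk0)
  have hdvd : ∀ m n : ℕ, c m = c n ↔ (k : ℤ) ∣ n - m := fun m n =>
    (hceq m n).trans Nat.modEq_iff_dvd
  have hcv : ∀ n, X.vert (c n).1 (c n).2 = X.vert t₀ i₀ := fun n => hτ.iterate_vert hC a₀ n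
  -- The `k` sectors at the vertex are laid around the unit disc, the `a`-th over the angles from
  -- a/k to (a + 1)/k of a full turn.
  let Θ : (Σ _ : Fin k, I × I) → Metric.closedBall (0 : ℂ) 1 := fun x =>
    ⟨(x.2.2 : ℝ) • turn ((x.1 + x.2.1) / k), by
      rw [mem_closedBall_zero_iff, norm_smul, norm_turn, mul_one, Real.norm_of_nonneg x.2.2.2.1]
      exact x.2.2.2.2⟩
  let g : (Σ _ : Fin k, I × I) → X.Realization := fun x => sectorPt S (c x.1) x.2.1 x.2.2
  have Θc : Continuous Θ := Continuous.subtype_mk (continuous_sigma fun a => by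
    dsimp only
    fun_prop) _
  have gc : Continuous g := continuous_sigma fun a =>
    (continuous_pt (c a).1).comp ((continuous_rot ((c a).2 - 2)).comp S.continuous_map)
  -- The right side has the form of the identifications in `sectorPt_eq_pt`: over the open disc, `Θ`
  -- and `g` have the same fibres.
  have hΘ : ∀ x y, Θ x = Θ y ↔ x.2.2 = y.2.2 ∧ (x.2.2 = 0 ∨
      (c x.1 = c y.1 ∧ x.2.1 = y.2.1) ∨ (c y.1 = τ (c x.1) ∧ x.2.1 = 1 ∧ y.2.1 = 0) ∨
      (c x.1 = τ (c y.1) ∧ x.2.1 = 0 ∧ y.2.1 = 1)) := by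
    rintro ⟨a, w, r⟩ ⟨b, w', r'⟩
    dsimp only
    rw [Subtype.mk.injEq, smul_turn_eq r.2.1 r'.2.1]
    refine and_congr ⟨Subtype.ext, congrArg _⟩ (or_congr ⟨fun h => Subtype.ext h, fun h => congrArg _ h⟩ ?_)
    rw [← hcs, ← hcs, hdvd, hdvd, hdvd]
    constructor
    · rintro ⟨n, hn⟩
      rw [div_add' _ _ _ hkR.ne', div_left_inj' hkR.ne'] at hn
      have h1 : (w : ℝ) - w' = (((b : ℕ) - (a : ℕ) + k * n : ℤ) : ℝ) := by
        push_cast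
        linarith
      rcases int_of_sub_mem h1 with ⟨h, h'⟩ | ⟨h, h'⟩ | ⟨h, h'⟩
      · exact Or.inl ⟨⟨-n, by linarith⟩, h'⟩
      · exact Or.inr (Or.inl ⟨⟨n, by push_cast; linarith⟩, h'⟩)
      · exact Or.inr (Or.inr ⟨⟨-n, by push_cast; linarith⟩, h'⟩)
    · have aux : ∀ n : ℤ, (w : ℝ) - w' = (((b : ℕ) - (a : ℕ) + k * n : ℤ) : ℝ) →
          ∃ n : ℤ, ((a : ℕ) + (w : ℝ)) / k = ((b : ℕ) + (w' : ℝ)) / k + n := by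
        intro n hn
        refine ⟨n, ?_⟩
        rw [div_add' _ _ _ hkR.ne', div_left_inj' hkR.ne']
        push_cast at hn
        linarith
      rintro (⟨⟨n, hn⟩, rfl⟩ | ⟨⟨n, hn⟩, rfl, rfl⟩ | ⟨⟨n, hn⟩, rfl, rfl⟩)
      · refine aux (-n) ?_
        rw [show (b : ℤ) - (a : ℤ) + k * -n = 0 by linarith]
        simp
      · refine aux n ?_
        push_cast at hn
        rw [show (b : ℤ) - (a : ℤ) + k * n = 1 by linarith]
        simp
      · refine aux (-n) ?_
        push_cast at hn
        rw [show (b : ℤ) - (a : ℤ) + k * -n = -1 by linarith]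
        simp
  have hΘg : ∀ x y, Θ x = Θ y → g x = g y := by
    rintro ⟨a, w, r⟩ ⟨b, w', r'⟩ h
    rw [hΘ] at h
    dsimp only at h
    obtain ⟨rfl, rfl | ⟨h1, rfl⟩ | ⟨h1, rfl, rfl⟩ | ⟨h1, rfl, rfl⟩⟩ := h
    · have : ∀ n w, sectorPt S (c n) w 0 = X.vertexPt (X.vert t₀ i₀) := by
        intro n w
        rw [← hcv n, sectorPt, S.eq_iff.2 ⟨rfl, Or.inl rfl⟩, S.one, sidePt_zero, rot_cornerPt,
          add_sub_cancel]
        rfl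
      exact (this a w).trans (this b w').symm
    · simp only [g, h1]
    · simp only [g, h1]
      exact hτ.sectorPt_one hC S _ _
    · simp only [g, h1]
      exact (hτ.sectorPt_one hC S _ _).symm
  have hgΘ : ∀ x y, Θ x ∈ {z : Metric.closedBall (0 : ℂ) 1 | ‖(z : ℂ)‖ < 1} → g x = g y →
      Θ x = Θ y := by
    rintro ⟨a, w, r⟩ ⟨b, w', r'⟩ hx h
    have hr : r < 1 := by
      simp only [Set.mem_ofPred_eq, Θ, norm_smul, norm_turn, mul_one,
        Real.norm_of_nonneg r.2.1] at hx
      exact hx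
    rw [hΘ]
    obtain ⟨i, w₁, h1, h2, h3⟩ := hτ.sectorPt_eq_pt hX S hr h
    dsimp only at h1 h2 h3
    have h4 : i = (c b).2 := hX.vert_inj (h1.trans ((hcv a).trans (hcv b).symm))
    subst h4
    obtain ⟨h5, h6⟩ := S.eq_iff.1 (rot_injective _ h2)
    dsimp only
    refine ⟨h5.symm, ?_⟩
    rcases h3 with h3 | h3
    · exact Or.inl h3
    · rcases h6 with h6 | rfl
      · exact Or.inl (h5.symm.trans h6)
      · exact Or.inr h3
  have hΘs : Function.Surjective Θ := by
    rintro ⟨z, hz⟩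
    obtain ⟨x, hx0, hx1, hx⟩ := exists_smul_turn z
    have hkx : 0 ≤ k * x := mul_nonneg hkR.le hx0
    have hlt : ⌊k * x⌋₊ < k := by
      rw [Nat.floor_lt hkx]
      exact mul_lt_of_lt_one_right hkR hx1
    have h1 := Nat.floor_le hkx
    have h2 := Nat.lt_floor_add_one (k * x)
    refine ⟨⟨⟨⌊k * x⌋₊, hlt⟩, ⟨k * x - ⌊k * x⌋₊, by linarith, by linarith⟩,
      ⟨‖z‖, norm_nonneg z, by simpa using hz⟩⟩, Subtype.ext ?_⟩
    simp only [Θ]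
    rw [add_sub_cancel, mul_div_cancel_left₀ _ hkR.ne', hx]
  have himg : g '' (Θ ⁻¹' {z | ‖(z : ℂ)‖ < 1}) = openStar S (X.vert t₀ i₀) := by
    ext y
    constructor
    · rintro ⟨⟨a, w, r⟩, hx, rfl⟩
      have hr : r < 1 := by
        simp only [Set.mem_preimage, Set.mem_ofPred_eq, Θ, norm_smul, norm_turn, mul_one,
          Real.norm_of_nonneg r.2.1] at hx
        exact hx
      exact ⟨c a, w, r, hcv a, hr, rfl⟩
    · rintro ⟨b, w, r, hb, hr, rfl⟩
      obtain ⟨n, hn⟩ := hτ.exists_iterate hX hC (a := a₀) hb.symm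
      have hn' : c (n % k) = b := by
        rw [← hn]
        exact (hceq _ _).2 (Nat.mod_modEq _ _)
      refine ⟨⟨⟨n % k, Nat.mod_lt _ hk0⟩, w, r⟩, ?_, by simp only [g, hn']⟩
      simp only [Set.mem_preimage, Set.mem_ofPred_eq, Θ, norm_smul, norm_turn, mul_one,
        Real.norm_of_nonneg r.2.1]
      exact hr
  obtain ⟨f, hf, hfr⟩ := isOpenEmbedding_of_quotient Θc hΘs gc hΘg hgΘ
    (himg ▸ hτ.isOpen_openStar hX S _)
  let B : ℂ ≃ₜ Metric.ball (0 : ℂ) 1 := Homeomorph.unitBall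
  let e : ℂ → {z : Metric.closedBall (0 : ℂ) 1 | ‖(z : ℂ)‖ < 1} := fun z =>
    ⟨⟨B z, Metric.ball_subset_closedBall (B z).2⟩, mem_ball_zero_iff.1 (B z).2⟩
  have hes : Function.Surjective e := by
    rintro ⟨⟨z, hz⟩, hz'⟩
    obtain ⟨y, hy⟩ := B.surjective ⟨z, mem_ball_zero_iff.2 hz'⟩
    refine ⟨y, Subtype.ext (Subtype.ext ?_)⟩
    change (B y : ℂ) = z
    rw [hy]
  have he : IsOpenEmbedding e := by
    have h1 : IsEmbedding fun z => (B z : ℂ) := IsEmbedding.subtypeVal.comp B.isEmbedding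
    let ι : {z : Metric.closedBall (0 : ℂ) 1 | ‖(z : ℂ)‖ < 1} → ℂ := fun z => z.1.1
    have hι : Continuous ι := continuous_subtype_val.comp continuous_subtype_val
    refine ⟨IsEmbedding.of_comp (f := e) (g := ι) ?_ hι h1, ?_⟩
    · exact Continuous.subtype_mk (Continuous.subtype_mk
        (continuous_subtype_val.comp B.continuous) _) _
    · rw [hes.range_eq]
      exact isOpen_univ
  exact ⟨f ∘ e, hf.comp he, by rw [hes.range_comp, hfr, himg]⟩

end PentComplex

namespace PentComplex
open Pentagon Topology

/-! ### Large cells in `K` -/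

theorem touch_central (a : tilingK.Tile) : tilingK.Touch (ascend (parent a, none)) a := by
  have ha : ascend (parent a, (descend a).2) = a := descendEquiv.left_inv a
  rcases h : (descend a).2 with _ | i
  · rw [h] at ha
    rw [ha]
    exact Touch.refl a
  · rw [h] at ha
    have := glued_ascend (SubGlued.central (L := tilingK) (parent a) (i - 1))
    rw [sub_add_cancel, ha] at this
    exact Adj.touch (Or.inl this)

theorem mem_tball_of_parent_eq {a b : tilingK.Tile} (h : parent a = parent b) :
    b ∈ tilingK.tball a 2 := by
  have h1 := (touch_central a).symm.mem_tball
  rw [h] at h1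
  exact tball_add h1 (touch_central b).mem_tball

/-- By the self-similarity, a common point of the parents comes from a common point of a child of
the one and a child of the other. This gives 2 + 1 + 2 steps. -/
theorem mem_tball_of_touch_parent {a b : tilingK.Tile} (h : tilingK.Touch (parent a) (parent b)) :
    b ∈ tilingK.tball a 5 := by
  obtain ⟨Φ, -, hΦ⟩ := exists_tilingK_homeomorph
  obtain ⟨p, q, h⟩ := h
  obtain ⟨a', p', ha, ha'⟩ := hΦ (parent a) p
  obtain ⟨b', q', hb, hb'⟩ := hΦ (parent b) q
  have ht : tilingK.Touch a' b' := ⟨p', q', Φ.injective (by rw [ha', hb', h])⟩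
  exact tball_add (tball_add (mem_tball_of_parent_eq ha.symm) ht.mem_tball)
    (mem_tball_of_parent_eq hb)

/-- Two steps suffice inside one parent, and every step between parents costs at most five steps
between their children; the central children serve as intermediate stations. -/
theorem mem_tball_of_parent {a b : tilingK.Tile} {m : ℕ}
    (h : parent b ∈ tilingK.tball (parent a) m) : b ∈ tilingK.tball a (5 * m + 2) := by
  induction m generalizing b with
  | zero => exact mem_tball_of_parent_eq h.symm
  | succ m ih =>
    obtain ⟨c, hc, ht⟩ := h
    have e : parent (ascend (c, none)) = c :=
      congrArg Prod.fst (descendEquiv.right_inv (c, none))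
    have h1 := ih (b := ascend (c, none)) (by rwa [e])
    have h2 := mem_tball_of_touch_parent (a := ascend (c, none)) (b := b) (by rwa [e])
    exact tball_mono a (by omega) (tball_add h1 h2)

theorem exists_tball_of_parent (n m : ℕ) : ∃ R, ∀ a b : tilingK.Tile,
    parent^[n] b ∈ tilingK.tball (parent^[n] a) m → b ∈ tilingK.tball a R := by
  induction n generalizing m with
  | zero => exact ⟨m, fun _ _ h => h⟩
  | succ n ih =>
    obtain ⟨R, hR⟩ := ih (5 * m + 2)
    refine ⟨R, fun a b h => hR a b (mem_tball_of_parent ?_)⟩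
    rwa [Function.iterate_succ_apply', Function.iterate_succ_apply'] at h

theorem exists_tilingK_homeomorph_iterate (n : ℕ) :
    ∃ Φ : tilingK.Realization ≃ₜ tilingK.Realization,
      (∀ t p, ∃ q, Φ (tilingK.pt t p) = tilingK.pt (parent^[n] t) q) ∧
      ∀ u q, ∃ t p, parent^[n] t = u ∧ Φ (tilingK.pt t p) = tilingK.pt u q := by
  induction n with
  | zero => exact ⟨Homeomorph.refl _, fun t p => ⟨p, rfl⟩, fun u q => ⟨u, q, rfl, rfl⟩⟩
  | succ n ih =>
    obtain ⟨Φ, h1, h2⟩ := ih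
    obtain ⟨Ψ, k1, k2⟩ := exists_tilingK_homeomorph
    refine ⟨Φ.trans Ψ, fun t p => ?_, fun u q => ?_⟩
    · obtain ⟨q, hq⟩ := h1 t p
      obtain ⟨q', hq'⟩ := k1 (parent^[n] t) q
      exact ⟨q', by rw [Homeomorph.trans_apply, hq, hq', Function.iterate_succ_apply']⟩
    · obtain ⟨t, p, rfl, hp⟩ := k2 u q
      obtain ⟨t', p', rfl, hp'⟩ := h2 t p
      exact ⟨t', p', Function.iterate_succ_apply' _ _ _, by
        rw [Homeomorph.trans_apply, hp', hp]⟩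

/-- A point is in the open star of a vertex if all its tiles contain the vertex. -/
theorem Regular.mem_openStar {X : PentComplex} (hX : X.Regular) (hC : X.Complete) (S : Sector)
    {v : X.Vertex} {x : X.Realization} (h : ∀ t p, x = X.pt t p → v ∈ X.verts t) :
    x ∈ openStar S v := by
  obtain ⟨t, p, rfl⟩ := x.exists_pt
  obtain ⟨i, hi⟩ := h t p rfl
  obtain ⟨w, r, rfl⟩ := exists_sectorPt S i p
  refine ⟨(t, i), w, r, hi, lt_of_le_of_ne unitInterval.le_one' ?_, rfl⟩
  -- For radius 1 the point lies on a side of `t` away from `v`. The tile across this side also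
  -- contains `v`, so both tiles share `v` and the two ends of the side, which are three vertices.
  rintro rfl
  obtain ⟨l, s, hl, e⟩ := S.far w
  rw [e, rot_sidePt] at h
  obtain ⟨t', j, hA⟩ := hC t (l + (i - 2))
  obtain ⟨i', hi'⟩ := h t' _ (hA.pt_eq s)
  have hne : t ≠ t' := fun e => hX.not_adj_self t _ j (by
    nth_rewrite 2 [e]
    exact hA)
  have := hX.share hne (i₁ := i) (i₂ := l + (i - 2)) (i₃ := l + (i - 2) + 1)
    ⟨i', hi.trans hi'.symm⟩ ⟨_, hA.vert_left⟩ ⟨_, hA.vert_right⟩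
  clear hi e h hA
  revert l i
  decide

/-- Every ball of `K` is contained in an open cell that is contained in a larger ball. -/
theorem exists_cell (r : ℕ) : ∃ R, ∀ t : tilingK.Tile, ∃ e : ℂ → tilingK.Realization,
    IsOpenEmbedding e ∧ (∀ u ∈ tilingK.tball t r, ∀ p, tilingK.pt u p ∈ Set.range e) ∧
    ∀ y ∈ Set.range e, ∃ u ∈ tilingK.tball t R, ∃ p, y = tilingK.pt u p := by
  obtain ⟨S⟩ := nonempty_sector
  -- A point is in the open star only if all tiles through it contain the vertex, and these tiles
  -- reach one step beyond the ball; hence `r + 1`. The cell is the preimage of the star under the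
  -- `n`-th iterate of the self-similarity.
  obtain ⟨n, hn⟩ := exists_supertile_star (r + 1)
  obtain ⟨R, hR⟩ := exists_tball_of_parent n 1
  obtain ⟨Φ, h1, h2⟩ := exists_tilingK_homeomorph_iterate n
  refine ⟨R, fun t => ?_⟩
  obtain ⟨v, hv⟩ := hn t
  obtain ⟨e, he, her⟩ := tilingK_regular.exists_openStar_chart tilingK_complete S v
  have hmem : ∀ y, y ∈ Set.range (Φ.symm ∘ e) ↔ Φ y ∈ openStar S v := by
    intro y
    rw [← her]
    constructor
    · rintro ⟨z, rfl⟩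
      exact ⟨z, by simp⟩
    · rintro ⟨z, hz⟩
      exact ⟨z, by simp [hz]⟩
  refine ⟨Φ.symm ∘ e, Φ.symm.isOpenEmbedding.comp he, fun u hu p => (hmem _).2 ?_,
    fun y hy => ?_⟩
  · refine tilingK_regular.mem_openStar tilingK_complete S fun T q hq => ?_
    obtain ⟨u', p', rfl, hp'⟩ := h2 T q
    have : tilingK.Touch u u' := ⟨p, p', Φ.injective (hq.trans hp'.symm)⟩
    exact hv u' ⟨u, hu, this⟩
  · obtain ⟨⟨T, i⟩, w, s, hT, -, hy⟩ := (hmem y).1 hy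
    obtain ⟨u, p, hu, hp⟩ := h2 T (rot (i - 2) (S.map w s))
    refine ⟨u, hR t u ?_, p, Φ.injective (hy.trans hp.symm)⟩
    obtain ⟨j, hj⟩ := hv t (mem_tball_self t _)
    rw [hu]
    exact (touch_of_vert_eq (hj.trans hT.symm)).mem_tball

end PentComplex

/-! ### Embeddings of patches -/

namespace Pentagon

/-- The midpoint of the unit interval. -/
def half : I := ⟨1 / 2, by norm_num, by norm_num⟩

@[simp] theorem symm_half : unitInterval.symm half = half :=
  Subtype.ext (by rw [unitInterval.coe_symm_eq]; norm_num [half])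

theorem half_ne_zero : half ≠ 0 := fun h => by
  have := congrArg Subtype.val h
  norm_num [half] at this

theorem half_ne_one : half ≠ 1 := fun h => by
  have := congrArg Subtype.val h
  norm_num [half] at this

/-- The midpoint of a side is fixed when the side is reversed, so midpoints allow isometries to be
followed on sides without regard to orientation. -/
theorem exists_side_of_isometry (g : pentagon ≃ᵢ pentagon) (i : ZMod 5) :
    ∃ j, g (sidePt i half) = sidePt j half ∧
      ((g (cornerPt i) = cornerPt j ∧ g (cornerPt (i + 1)) = cornerPt (j + 1)) ∨
        (g (cornerPt i) = cornerPt (j + 1) ∧ g (cornerPt (i + 1)) = cornerPt j)) := by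
  obtain ⟨j, h | h⟩ := exists_sidePt_of_isometry g i
  · exact ⟨j, h half, Or.inl ⟨by simpa using h 0, by simpa using h 1⟩⟩
  · exact ⟨j, by simpa using h half, Or.inr ⟨by simpa using h 0, by simpa using h 1⟩⟩

theorem sidePt_half_injective {i j : ZMod 5} (h : sidePt i half = sidePt j half) : i = j :=
  (PentComplex.sidePt_eq_sidePt_of_ne half_ne_zero half_ne_one h).1

/-- The centre of the pentagon. -/
def centre : pentagon := ⟨0, zero_mem⟩

theorem centre_ne_sidePt (i : ZMod 5) (s : I) : centre ≠ sidePt i s := by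
  intro h
  have h1 : centre = cone i s 0 := Subtype.ext (by simp [centre, cone])
  have h2 := (cone_eq_cone.1 ((h1.symm.trans h).trans (cone_one i s).symm)).1
  exact zero_ne_one h2

end Pentagon

namespace PentComplex
open Pentagon Topology

variable {X : PentComplex}

/-- The centre of a tile does not belong to other tiles. -/
theorem eq_of_pt_centre_eq {t u : X.Tile} {p : pentagon} (h : X.pt t centre = X.pt u p) :
    t = u ∧ p = centre := by
  let f : X.Realization → Prop := Quot.lift (fun x => x.1 = t ∧ x.2 = centre) (by
    rintro _ _ ⟨t, i, t', j, s, -⟩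
    refine propext ⟨fun h => ?_, fun h => ?_⟩
    · exact absurd h.2.symm (centre_ne_sidePt _ _)
    · exact absurd h.2.symm (centre_ne_sidePt _ _))
  have h1 : f (X.pt t centre) := ⟨rfl, rfl⟩
  rw [h] at h1
  exact ⟨h1.1.symm, h1.2⟩

theorem EdgeRegular.eq_or_adj (hX : X.EdgeRegular) {t u : X.Tile} {i j : ZMod 5}
    (h : X.pt t (sidePt i half) = X.pt u (sidePt j half)) : (t = u ∧ i = j) ∨ X.Adj t i u j := by
  rcases hX.pt_eq_iff.1 h with ⟨e, e'⟩ | ⟨i', j', s, hA, h0, h1, e, e'⟩ | ⟨i', j', e, -⟩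
  · exact Or.inl ⟨e, sidePt_half_injective e'⟩
  · obtain ⟨rfl, rfl⟩ := sidePt_eq_sidePt_of_ne half_ne_zero half_ne_one e
    rw [symm_half] at e'
    obtain rfl := sidePt_half_injective e'
    exact Or.inr hA
  · exact absurd e (sidePt_ne_cornerPt half_ne_zero half_ne_one)

theorem Adj.pt_half {t u : X.Tile} {i j : ZMod 5} (h : X.Adj t i u j) :
    X.pt t (sidePt i half) = X.pt u (sidePt j half) := by
  rw [h.pt_eq, symm_half]

/-- A map of tiles, together with isometries of the tiles, that respects the identifications of
the points of the tiles of a set. -/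
def TileEmb (X Y : PentComplex) (P : Set X.Tile) (τ : X.Tile → Y.Tile)
    (g : X.Tile → pentagon ≃ᵢ pentagon) : Prop :=
  ∀ t ∈ P, ∀ u ∈ P, ∀ p q, X.pt t p = X.pt u q ↔ Y.pt (τ t) (g t p) = Y.pt (τ u) (g u q)

namespace TileEmb

variable {Y : PentComplex} {P : Set X.Tile} {τ : X.Tile → Y.Tile}
  {g : X.Tile → pentagon ≃ᵢ pentagon}

/-- Tiles are recognized by their centres, which belong to no other tile. -/
theorem injOn (h : X.TileEmb Y P τ g) : Set.InjOn τ P := by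
  intro t ht u hu e
  have := (h t ht u hu centre ((g u).symm (g t centre))).2 (by
    rw [e, IsometryEquiv.apply_symm_apply])
  exact (eq_of_pt_centre_eq this).1

theorem touch (h : X.TileEmb Y P τ g) {t u : X.Tile} (ht : t ∈ P) (hu : u ∈ P)
    (htu : X.Touch t u) : Y.Touch (τ t) (τ u) := by
  obtain ⟨p, q, e⟩ := htu
  exact ⟨_, _, (h t ht u hu p q).1 e⟩

theorem exists_map (h : X.TileEmb Y P τ g) : ∃ φ : X.Realization → Y.Realization,
    ∀ t ∈ P, ∀ p, φ (X.pt t p) = Y.pt (τ t) (g t p) := by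
  classical
  have key : ∀ x : X.Realization, ∃ y, ∀ t ∈ P, ∀ p, x = X.pt t p → y = Y.pt (τ t) (g t p) := by
    intro x
    by_cases hx : ∃ t ∈ P, ∃ p, x = X.pt t p
    · obtain ⟨t, ht, p, rfl⟩ := hx
      exact ⟨_, fun u hu q e => (h t ht u hu p q).1 e⟩
    · obtain ⟨t, p, -⟩ := x.exists_pt
      exact ⟨Y.pt (τ t) p, fun t ht p e => absurd ⟨t, ht, p, e⟩ hx⟩
  choose φ hφ using key
  exact ⟨φ, fun t ht p => hφ _ t ht p rfl⟩

theorem exists_cornerPt (g : pentagon ≃ᵢ pentagon) :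
    ∃ f : ZMod 5 → ZMod 5, Function.Injective f ∧ ∀ i, g (cornerPt i) = cornerPt (f i) := by
  choose f hf using exists_cornerPt_of_isometry g
  refine ⟨f, fun i j e => ?_, hf⟩
  have := hf i
  rw [e, ← hf j] at this
  exact cornerPt_injective (g.injective this)

theorem vert_eq_iff (h : X.TileEmb Y P τ g) {t u : X.Tile} (ht : t ∈ P) (hu : u ∈ P)
    {i j i' j' : ZMod 5} (hi : g t (cornerPt i) = cornerPt i')
    (hj : g u (cornerPt j) = cornerPt j') :
    X.vert t i = X.vert u j ↔ Y.vert (τ t) i' = Y.vert (τ u) j' := by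
  rw [← pt_cornerPt_eq_iff, ← pt_cornerPt_eq_iff, h t ht u hu, hi, hj]

/-- The adjacency of sides is respected. -/
theorem adj (h : X.TileEmb Y P τ g) (hX : ∀ t, Function.Injective (X.pt t))
    (hY : Y.EdgeRegular) {t u : X.Tile} (ht : t ∈ P) (hu : u ∈ P) {i j i' j' : ZMod 5}
    (hA : X.Adj t i u j) (hi : g t (sidePt i half) = sidePt i' half)
    (hj : g u (sidePt j half) = sidePt j' half) : Y.Adj (τ t) i' (τ u) j' := by
  have e := (h t ht u hu _ _).1 hA.pt_half
  rw [hi, hj] at e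
  refine (hY.eq_or_adj e).resolve_left ?_
  rintro ⟨e1, -⟩
  obtain rfl := h.injOn ht hu e1
  obtain rfl := sidePt_half_injective (hX t hA.pt_half)
  have := hX t (hA.pt_eq 0)
  rw [unitInterval.symm_zero] at this
  exact zero_ne_one (sidePt_injective i this)

end TileEmb

/-- A complex all of whose finite patches embed into a regular complex is regular. -/
theorem Regular.of_tileEmb {Y : PentComplex} (hY : Y.Regular)
    (h : ∀ P : Finset X.Tile, ∃ τ g, X.TileEmb Y P τ g) : X.Regular := by
  classical
  have hinj : ∀ t, Function.Injective (X.pt t) := by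
    intro t p q e
    obtain ⟨τ, g, H⟩ := h {t}
    have := (H t (by simp) t (by simp) p q).1 e
    exact (g t).injective (hY.pt_injective _ this)
  refine ⟨?_, ?_, ?_, ?_⟩
  · intro t i t₁ j₁ t₂ j₂ h₁ h₂
    obtain ⟨τ, g, H⟩ := h {t, t₁, t₂}
    obtain ⟨i', hi, -⟩ := exists_side_of_isometry (g t) i
    obtain ⟨j₁', hj₁, -⟩ := exists_side_of_isometry (g t₁) j₁
    obtain ⟨j₂', hj₂, -⟩ := exists_side_of_isometry (g t₂) j₂
    obtain ⟨e, rfl⟩ := hY.edge (H.adj hinj hY.edge (by simp) (by simp) h₁ hi hj₁)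
      (H.adj hinj hY.edge (by simp) (by simp) h₂ hi hj₂)
    obtain rfl := H.injOn (by simp) (by simp) e
    exact ⟨rfl, sidePt_half_injective ((g t₁).injective (hj₁.trans hj₂.symm))⟩
  · intro t i j e
    exact cornerPt_injective (hinj t (pt_cornerPt_eq_iff.2 e))
  · intro t t' hne i₁ i₂ i₃ ⟨j₁, h₁⟩ ⟨j₂, h₂⟩ ⟨j₃, h₃⟩
    obtain ⟨τ, g, H⟩ := h {t, t'}
    obtain ⟨f, hf, hf'⟩ := TileEmb.exists_cornerPt (g t)
    obtain ⟨f₁, -, hf₁⟩ := TileEmb.exists_cornerPt (g t')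
    have ht : t ∈ ((({t, t'} : Finset X.Tile)) : Set X.Tile) := by simp
    have ht' : t' ∈ ((({t, t'} : Finset X.Tile)) : Set X.Tile) := by simp
    have hne' : τ t ≠ τ t' := fun e => hne (H.injOn ht ht' e)
    have := hY.share hne'
      ⟨_, (H.vert_eq_iff ht ht' (hf' i₁) (hf₁ j₁)).1 h₁⟩
      ⟨_, (H.vert_eq_iff ht ht' (hf' i₂) (hf₁ j₂)).1 h₂⟩
      ⟨_, (H.vert_eq_iff ht ht' (hf' i₃) (hf₁ j₃)).1 h₃⟩
    exact this.imp (fun e => hf e) (Or.imp (fun e => hf e) fun e => hf e)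
  · intro v s hs
    obtain ⟨τ, g, H⟩ := h (s.image Prod.fst)
    have hmem : ∀ a ∈ s, a.1 ∈ ((s.image Prod.fst : Finset X.Tile) : Set X.Tile) := fun a ha => by
      simpa using ⟨a.2, ha⟩
    choose f hf hf' using fun t => TileEmb.exists_cornerPt (g t)
    let F : X.Tile × ZMod 5 → Y.Tile × ZMod 5 := fun a => (τ a.1, f a.1 a.2)
    have hF : Set.InjOn F s := by
      rintro ⟨t, i⟩ ha ⟨u, j⟩ hb e
      obtain ⟨e1, e2⟩ := Prod.ext_iff.1 e
      have := H.injOn (hmem _ ha) (hmem _ hb) e1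
      dsimp only at this
      subst this
      exact Prod.ext rfl (hf t e2)
    rw [← Finset.card_image_of_injOn hF]
    rcases s.eq_empty_or_nonempty with rfl | ⟨a, ha⟩
    · simp
    refine hY.deg (Y.vert (F a).1 (F a).2) _ fun b hb => ?_
    obtain ⟨c, hc, rfl⟩ := Finset.mem_image.1 hb
    exact (H.vert_eq_iff (hmem c hc) (hmem a ha) (hf' _ _) (hf' _ _)).1
      ((hs c hc).trans (hs a ha).symm)

theorem Regular.finite_touch (hX : X.Regular) (t : X.Tile) : {u | X.Touch t u}.Finite := by
  refine (Set.finite_iUnion fun i => (hX.finite_corners (X.vert t i)).image Prod.fst).subset ?_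
  intro u hu
  obtain ⟨i, j, h⟩ := hX.edge.exists_vert_eq hu
  exact Set.mem_iUnion.2 ⟨i, (u, j), h.symm, rfl⟩

theorem Regular.finite_tball (hX : X.Regular) (t : X.Tile) (k : ℕ) : (X.tball t k).Finite := by
  induction k with
  | zero => exact Set.finite_singleton t
  | succ k ih =>
    refine (ih.biUnion fun u _ => hX.finite_touch u).subset ?_
    rintro v ⟨u, hu, h⟩
    exact Set.mem_biUnion hu h

namespace TileEmb

variable {Y : PentComplex} {P : Set X.Tile} {τ : X.Tile → Y.Tile}
  {g : X.Tile → pentagon ≃ᵢ pentagon}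

/-- The image of a complete patch contains all tiles around the image of a tile. -/
theorem exists_touch (h : X.TileEmb Y P τ g) (hX : X.Regular) (hC : X.Complete) (hY : Y.Regular)
    {t : X.Tile} (ht : ∀ u, X.Touch t u → u ∈ P) {u' : Y.Tile} (hu' : Y.Touch (τ t) u') :
    ∃ u, X.Touch t u ∧ τ u = u' := by
  obtain ⟨i', j', hv⟩ := hY.edge.exists_vert_eq hu'
  obtain ⟨i, hi⟩ := exists_cornerPt_of_isometry (g t).symm i'
  have hi : g t (cornerPt i) = cornerPt i' := by rw [← hi, IsometryEquiv.apply_symm_apply]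
  -- A corner is good if it comes from a corner at the vertex `i` of `t`. Goodness propagates across
  -- every gluing of `Y`: the corresponding side in the source has a neighbour, which is in `P`, and
  -- its image is the unique neighbour in `Y`. So all corners at the image vertex are good.
  let good : Y.Tile × ZMod 5 → Prop := fun a =>
    ∃ u k, X.vert u k = X.vert t i ∧ τ u = a.1 ∧ g u (cornerPt k) = cornerPt a.2
  have hP : ∀ u k, X.vert u k = X.vert t i → u ∈ P := fun u k e =>
    ht u (touch_of_vert_eq e.symm)
  have step : ∀ {s' i₁ s'' j₁ c c₂}, Y.Adj s' i₁ s'' j₁ → good (s', c) →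
      ((c = i₁ ∧ c₂ = j₁ + 1) ∨ (c = i₁ + 1 ∧ c₂ = j₁)) → good (s'', c₂) := by
    rintro s' i₁ s'' j₁ c c₂ hA ⟨u, k, e1, e2, e3⟩ hc
    dsimp only at e2 e3
    have hvc : Y.vert s' c = Y.vert s'' c₂ := by
      rcases hc with ⟨rfl, rfl⟩ | ⟨rfl, rfl⟩
      · exact hA.vert_left
      · exact hA.vert_right
    obtain ⟨m, hm, hm'⟩ := exists_side_of_isometry (g u).symm i₁
    simp only [IsometryEquiv.symm_apply_eq] at hm hm'
    have hk : k = m ∨ k = m + 1 := by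
      have hinj : ∀ {a b}, g u (cornerPt a) = g u (cornerPt b) → a = b := fun e =>
        cornerPt_injective ((g u).injective e)
      rcases hc with ⟨rfl, -⟩ | ⟨rfl, -⟩ <;> rcases hm' with ⟨h1, h2⟩ | ⟨h1, h2⟩
      · exact Or.inl (hinj (e3.trans h1))
      · exact Or.inr (hinj (e3.trans h1))
      · exact Or.inr (hinj (e3.trans h2))
      · exact Or.inl (hinj (e3.trans h2))
    obtain ⟨u₂, n, hn⟩ := hC u m
    obtain ⟨k₂, hk₂⟩ : ∃ k₂, X.vert u k = X.vert u₂ k₂ := by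
      rcases hk with rfl | rfl
      · exact ⟨_, hn.vert_left⟩
      · exact ⟨_, hn.vert_right⟩
    have huP := hP u k e1
    have hu₂P := hP u₂ k₂ (hk₂.symm.trans e1)
    obtain ⟨n', hn', -⟩ := exists_side_of_isometry (g u₂) n
    have hA' := h.adj hX.pt_injective hY.edge huP hu₂P hn hm.symm hn'
    rw [e2] at hA'
    obtain ⟨e4, -⟩ := hY.edge hA' hA
    refine ⟨u₂, k₂, hk₂.symm.trans e1, e4, ?_⟩
    obtain ⟨k₂', hk₂'⟩ := exists_cornerPt_of_isometry (g u₂) k₂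
    have e5 := (h.vert_eq_iff huP hu₂P e3 hk₂').1 hk₂
    rw [e2, e4, hvc] at e5
    rw [hk₂', hY.vert_inj e5]
  have hgood : ∀ a b, Relation.EqvGen Y.CornerRel a b → (good a ↔ good b) := by
    intro a b hab
    induction hab with
    | rel a b hab =>
      cases hab with
      | left hA => exact ⟨fun hg => step (Or.inl hA) hg (Or.inl ⟨rfl, rfl⟩),
          fun hg => step (Or.inr hA) hg (Or.inr ⟨rfl, rfl⟩)⟩
      | right hA => exact ⟨fun hg => step (Or.inl hA) hg (Or.inr ⟨rfl, rfl⟩),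
          fun hg => step (Or.inr hA) hg (Or.inl ⟨rfl, rfl⟩)⟩
    | refl a => exact Iff.rfl
    | symm a b _ ih => exact ih.symm
    | trans a b c _ _ ih ih' => exact ih.trans ih'
  obtain ⟨u, k, e1, e2, -⟩ := (hgood _ _ (Quot.eqvGen_exact hv)).1 ⟨t, i, rfl, rfl, hi⟩
  exact ⟨u, touch_of_vert_eq e1.symm, e2⟩

theorem mem_tball (h : X.TileEmb Y P τ g) {t : X.Tile} {k : ℕ} (hP : X.tball t k ⊆ P)
    {u : X.Tile} (hu : u ∈ X.tball t k) : τ u ∈ Y.tball (τ t) k := by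
  induction k generalizing u with
  | zero => cases hu; rfl
  | succ k ih =>
    obtain ⟨w, hw, hwu⟩ := hu
    have hk : X.tball t k ⊆ P := (tball_succ_subset t k).trans hP
    exact ⟨τ w, ih hk hw, h.touch (hk hw) (hP ⟨w, hw, hwu⟩) hwu⟩

theorem exists_of_mem_tball (h : X.TileEmb Y P τ g) (hX : X.Regular) (hC : X.Complete)
    (hY : Y.Regular) {t : X.Tile} {k : ℕ} (hP : X.tball t k ⊆ P) {u' : Y.Tile}
    (hu' : u' ∈ Y.tball (τ t) k) : ∃ u ∈ X.tball t k, τ u = u' := by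
  induction k generalizing u' with
  | zero => cases hu'; exact ⟨t, rfl, rfl⟩
  | succ k ih =>
    obtain ⟨w', hw', hwu⟩ := hu'
    obtain ⟨w, hw, rfl⟩ := ih ((tball_succ_subset t k).trans hP) hw'
    obtain ⟨u, hu, rfl⟩ := h.exists_touch hX hC hY (fun u hu => hP ⟨w, hw, hu⟩) hwu
    exact ⟨u, ⟨w, hw, hu⟩, rfl⟩

end TileEmb

end PentComplex

namespace PentComplex
open Pentagon Topology

variable {X : PentComplex}

/-! ### Complexes homeomorphic to the plane -/

/-- The union of the tiles that can be reached from `t` contains all or nothing of every tile, so it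
is open and closed. -/
theorem chained_of_preconnected [PreconnectedSpace X.Realization] : X.Chained := by
  intro t u
  let C : Set X.Realization := {x | ∃ k, ∃ v ∈ X.tball t k, ∃ p, x = X.pt v p}
  have key : ∀ v p, X.pt v p ∈ C ↔ ∃ k, v ∈ X.tball t k := by
    intro v p
    constructor
    · rintro ⟨k, w, hw, q, e⟩
      exact ⟨k + 1, w, hw, q, p, e.symm⟩
    · rintro ⟨k, hk⟩
      exact ⟨k, v, hk, p, rfl⟩
  have hpre : ∀ v, X.pt v ⁻¹' C = Set.univ ∨ X.pt v ⁻¹' C = ∅ := by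
    intro v
    by_cases hv : ∃ k, v ∈ X.tball t k
    · exact Or.inl (Set.eq_univ_of_forall fun p => (key v p).2 hv)
    · exact Or.inr (Set.eq_empty_of_forall_notMem fun p hp => hv ((key v p).1 hp))
  have hopen : IsOpen C := isOpen_iff.2 fun v => by
    rcases hpre v with h | h <;> rw [h]
    exacts [isOpen_univ, isOpen_empty]
  have hclosed : IsClosed C := ⟨isOpen_iff.2 fun v => by
    rw [Set.preimage_compl]
    rcases hpre v with h | h <;> rw [h] <;> simp⟩
  have huniv : C = Set.univ := IsClopen.eq_univ ⟨hclosed, hopen⟩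
    ⟨X.pt t centre, (key t centre).2 ⟨0, rfl⟩⟩
  exact (key u centre).1 (huniv ▸ Set.mem_univ _)

/-- If side `i` of `t` were free, the tile without its other sides would be open in the complex. It
contracts radially to the centre of the pentagon, and so does the complement of the midpoint of side
`i`; this is impossible for an open set of the plane. -/
theorem Regular.complete_of_homeomorph (hX : X.Regular) (Ψ : X.Realization ≃ₜ ℂ) : X.Complete := by
  by_contra hC
  obtain ⟨t, i, hti⟩ : ∃ t i, ∀ t' j, ¬ X.Adj t i t' j := by
    simpa [Complete] using hC
  let V : Set ℂ := {z | ∃ hz : z ∈ pentagon, ∀ j s, j ≠ i → (⟨z, hz⟩ : pentagon) ≠ sidePt j s}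
  let ι : V → pentagon := fun z => ⟨z, z.2.choose⟩
  have hι : ∀ z : V, ∀ j s, ι z = sidePt j s → j = i := fun z j s e => by
    by_contra hne
    exact z.2.choose_spec j s hne e
  have hιc : Continuous ι := Continuous.subtype_mk continuous_subtype_val _
  have hιi : Function.Injective ι := fun z w e =>
    Subtype.ext (congrArg (fun p : pentagon => (p : ℂ)) e)
  have hιr : ∀ p : pentagon, (∀ j s, j ≠ i → p ≠ sidePt j s) → ∃ z, ι z = p := fun p hp =>
    ⟨⟨p, p.2, hp⟩, rfl⟩
  have hιo : IsOpenMap ι := by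
    have hr : IsOpen (Set.range ι) := by
      have : Set.range ι = ⋂ j, ⋂ (_ : j ≠ i), (Set.range (sidePt j))ᶜ := by
        ext p
        simp only [Set.mem_iInter, Set.mem_compl_iff, Set.mem_range, not_exists]
        constructor
        · rintro ⟨z, rfl⟩ j hj s e
          exact hj (hι z j s e.symm)
        · intro h
          exact hιr p fun j s hj e => h j hj s e.symm
      rw [this]
      refine isOpen_iInter_of_finite fun j => isOpen_iInter_of_finite fun _ => ?_
      exact (isCompact_range (continuous_sidePt j)).isClosed.isOpen_compl
    have : IsEmbedding ι := IsEmbedding.of_comp (g := Subtype.val) hιc continuous_subtype_val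
      IsEmbedding.subtypeVal
    exact (IsOpenEmbedding.mk this hr).isOpenMap
  have hemb : IsOpenEmbedding fun z => X.pt t (ι z) := by
    refine .of_continuous_injective_isOpenMap ((continuous_pt t).comp hιc)
      (fun z w e => hιi (hX.pt_injective t e)) fun W hW => isOpen_iff.2 fun u => ?_
    have key : ∀ z p, X.pt t (ι z) = X.pt u p → t = u ∧ ι z = p := by
      intro z p e
      rcases hX.edge.pt_eq_iff.1 e with e | ⟨j, j', s, hA, h0, h1, e, -⟩ | ⟨j, j', e, -, -⟩
      · exact e
      · obtain rfl := hι z j s e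
        exact absurd hA (hti _ _)
      · exfalso
        have h1 := hι z j 0 (by rw [sidePt_zero, e])
        have h2 := hι z (j - 1) 1 (by rw [sidePt_one, sub_add_cancel, e])
        rw [← h1] at h2
        revert h2
        clear * -
        revert j
        decide
    rcases eq_or_ne t u with rfl | hne
    · have : X.pt t ⁻¹' ((fun z => X.pt t (ι z)) '' W) = ι '' W := by
        ext p
        constructor
        · rintro ⟨z, hz, e⟩
          exact ⟨z, hz, (key z p e).2⟩
        · rintro ⟨z, hz, rfl⟩
          exact ⟨z, hz, rfl⟩
      rw [this]
      exact hιo W hW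
    · have : X.pt u ⁻¹' ((fun z => X.pt t (ι z)) '' W) = ∅ := by
        refine Set.eq_empty_of_forall_notMem ?_
        rintro p ⟨z, -, e⟩
        exact hne (key z p e).1
      rw [this]
      exact isOpen_empty
  have hmV : (sidePt i half : ℂ) ∈ V := ⟨(sidePt i half).2, fun j s hj e =>
    hj (sidePt_eq_sidePt_of_ne half_ne_zero half_ne_one (Subtype.ext_iff.2 (congrArg Subtype.val e) :
      sidePt i half = sidePt j s)).1.symm⟩
  refine PlaneTopology.not_isOpenEmbedding_of_contractible hmV ?_ _
    (Ψ.isOpenEmbedding.comp hemb)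
  rintro p ⟨hp, hpV⟩ hpm r r0 r1
  obtain ⟨j, s, ρ, hcone⟩ := cone_surjective ⟨p, hp⟩
  have hrp : r • p = (cone j s ⟨r * ρ, mul_nonneg r0 ρ.2.1, mul_le_one₀ r1 ρ.2.1 ρ.2.2⟩ : ℂ) := by
    have : p = (cone j s ρ : ℂ) := congrArg Subtype.val hcone.symm
    rw [this]
    simp [cone, mul_smul]
  have hone : ∀ j' s', r • p = (sidePt j' s' : ℂ) → r • p = p := by
    intro j' s' e
    rw [hrp] at e
    have e' : cone j s ⟨r * ρ, _⟩ = cone j' s' 1 := Subtype.ext (by rw [cone_one]; exact e)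
    have e1 : r * ρ = 1 := congrArg Subtype.val (cone_eq_cone.1 e').1
    have hr : r = 1 := by nlinarith [ρ.2.1, ρ.2.2]
    rw [hr, one_smul]
  have hmem : r • p ∈ pentagon := hrp ▸ (cone j s _).2
  refine ⟨⟨hmem, fun j' s' hj' e => ?_⟩, fun e => ?_⟩
  · have e1 : r • p = (sidePt j' s' : ℂ) := congrArg Subtype.val e
    refine hpV j' s' hj' (Subtype.ext ?_)
    exact (hone j' s' e1).symm.trans e1
  · exact hpm ((hone i half e).symm.trans e)

/-- Cells in a complex whose patches embed into `K`. -/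
theorem exists_cell_of_tileEmb (hX : X.Regular) (hC : X.Complete)
    (h : ∀ P : Finset X.Tile, ∃ τ g, X.TileEmb tilingK P τ g) (r : ℕ) :
    ∃ R, ∀ t : X.Tile, ∃ e : ℂ → X.Realization, IsOpenEmbedding e ∧
      (∀ u ∈ X.tball t r, ∀ p, X.pt u p ∈ Set.range e) ∧
      ∀ y ∈ Set.range e, ∃ u ∈ X.tball t R, ∃ p, y = X.pt u p := by
  obtain ⟨R, hR⟩ := exists_cell r
  refine ⟨R, fun t => ?_⟩
  -- Openness of a subset of `C` has to be tested on all tiles that meet `C`, and these are in the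
  -- ball of radius `R + 1`.
  set N := max r (R + 1)
  obtain ⟨τ, g, H⟩ := h (hX.finite_tball t N).toFinset
  rw [Set.Finite.coe_toFinset] at H
  have hR1 : X.tball t (R + 1) ⊆ X.tball t N := tball_mono t (le_max_right _ _)
  have hR0 : X.tball t R ⊆ X.tball t N := (tball_succ_subset t R).trans hR1
  obtain ⟨φ, hφ⟩ := H.exists_map
  obtain ⟨e, he, he1, he2⟩ := hR (τ t)
  have inj : ∀ u ∈ X.tball t N, ∀ v ∈ X.tball t N, ∀ p q, φ (X.pt u p) = φ (X.pt v q) →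
      X.pt u p = X.pt v q := by
    intro u hu v hv p q e
    rw [hφ u hu, hφ v hv] at e
    exact (H u hu v hv p q).2 e
  let C : Set X.Realization := {x | ∃ u ∈ X.tball t R, ∃ p, x = X.pt u p}
  have hCU : ∀ y ∈ Set.range e, ∃ x ∈ C, φ x = y := by
    intro y hy
    obtain ⟨u', hu', p', rfl⟩ := he2 y hy
    obtain ⟨u, hu, rfl⟩ := H.exists_of_mem_tball hX hC tilingK_regular hR0 hu'
    exact ⟨X.pt u ((g u).symm p'), ⟨u, hu, _, rfl⟩, by
      rw [hφ u (hR0 hu), IsometryEquiv.apply_symm_apply]⟩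
  have hCmem : ∀ u p, X.pt u p ∈ C → u ∈ X.tball t (R + 1) := by
    rintro u p ⟨w, hw, q, e⟩
    exact ⟨w, hw, q, p, e.symm⟩
  have injC : ∀ x ∈ C, ∀ u ∈ X.tball t N, ∀ p, φ x = φ (X.pt u p) → x = X.pt u p := by
    rintro _ ⟨w, hw, q, rfl⟩ u hu p e
    exact inj w (hR0 hw) u hu q p e
  -- Together with `open2` this makes `φ` a homeomorphism from an open part of `C` onto the cell, so
  -- the cell can be lifted to `X`.
  have open1 : ∀ V ⊆ Set.range e, IsOpen V → IsOpen (C ∩ φ ⁻¹' V) := by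
    intro V hVe hV
    refine isOpen_iff.2 fun u => ?_
    by_cases hu : u ∈ X.tball t (R + 1)
    · have : X.pt u ⁻¹' (C ∩ φ ⁻¹' V) = (fun p => tilingK.pt (τ u) (g u p)) ⁻¹' V := by
        ext p
        constructor
        · rintro ⟨-, hp⟩
          rwa [Set.mem_preimage, hφ u (hR1 hu)] at hp
        · intro hp
          rw [Set.mem_preimage, ← hφ u (hR1 hu)] at hp
          obtain ⟨x, hx, e⟩ := hCU _ (hVe hp)
          obtain rfl := injC x hx u (hR1 hu) p e
          exact ⟨hx, hp⟩
      rw [this]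
      exact hV.preimage ((continuous_pt _).comp (g u).continuous)
    · have : X.pt u ⁻¹' (C ∩ φ ⁻¹' V) = ∅ :=
        Set.eq_empty_of_forall_notMem fun p hp => hu (hCmem u p hp.1)
      rw [this]
      exact isOpen_empty
  have open2 : ∀ W ⊆ C, IsOpen W → IsOpen (φ '' W) := by
    intro W hWC hW
    refine isOpen_iff.2 fun u' => ?_
    by_cases hu' : u' ∈ tilingK.tball (τ t) (R + 1)
    · obtain ⟨u, hu, rfl⟩ := H.exists_of_mem_tball hX hC tilingK_regular hR1 hu'
      have : tilingK.pt (τ u) ⁻¹' (φ '' W) = (fun p => X.pt u ((g u).symm p)) ⁻¹' W := by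
        ext p
        have e : tilingK.pt (τ u) p = φ (X.pt u ((g u).symm p)) := by
          rw [hφ u (hR1 hu), IsometryEquiv.apply_symm_apply]
        rw [Set.mem_preimage, Set.mem_preimage, e]
        constructor
        · rintro ⟨x, hx, e⟩
          rw [← injC x (hWC hx) u (hR1 hu) _ e]
          exact hx
        · intro hp
          exact ⟨_, hp, rfl⟩
      rw [this]
      exact hW.preimage ((continuous_pt _).comp (g u).symm.continuous)
    · have : tilingK.pt u' ⁻¹' (φ '' W) = ∅ := by
        refine Set.eq_empty_of_forall_notMem ?_
        rintro p ⟨x, hx, e⟩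
        obtain ⟨w, hw, q, rfl⟩ := hWC hx
        rw [hφ w (hR0 hw)] at e
        exact hu' ⟨τ w, H.mem_tball hR0 hw, _, _, e⟩
      rw [this]
      exact isOpen_empty
  choose f hfC hf using fun z => hCU (e z) ⟨z, rfl⟩
  have fuse : ∀ x ∈ C, ∀ z, φ x = e z → x = f z := by
    rintro x hx z ez
    obtain ⟨w, hw, q, e'⟩ := hfC z
    rw [e']
    exact injC x hx w (hR0 hw) q (by rw [← e', hf, ez])
  have hD := open1 _ le_rfl he.isOpen_range
  have hfc : Continuous f := by
    refine ⟨fun W hW => ?_⟩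
    have : f ⁻¹' W = e ⁻¹' (φ '' (W ∩ (C ∩ φ ⁻¹' Set.range e))) := by
      ext z
      constructor
      · intro hz
        exact ⟨f z, ⟨hz, hfC z, z, (hf z).symm⟩, hf z⟩
      · rintro ⟨x, ⟨hx, hxC, -⟩, ex⟩
        rw [Set.mem_preimage, ← fuse x hxC z ex]
        exact hx
    rw [this]
    exact (open2 _ (fun x hx => hx.2.1) (hW.inter hD)).preimage he.continuous
  refine ⟨f, .of_continuous_injective_isOpenMap hfc
    (fun z w ezw => he.injective (by rw [← hf, ← hf, ezw])) (fun V hV => ?_), ?_, ?_⟩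
  · have : f '' V = C ∩ φ ⁻¹' (e '' V) := by
      ext x
      constructor
      · rintro ⟨z, hz, rfl⟩
        exact ⟨hfC z, z, hz, (hf z).symm⟩
      · rintro ⟨hx, z, hz, ez⟩
        exact ⟨z, hz, (fuse x hx z ez.symm).symm⟩
    rw [this]
    exact open1 _ (Set.image_subset_range _ _) (he.isOpenMap V hV)
  · intro u hu p
    have hr : X.tball t r ⊆ X.tball t N := tball_mono t (le_max_left _ _)
    obtain ⟨z, hz⟩ := he1 (τ u) (H.mem_tball hr hu) (g u p)
    rw [← hφ u (hr hu)] at hz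
    exact ⟨z, injC _ (hfC z) u (hr hu) p (by rw [hf, hz])⟩
  · rintro _ ⟨z, rfl⟩
    exact hfC z

/-- A complete connected complex whose patches embed into `K` is homeomorphic to the plane. -/
theorem isTiling_of_tileEmb (hX : X.Regular) (hC : X.Complete) (hch : X.Chained) (t : X.Tile)
    (h : ∀ P : Finset X.Tile, ∃ τ g, X.TileEmb tilingK P τ g) : X.IsTiling := by
  have : T2Space X.Realization := hX.t2Space
  choose R hR using exists_cell_of_tileEmb hX hC h
  choose e he he1 he2 using fun r => hR r t
  -- The `n`-th cell lies in the ball of radius `R (ρ n)`, so the radius `ρ (n + 1)` puts it into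
  -- the next cell. The term `r + 1` lets the radii grow beyond all bounds, and the cells cover the
  -- complex.
  let ρ : ℕ → ℕ := fun n => Nat.rec 0 (fun _ r => max (R r) (r + 1)) n
  have hρ : ∀ n, ρ (n + 1) = max (R (ρ n)) (ρ n + 1) := fun n => rfl
  have hle : ∀ n, n ≤ ρ n := by
    intro n
    induction n with
    | zero => exact le_rfl
    | succ n ih =>
      rw [hρ]
      exact le_max_of_le_right (by omega)
  obtain ⟨Ψ⟩ := PlaneTopology.nonempty_homeomorph_of_iUnion (e := fun n => e (ρ n))
    (fun n => he _) (fun n => by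
      intro y hy
      obtain ⟨u, hu, p, rfl⟩ := he2 _ y hy
      exact he1 _ u (tball_mono t (by rw [hρ]; exact le_max_left _ _) hu) p)
    (fun x => by
      obtain ⟨u, p, rfl⟩ := x.exists_pt
      obtain ⟨k, hk⟩ := hch t u
      exact ⟨k, he1 _ u (tball_mono t (hle k) hk) p⟩)
  exact ⟨Ψ.trans Complex.orthonormalBasisOneI.repr.toHomeomorph⟩

theorem IsTiling.chained (h : X.IsTiling) : X.Chained := by
  obtain ⟨Ψ⟩ := h
  have : PreconnectedSpace X.Realization := by
    refine ⟨?_⟩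
    have h1 : IsPreconnected (Set.range Ψ.symm) := isPreconnected_range Ψ.symm.continuous
    rwa [Ψ.symm.surjective.range_eq] at h1
  exact chained_of_preconnected

theorem IsTiling.complete (h : X.IsTiling) (hX : X.Regular) : X.Complete := by
  obtain ⟨Ψ⟩ := h
  exact hX.complete_of_homeomorph
    (Ψ.trans Complex.orthonormalBasisOneI.repr.toHomeomorph.symm)

end PentComplex

/-! ### Local isomorphism in terms of embeddings -/

namespace DecComplex
open PentComplex

variable {A : Type} {L K : DecComplex A}

/-- An embedding of a patch that respects the decorations. -/
def DecEmb (L K : DecComplex A) (P : Set L.Tile) (τ : L.Tile → K.Tile)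
    (g : L.Tile → pentagon ≃ᵢ pentagon) : Prop :=
  L.TileEmb K.toPentComplex P τ g ∧ ∀ t ∈ P, ∀ p, K.deco (τ t) (g t p) = L.deco t p

theorem LocallyIsomorphic.exists_decEmb (h : L.LocallyIsomorphic K) (P : Finset L.Tile) :
    ∃ τ g, L.DecEmb K P τ g := by
  obtain ⟨Q, φ, hφ, h1, -⟩ := h P
  have key : ∀ t, ∃ (t' : K.Tile) (g : pentagon ≃ᵢ pentagon), t ∈ P → ∀ p, φ (L.pt t p) = K.pt t' (g p) ∧
      K.deco t' (g p) = L.deco t p := by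
    intro t
    by_cases ht : t ∈ P
    · obtain ⟨t', -, g, hg⟩ := h1 t ht
      exact ⟨t', g, fun _ => hg⟩
    -- Outside `P` the values do not matter; the patch `{t}` serves only to produce some tile of
    -- `K`.
    · obtain ⟨Q', φ', -, h2, -⟩ := h {t}
      obtain ⟨t', -⟩ := h2 t (by simp)
      exact ⟨t', IsometryEquiv.refl _, fun h => absurd h ht⟩
  choose τ g H using key
  refine ⟨τ, g, fun t ht u hu p q => ?_, fun t ht p => (H t ht p).2⟩
  rw [← (H t ht p).1, ← (H u hu q).1]
  exact (hφ.injOn.eq_iff ⟨t, ht, p, rfl⟩ ⟨u, hu, q, rfl⟩).symm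

theorem locallyIsomorphic_of_decEmb (h : ∀ P : Finset L.Tile, ∃ τ g, L.DecEmb K P τ g) :
    L.LocallyIsomorphic K := by
  classical
  intro P
  obtain ⟨τ, g, h1, h2⟩ := h P
  obtain ⟨φ, hφ⟩ := h1.exists_map
  have hmaps : ∀ t ∈ P, L.MapsTile K φ t (τ t) := fun t ht =>
    ⟨g t, fun p => ⟨hφ t ht p, h2 t ht p⟩⟩
  refine ⟨P.image τ, φ, ⟨?_, ?_, ?_⟩, fun t ht => ⟨τ t, Finset.mem_image_of_mem τ ht, hmaps t ht⟩,
    fun t' ht' => ?_⟩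
  · rintro _ ⟨t, ht, p, rfl⟩
    exact ⟨τ t, Finset.mem_image_of_mem τ ht, g t p, hφ t ht p⟩
  · rintro _ ⟨t, ht, p, rfl⟩ _ ⟨u, hu, q, rfl⟩ e
    rw [hφ t ht, hφ u hu] at e
    exact (h1 t ht u hu p q).2 e
  · rintro _ ⟨t', ht', p, rfl⟩
    obtain ⟨t, ht, rfl⟩ := Finset.mem_image.1 ht'
    exact ⟨L.pt t ((g t).symm p), ⟨t, ht, _, rfl⟩, by
      rw [hφ t ht, IsometryEquiv.apply_symm_apply]⟩
  · obtain ⟨t, ht, rfl⟩ := Finset.mem_image.1 ht'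
    exact ⟨t, ht, hmaps t ht⟩

end DecComplex

/-! ### Distances and degrees under cellwise isometries -/

namespace PentComplex
open Pentagon

variable {X Y : PentComplex}

theorem Regular.eq_of_affDist_eq_zero (hX : X.Regular) (hch : X.Chained) {x y : X.Realization}
    (h : X.affDist x y = 0) : x = y := by
  obtain ⟨f, hf, h0, h1⟩ := exists_separating hX.pt_injective x
    (hX.edge.finite_fibre hX.finite_corners x)
  have := hf.abs_sub_le hch x y
  rw [h, h0, zero_sub, abs_neg] at this
  exact (h1 y (abs_nonpos_iff.1 this)).symm

theorem PolyPath.map_of_forall {φ : X.Realization → Y.Realization}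
    (hφ : ∀ t, ∃ t', ∃ g : pentagon ≃ᵢ pentagon, ∀ p, φ (X.pt t p) = Y.pt t' (g p))
    {x y : X.Realization} {r : ℝ} (h : X.PolyPath x y r) : Y.PolyPath (φ x) (φ y) r := by
  induction h with
  | nil x => exact PolyPath.nil _
  | cons t p q y r h ih =>
    obtain ⟨t', g, hg⟩ := hφ t
    rw [hg] at ih ⊢
    rw [← g.dist_eq p q]
    exact PolyPath.cons t' _ _ _ _ ih

theorem affDist_map_equiv (φ : X.Realization ≃ Y.Realization)
    (hφ : ∀ t, ∃ t', ∃ g : pentagon ≃ᵢ pentagon, ∀ p, φ (X.pt t p) = Y.pt t' (g p))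
    (hφ' : ∀ t, ∃ t', ∃ g : pentagon ≃ᵢ pentagon, ∀ p, φ.symm (Y.pt t p) = X.pt t' (g p))
    (x y : X.Realization) : Y.affDist (φ x) (φ y) = X.affDist x y := by
  unfold affDist
  congr 1
  ext r
  refine ⟨fun h => ?_, fun h => h.map_of_forall hφ⟩
  have := PolyPath.map_of_forall hφ' h
  rwa [Equiv.symm_apply_apply, Equiv.symm_apply_apply] at this

/-- An isometry of tiles maps edges to edges. -/
theorem exists_image_edge {φ : X.Realization → Y.Realization} {t : X.Tile} {t' : Y.Tile}
    {g : pentagon ≃ᵢ pentagon} (h : ∀ p, φ (X.pt t p) = Y.pt t' (g p)) (i : ZMod 5) :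
    ∃ j, φ '' X.edge t i = Y.edge t' j := by
  obtain ⟨j, hj | hj⟩ := exists_sidePt_of_isometry g i
  · refine ⟨j, ?_⟩
    rw [edge, edge, ← Set.range_comp]
    congr 1
    funext s
    rw [Function.comp_apply, h, hj]
  · refine ⟨j, ?_⟩
    rw [edge, edge, ← Set.range_comp, ← unitInterval.symm_bijective.surjective.range_comp]
    congr 1
    funext s
    rw [Function.comp_apply, Function.comp_apply, h, hj, unitInterval.symm_symm]

theorem degree_map_equiv (φ : X.Realization ≃ Y.Realization)
    (hφ : ∀ t, ∃ t', ∃ g : pentagon ≃ᵢ pentagon, ∀ p, φ (X.pt t p) = Y.pt t' (g p))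
    (hφ' : ∀ t, ∃ t', ∃ g : pentagon ≃ᵢ pentagon, ∀ p, φ.symm (Y.pt t p) = X.pt t' (g p))
    (v : X.Realization) : Y.degree (φ v) = X.degree v := by
  have : {e : Set Y.Realization | (∃ t i, e = Y.edge t i) ∧ φ v ∈ e} =
      Set.image φ '' {e | (∃ t i, e = X.edge t i) ∧ v ∈ e} := by
    ext e
    constructor
    · rintro ⟨⟨t, i, rfl⟩, hv⟩
      obtain ⟨t', g, hg⟩ := hφ' t
      obtain ⟨j, hj⟩ := exists_image_edge hg i
      refine ⟨X.edge t' j, ⟨⟨t', j, rfl⟩, ?_⟩, ?_⟩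
      · rw [← hj]
        exact ⟨φ v, hv, by simp⟩
      · rw [← hj, ← Set.image_comp]
        simp
    · rintro ⟨_, ⟨⟨t, i, rfl⟩, hv⟩, rfl⟩
      obtain ⟨t', g, hg⟩ := hφ t
      obtain ⟨j, hj⟩ := exists_image_edge hg i
      exact ⟨⟨t', j, hj⟩, v, hv, rfl⟩
  rw [degree, degree, this, Set.ncard_image_of_injective _ φ.injective.image_injective]

end PentComplex

/-! ### Composition of admissible maps -/

namespace DecComplex
open PentComplex Pentagon

variable {A : Type} {L L' L'' : DecComplex A}

/-- `NearMap` with the radius of the ball and the displacement of the point as separate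
parameters. -/
def Near (L L' : DecComplex A) (x : L.Realization) (x' : L'.Realization) (R δ : ℝ) : Prop :=
  ∃ φ : L.Realization → L'.Realization,
    (∀ y ∈ L.ball x R, ∀ z ∈ L.ball x R, L'.affDist (φ y) (φ z) = L.affDist y z) ∧
    (∀ t : L.Tile, (∃ p, L.pt t p ∈ L.ball x R) →
      ∃ (t' : L'.Tile) (g : pentagon ≃ᵢ pentagon),
        (∀ p, L.pt t p ∈ L.ball x R → φ (L.pt t p) = L'.pt t' (g p)) ∧
        (∀ p, L'.deco t' (g p) = L.deco t p)) ∧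
    (∀ v ∈ L.ball x R, L.IsVertex v → L'.degree (φ v) = L.degree v) ∧
    L'.affDist (φ x) x' ≤ δ

theorem nearMap_iff {x : L.Realization} {x' : L'.Realization} {ε : ℝ} :
    L.NearMap L' x x' ε ↔ L.Near L' x x' (1 / ε) ε := Iff.rfl

theorem Near.mono {x : L.Realization} {x' : L'.Realization} {R R' δ δ' : ℝ}
    (h : L.Near L' x x' R δ) (hR : R' ≤ R) (hδ : δ ≤ δ') : L.Near L' x x' R' δ' := by
  obtain ⟨φ, h1, h2, h3, h4⟩ := h
  have hb : L.ball x R' ⊆ L.ball x R := fun y hy => le_trans hy hR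
  refine ⟨φ, fun y hy z hz => h1 y (hb hy) z (hb hz), fun t ⟨p, hp⟩ => ?_,
    fun v hv => h3 v (hb hv), h4.trans hδ⟩
  obtain ⟨t', g, h5, h6⟩ := h2 t ⟨p, hb hp⟩
  exact ⟨t', g, fun p hp => h5 p (hb hp), h6⟩

theorem Near.refl (x : L.Realization) (R : ℝ) : L.Near L x x R 0 :=
  ⟨id, fun _ _ _ _ => rfl, fun t _ => ⟨t, IsometryEquiv.refl _, fun _ _ => rfl, fun _ => rfl⟩,
    fun _ _ _ => rfl, (affDist_self x).le⟩

/-- The first map sends the ball of radius `R` around `x` into the ball of radius `R + δ₁` around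
`x'`, where the second map is controlled. -/
theorem Near.trans {x : L.Realization} {x' : L'.Realization} {x'' : L''.Realization}
    {R R₁ δ₁ R₂ δ₂ : ℝ} (h : L.Near L' x x' R₁ δ₁) (h' : L'.Near L'' x' x'' R₂ δ₂)
    (hL' : L'.Chained) (hL'' : L''.Chained) (h0 : 0 ≤ R) (hR₁ : R ≤ R₁) (hR₂ : R + δ₁ ≤ R₂) :
    L.Near L'' x x'' R (δ₁ + δ₂) := by
  obtain ⟨φ, h1, h2, h3, h4⟩ := h.mono hR₁ le_rfl
  obtain ⟨ψ, k1, k2, k3, k4⟩ := h'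
  have hx : x ∈ L.ball x R := (affDist_self x).le.trans h0
  have hb : ∀ y ∈ L.ball x R, φ y ∈ L'.ball x' R₂ := by
    intro y hy
    have e1 := hL'.affDist_triangle x' (φ x) (φ y)
    rw [h1 x hx y hy, affDist_comm x' (φ x)] at e1
    have e2 : L.affDist x y ≤ R := hy
    change L'.affDist x' (φ y) ≤ R₂
    linarith
  have hx' : x' ∈ L'.ball x' R₂ := by
    have : 0 ≤ δ₁ := (affDist_nonneg _ _).trans h4
    exact (affDist_self x').le.trans (by linarith)
  refine ⟨ψ ∘ φ, fun y hy z hz => ?_, fun t ⟨p, hp⟩ => ?_, fun v hv hvv => ?_, ?_⟩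
  · rw [Function.comp_apply, Function.comp_apply, k1 _ (hb y hy) _ (hb z hz), h1 y hy z hz]
  · obtain ⟨t', g, e1, e2⟩ := h2 t ⟨p, hp⟩
    obtain ⟨t'', g', e3, e4⟩ := k2 t' ⟨g p, by rw [← e1 p hp]; exact hb _ hp⟩
    refine ⟨t'', g.trans g', fun q hq => ?_, fun q => ?_⟩
    · rw [Function.comp_apply, e1 q hq]
      exact e3 (g q) (by rw [← e1 q hq]; exact hb _ hq)
    · exact (e4 (g q)).trans (e2 q)
  · rw [Function.comp_apply, k3 _ (hb v hv) ?_, h3 v hv hvv]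
    obtain ⟨t, i, rfl⟩ := hvv
    obtain ⟨t', g, e1, -⟩ := h2 t ⟨_, hv⟩
    obtain ⟨j, hj⟩ := exists_cornerPt_of_isometry g i
    exact ⟨t', j, by rw [e1 _ hv, hj]⟩
  · have e1 := hL''.affDist_triangle (ψ (φ x)) (ψ x') x''
    rw [k1 _ (hb x hx) _ hx'] at e1
    exact e1.trans (by linarith)

end DecComplex

namespace PointedTiling
open PentComplex DecComplex Pentagon

variable {A : Type} {K : DecComplex A}

theorem chained (u : PointedTiling K) : u.L.Chained := u.isTiling.chained

theorem Iso.near {u v : PointedTiling K} (h : Iso u v) (R : ℝ) : u.L.Near v.L u.x v.x R 0 := by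
  obtain ⟨φ, h1, h2, h3⟩ := h
  have k1 : ∀ t, ∃ t', ∃ g : pentagon ≃ᵢ pentagon, ∀ p, φ (u.L.pt t p) = v.L.pt t' (g p) :=
    fun t => by
      obtain ⟨t', g, hg⟩ := h1 t
      exact ⟨t', g, fun p => (hg p).1⟩
  have k2 : ∀ t, ∃ t', ∃ g : pentagon ≃ᵢ pentagon, ∀ p, φ.symm (v.L.pt t p) = u.L.pt t' (g p) :=
    fun t => by
      obtain ⟨t', g, hg⟩ := h2 t
      exact ⟨t', g, fun p => (hg p).1⟩
  refine ⟨φ, fun y _ z _ => affDist_map_equiv φ k1 k2 y z, fun t _ => ?_,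
    fun w _ _ => degree_map_equiv φ k1 k2 w, ?_⟩
  · obtain ⟨t', g, hg⟩ := h1 t
    exact ⟨t', g, fun p _ => (hg p).1, fun p => (hg p).2⟩
  · rw [h3]
    exact (affDist_self _).le

/-- An isomorphism is an admissible map for every radius, with displacement 0, so composing with it
changes neither parameter. Hence `hullLambda` can be tested on arbitrary representatives. -/
theorem near_congr {u u' v v' : PointedTiling K} (hu : Iso u u') (hv : Iso v v') {ε : ℝ}
    (hε : 0 < ε) (h : u.L.NearMap v.L u.x v.x ε) : u'.L.NearMap v'.L u'.x v'.x ε := by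
  have h0 : 0 ≤ 1 / ε := (one_div_pos.2 hε).le
  have h1 := (hu.symm.near (1 / ε)).trans (nearMap_iff.1 h) u.chained v.chained h0 le_rfl
    (add_zero _).le
  have h2 := h1.trans (hv.near (1 / ε + (0 + ε))) v.chained v'.chained h0 le_rfl le_rfl
  rwa [add_zero, zero_add] at h2

theorem mem_hullLambda {u v : PointedTiling K} {ε : ℝ} :
    ε ∈ hullLambda (Quotient.mk (isoSetoid K) u) (Quotient.mk (isoSetoid K) v) ↔
      0 < ε ∧ u.L.NearMap v.L u.x v.x ε ∧ v.L.NearMap u.L v.x u.x ε := by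
  constructor
  · rintro ⟨h0, u', v', hu, hv, h1, h2⟩
    have hu : Iso u' u := Quotient.exact hu
    have hv : Iso v' v := Quotient.exact hv
    exact ⟨h0, near_congr hu hv h0 h1, near_congr hv hu h0 h2⟩
  · rintro ⟨h0, h1, h2⟩
    exact ⟨h0, u, v, rfl, rfl, h1, h2⟩

end PointedTiling

/-! ### Symmetry and the triangle inequality -/

section HullDist
open PentComplex DecComplex PointedTiling

variable {A : Type} {K : DecComplex A}

theorem bddBelow_hullLambda (a b : ContinuousHull K) :
    BddBelow (insert (1 / Real.sqrt 2) (hullLambda a b)) := by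
  refine ⟨0, ?_⟩
  rintro ε (rfl | h)
  · positivity
  · exact h.1.le

theorem hullDist_le_of_mem {a b : ContinuousHull K} {ε : ℝ} (h : ε ∈ hullLambda a b) :
    hullDist a b ≤ ε := csInf_le (bddBelow_hullLambda a b) (Or.inr h)

theorem hullDist_le (a b : ContinuousHull K) : hullDist a b ≤ 1 / Real.sqrt 2 :=
  csInf_le (bddBelow_hullLambda a b) (Or.inl rfl)

theorem hullDist_nonneg (a b : ContinuousHull K) : 0 ≤ hullDist a b := by
  refine Real.sInf_nonneg ?_
  rintro ε (rfl | h)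
  · positivity
  · exact h.1.le

theorem exists_mem_of_hullDist_lt {a b : ContinuousHull K} {r : ℝ} (h : hullDist a b < r)
    (hr : r ≤ 1 / Real.sqrt 2) : ∃ ε ∈ hullLambda a b, ε < r := by
  obtain ⟨ε, hε | hε, hlt⟩ := exists_lt_of_csInf_lt ⟨_, Set.mem_insert _ _⟩ h
  · exact absurd (hε ▸ hlt) (not_lt.2 hr)
  · exact ⟨ε, hε, hlt⟩

theorem hullLambda_comm (a b : ContinuousHull K) : hullLambda a b = hullLambda b a := by
  ext ε
  constructor
  · rintro ⟨h0, u, v, hu, hv, h1, h2⟩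
    exact ⟨h0, v, u, hv, hu, h2, h1⟩
  · rintro ⟨h0, u, v, hu, hv, h1, h2⟩
    exact ⟨h0, v, u, hv, hu, h2, h1⟩

theorem hullDist_comm (a b : ContinuousHull K) : hullDist a b = hullDist b a := by
  rw [hullDist, hullDist, hullLambda_comm]

theorem hullDist_self (a : ContinuousHull K) : hullDist a a = 0 := by
  obtain ⟨u, rfl⟩ := Quotient.exists_rep a
  refine le_antisymm (le_of_forall_pos_le_add fun ε hε => ?_) (hullDist_nonneg _ _)
  rw [zero_add]
  have h : u.L.NearMap u.L u.x u.x ε := (Near.refl u.x (1 / ε)).mono le_rfl hε.le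
  exact hullDist_le_of_mem (mem_hullLambda.2 ⟨hε, h, h⟩)

/-- To compose the maps on the ball of radius 1/(ε + ε') one needs 1/(ε + ε') + ε ≤ 1/ε', that is,
ε'(ε + ε') ≤ 1, and the same with ε and ε' exchanged. The cap 1/√2 guarantees more than this, (ε +
ε')² ≤ 1/2. -/
theorem add_mem_hullLambda {a b c : ContinuousHull K} {ε ε' : ℝ} (h : ε ∈ hullLambda a b)
    (h' : ε' ∈ hullLambda b c) (hlt : ε + ε' ≤ 1 / Real.sqrt 2) :
    ε + ε' ∈ hullLambda a c := by
  obtain ⟨u, rfl⟩ := Quotient.exists_rep a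
  obtain ⟨v, rfl⟩ := Quotient.exists_rep b
  obtain ⟨w, rfl⟩ := Quotient.exists_rep c
  obtain ⟨h0, h1, h2⟩ := mem_hullLambda.1 h
  obtain ⟨h0', h1', h2'⟩ := mem_hullLambda.1 h'
  have hs : (ε + ε') * (ε + ε') ≤ 1 := by
    have h3 : (ε + ε') * (ε + ε') ≤ 1 / Real.sqrt 2 * (1 / Real.sqrt 2) :=
      mul_le_mul hlt hlt (by linarith) (by positivity)
    rw [div_mul_div_comm, Real.mul_self_sqrt (by norm_num)] at h3
    linarith
  have aux : ∀ x y : ℝ, 0 < x → 0 < y → (x + y) * (x + y) ≤ 1 →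
      1 / (x + y) + x ≤ 1 / y ∧ 1 / (x + y) ≤ 1 / x := by
    intro x y hx hy hxy
    constructor
    · rw [div_add' _ _ _ (by linarith), div_le_div_iff₀ (by linarith) hy]
      have h1 : y * (x + y) ≤ 1 := (mul_le_mul_of_nonneg_right (by linarith) (by linarith)).trans hxy
      have h2 := mul_le_mul_of_nonneg_left h1 hx.le
      linarith
    · exact one_div_le_one_div_of_le hx (by linarith)
  have hp : 0 ≤ 1 / (ε + ε') := one_div_nonneg.2 (by linarith)
  refine mem_hullLambda.2 ⟨by linarith, ?_, ?_⟩
  · obtain ⟨e1, e2⟩ := aux ε ε' h0 h0' hs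
    exact Near.trans h1 h1' v.chained w.chained hp e2 e1
  · obtain ⟨e1, e2⟩ := aux ε' ε h0' h0 (by rwa [add_comm ε'])
    rw [add_comm ε] at hp ⊢
    exact Near.trans h2' h2 v.chained u.chained hp e2 e1

theorem hullDist_triangle (a b c : ContinuousHull K) :
    hullDist a c ≤ hullDist a b + hullDist b c := by
  rcases le_or_gt (1 / Real.sqrt 2) (hullDist a b + hullDist b c) with h | h
  · exact (hullDist_le a c).trans h
  refine le_of_forall_pos_le_add fun η hη => ?_
  -- The second bound keeps both distances, enlarged by `η'`, and also the sum of the two, below the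
  -- cap. There the distances are approximated by members of `hullLambda`.
  set η' := min (η / 2) ((1 / Real.sqrt 2 - (hullDist a b + hullDist b c)) / 2) with hη'
  have hpos : 0 < η' := lt_min (by linarith) (by linarith)
  have e1 : η' ≤ η / 2 := min_le_left _ _
  have e2 : η' ≤ (1 / Real.sqrt 2 - (hullDist a b + hullDist b c)) / 2 := min_le_right _ _
  have h1 := hullDist_nonneg a b
  have h2 := hullDist_nonneg b c
  obtain ⟨ε, hε, hlt⟩ := exists_mem_of_hullDist_lt (a := a) (b := b) (r := hullDist a b + η') (by linarith)
    (by linarith)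
  obtain ⟨ε', hε', hlt'⟩ := exists_mem_of_hullDist_lt (a := b) (b := c) (r := hullDist b c + η') (by linarith)
    (by linarith)
  exact (hullDist_le_of_mem (add_mem_hullLambda hε hε' (by linarith))).trans (by linarith)

end HullDist

/-- The pigeonhole principle that takes the place of passing to subsequences. -/
theorem Ultrafilter.exists_eventually_eq {ι α : Type*} (U : Ultrafilter ι) {s : Set α}
    (hs : s.Finite) {f : ι → α} (h : ∀ᶠ n in U, f n ∈ s) : ∃ a ∈ s, ∀ᶠ n in U, f n = a := by
  have h1 : ∀ᶠ n in (U : Filter ι), ∃ a ∈ s, f n = a := h.mono fun n hn => ⟨f n, hn, rfl⟩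
  exact (U.eventually_exists_mem_iff hs).1 h1

/-! ### Inverses, distances and degrees for embeddings of balls -/

namespace PentComplex
open Pentagon

variable {X Y : PentComplex}

theorem exists_edge_image_eq {φ : X.Realization → Y.Realization} {t : X.Tile} {t' : Y.Tile}
    {g : pentagon ≃ᵢ pentagon} (h : ∀ p, φ (X.pt t p) = Y.pt t' (g p)) (j : ZMod 5) :
    ∃ i, φ '' X.edge t i = Y.edge t' j := by
  obtain ⟨i, hi | hi⟩ := exists_sidePt_of_isometry g.symm j <;>
    simp only [IsometryEquiv.symm_apply_eq] at hi <;> refine ⟨i, ?_⟩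
  · rw [edge, edge, ← Set.range_comp]
    congr 1
    funext s
    rw [Function.comp_apply, h, hi]
  · rw [edge, edge, ← Set.range_comp, ← unitInterval.symm_bijective.surjective.range_comp]
    congr 1
    funext s
    rw [Function.comp_apply, Function.comp_apply, h, hi]

namespace TileEmb

variable {P : Set X.Tile} {τ : X.Tile → Y.Tile} {g : X.Tile → pentagon ≃ᵢ pentagon}

/-- The inverse is defined on a whole ball because an embedding maps a ball of a complete complex
onto a ball. -/
theorem exists_inverse (h : X.TileEmb Y P τ g) (hX : X.Regular) (hC : X.Complete)
    (hY : Y.Regular) {t : X.Tile} {k : ℕ} (hP : P = X.tball t k) :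
    ∃ τ' : Y.Tile → X.Tile, Y.TileEmb X (Y.tball (τ t) k) τ' (fun u => (g (τ' u)).symm) ∧
      (∀ u ∈ P, τ' (τ u) = u) ∧ ∀ u ∈ Y.tball (τ t) k, τ' u ∈ P ∧ τ (τ' u) = u := by
  classical
  have key : ∀ u', ∃ u, u' ∈ Y.tball (τ t) k → u ∈ P ∧ τ u = u' := by
    intro u'
    by_cases hu' : u' ∈ Y.tball (τ t) k
    · obtain ⟨u, hu, e⟩ := h.exists_of_mem_tball hX hC hY hP.ge hu'
      exact ⟨u, fun _ => ⟨hP ▸ hu, e⟩⟩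
    · exact ⟨t, fun h => absurd h hu'⟩
  choose τ' hτ' using key
  refine ⟨τ', fun u hu w hw p q => ?_, fun u hu => ?_, hτ'⟩
  · obtain ⟨h1, h2⟩ := hτ' u hu
    obtain ⟨h3, h4⟩ := hτ' w hw
    rw [h _ h1 _ h3, h2, h4, IsometryEquiv.apply_symm_apply, IsometryEquiv.apply_symm_apply]
  · obtain ⟨h1, h2⟩ := hτ' (τ u) (h.mem_tball hP.ge (hP ▸ hu))
    exact h.injOn h1 hu h2

/-- Embeddings of patches do not increase distances in the interior of the patch. -/
theorem _root_.PentComplex.Chained.affDist_map_le (hch : X.Chained) {φ : X.Realization → Y.Realization}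
    (hφ : ∀ t ∈ P, ∀ p, φ (X.pt t p) = Y.pt (τ t) (g t p)) {f : X.Realization → ℝ}
    (hf : X.TileLipschitz f) {R : ℝ} (hfP : ∀ t p, f (X.pt t p) ≤ 3 * R + 1 → t ∈ P)
    {y z : X.Realization} (hy : f y ≤ R) (hyz : X.affDist y z ≤ 2 * R) :
    Y.affDist (φ y) (φ z) ≤ X.affDist y z := by
  refine le_of_forall_pos_le_add fun η hη => ?_
  have hη' : 0 < min η 1 := lt_min hη one_pos
  -- Such a path is shorter than 2R + 1 and starts where `f` is at most `R`. So it stays where `f`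
  -- is at most 3R + 1, inside the tiles of `P`.
  obtain ⟨s, hs, hpath⟩ := hch.exists_path_lt
    (show X.affDist y z < X.affDist y z + min η 1 by linarith)
  have h1 := min_le_left η 1
  have h2 := min_le_right η 1
  have := hpath.map (S := P) (fun t ht => ⟨τ t, g t, hφ t ht⟩) hf hfP (by linarith)
  exact this.affDist_le.trans (by linarith)

/-- All tiles at the point are in `P`, and by `exists_touch` all tiles at the image point are images
of such tiles. So `φ` matches the edges at the two points. -/
theorem degree_eq (h : X.TileEmb Y P τ g) (hX : X.Regular) (hC : X.Complete) (hY : Y.Regular)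
    {φ : X.Realization → Y.Realization} (hφ : ∀ t ∈ P, ∀ p, φ (X.pt t p) = Y.pt (τ t) (g t p))
    {t : X.Tile} (ht : ∀ u, X.Touch t u → u ∈ P) (p : pentagon) :
    Y.degree (φ (X.pt t p)) = X.degree (X.pt t p) := by
  have hinj : Set.InjOn φ {x | ∃ u ∈ P, ∃ q, x = X.pt u q} := by
    rintro _ ⟨u, hu, q, rfl⟩ _ ⟨w, hw, q', rfl⟩ e
    rw [hφ u hu, hφ w hw] at e
    exact (h u hu w hw q q').2 e
  have hmem : ∀ u i, X.pt t p ∈ X.edge u i → u ∈ P := by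
    rintro u i ⟨s, hs⟩
    exact ht u ⟨_, _, hs.symm⟩
  have hsub : ∀ u ∈ P, ∀ i, X.edge u i ⊆ {x | ∃ u ∈ P, ∃ q, x = X.pt u q} := by
    rintro u hu i _ ⟨s, rfl⟩
    exact ⟨u, hu, _, rfl⟩
  have himg : {e : Set Y.Realization | (∃ t i, e = Y.edge t i) ∧ φ (X.pt t p) ∈ e} =
      Set.image φ '' {e | (∃ t i, e = X.edge t i) ∧ X.pt t p ∈ e} := by
    ext e
    constructor
    · rintro ⟨⟨u', j, rfl⟩, hv⟩
      have htouch : Y.Touch (τ t) u' := by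
        obtain ⟨s, hs⟩ := hv
        rw [hφ t (ht t (Touch.refl t))] at hs
        exact ⟨_, _, hs.symm⟩
      obtain ⟨u, hu, rfl⟩ := h.exists_touch hX hC hY ht htouch
      obtain ⟨i, hi⟩ := exists_edge_image_eq (hφ u (ht u hu)) j
      refine ⟨X.edge u i, ⟨⟨u, i, rfl⟩, ?_⟩, hi⟩
      rw [← hi] at hv
      obtain ⟨y, hy, e⟩ := hv
      rwa [← hinj (hsub u (ht u hu) i hy) ⟨t, ht t (Touch.refl t), p, rfl⟩ e]
    · rintro ⟨_, ⟨⟨u, i, rfl⟩, hv⟩, rfl⟩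
      obtain ⟨j, hj⟩ := exists_image_edge (hφ u (hmem u i hv)) i
      exact ⟨⟨τ u, j, hj⟩, _, hv, rfl⟩
  rw [degree, degree, himg, Set.InjOn.ncard_image]
  rintro _ ⟨⟨u, i, rfl⟩, hu⟩ _ ⟨⟨w, j, rfl⟩, hw⟩ e
  exact (hinj.image_eq_image_iff (hsub u (hmem u i hu) i) (hsub w (hmem w j hw) j)).1 e

end TileEmb

end PentComplex

/-! ### Embeddings of large patches are admissible maps -/

namespace DecComplex
open PentComplex Pentagon

variable {A : Type} {L M : DecComplex A}

/-- The embedding of a large patch is an admissible map. -/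
theorem DecEmb.near {τ : L.Tile → M.Tile} {g : L.Tile → pentagon ≃ᵢ pentagon} {t : L.Tile}
    {k : ℕ} (h : L.DecEmb M (L.tball t k) τ g) (hL : L.Regular) (hLC : L.Complete)
    (hLch : L.Chained) (hM : M.Regular) (hMch : M.Chained) {R δ : ℝ} (hR : 0 ≤ R)
    (hk : ⌈2 * (3 * R + 1)⌉₊ + 6 ≤ k) {p q : pentagon} (hδ : dist (g t p) q ≤ δ) :
    L.Near M (L.pt t p) (M.pt (τ t) q) R δ := by
  have hE : L.toPentComplex.TileEmb M.toPentComplex (L.tball t k) τ g := h.1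
  -- An embedding does not increase distances inside the patch; the opposite inequality is the same
  -- fact for the inverse embedding.
  obtain ⟨τ', h', hl, hr⟩ := hE.exists_inverse hL hLC hM rfl
  obtain ⟨φ, hφ⟩ := hE.exists_map
  obtain ⟨ψ, hψ⟩ := h'.exists_map
  obtain ⟨f, f1, f2, f3⟩ := hLch.exists_control t
  obtain ⟨f', f1', f2', f3'⟩ := hMch.exists_control (τ t)
  -- The radius `k - 1` keeps one layer of tiles in reserve: for the degree of a vertex all tiles
  -- that touch a tile at the vertex must be in the patch.
  have hfP : ∀ u p, f (L.pt u p) ≤ 3 * R + 1 → u ∈ L.tball t (k - 1) := fun u p hp =>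
    tball_mono t (by omega) (f3 u p _ hp)
  have hfP' : ∀ u p, f' (M.pt u p) ≤ 3 * R + 1 → u ∈ M.tball (τ t) k := fun u p hp =>
    tball_mono (τ t) (by omega) (f3' u p _ hp)
  have hk1 : L.tball t (k - 1) ⊆ L.tball t k := tball_mono t (Nat.sub_le _ _)
  have hball : ∀ y ∈ L.ball (L.pt t p) R, f y ≤ R := by
    intro y hy
    have h1 := f1.abs_sub_le hLch y (L.pt t p)
    rw [affDist_comm y (L.pt t p)] at h1
    have h2 : L.affDist (L.pt t p) y ≤ R := hy
    linarith [le_abs_self (f y - f (L.pt t p)), f2 p]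
  have hdist : ∀ y ∈ L.ball (L.pt t p) R, ∀ z ∈ L.ball (L.pt t p) R, L.affDist y z ≤ 2 * R := by
    intro y hy z hz
    have h1 := hLch.affDist_triangle y (L.pt t p) z
    rw [affDist_comm y (L.pt t p)] at h1
    have h2 : L.affDist (L.pt t p) y ≤ R := hy
    have h3 : L.affDist (L.pt t p) z ≤ R := hz
    linarith
  have hψφ : ∀ y, f y ≤ R → ψ (φ y) = y := by
    intro y hy
    obtain ⟨u, q, rfl⟩ := y.exists_pt
    have hu := hk1 (hfP u q (by linarith))
    rw [hφ u hu, hψ _ (hE.mem_tball le_rfl hu), hl u hu, IsometryEquiv.symm_apply_apply]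
  have hle : ∀ y ∈ L.ball (L.pt t p) R, ∀ z ∈ L.ball (L.pt t p) R,
      M.affDist (φ y) (φ z) ≤ L.affDist y z := fun y hy z hz =>
    hLch.affDist_map_le hφ f1 (fun u p hp => hk1 (hfP u p hp)) (hball y hy) (hdist y hy z hz)
  have hx : L.pt t p ∈ L.ball (L.pt t p) R := (affDist_self _).le.trans hR
  have htk : t ∈ L.tball t k := mem_tball_self t k
  refine ⟨φ, fun y hy z hz => le_antisymm (hle y hy z hz) ?_, fun u ⟨q, hq⟩ => ?_,
    fun v hv _ => ?_, ?_⟩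
  · have h1 : f' (φ y) ≤ R := by
      have h2 := f1'.abs_sub_le hMch (φ y) (φ (L.pt t p))
      have h3 := (hle y hy _ hx)
      rw [hφ t htk] at h2 h3
      have h4 : L.affDist (L.pt t p) y ≤ R := hy
      rw [affDist_comm y (L.pt t p)] at h3
      linarith [le_abs_self (f' (φ y) - f' (M.pt (τ t) (g t p))), f2' (g t p)]
    have h2 := hMch.affDist_map_le hψ f1' hfP' h1
      ((hle y hy z hz).trans (hdist y hy z hz))
    rwa [hψφ y (hball y hy), hψφ z (hball z hz)] at h2
  · have hu := hk1 (hfP u q (by linarith [hball _ hq]))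
    exact ⟨τ u, g u, fun q _ => hφ u hu q, h.2 u hu⟩
  · obtain ⟨u, q, rfl⟩ := v.exists_pt
    have hu := hfP u q (by linarith [hball _ hv])
    refine hE.degree_eq hL hLC hM hφ (fun w hw => ?_) q
    have := tball_add hu hw.mem_tball
    rwa [Nat.sub_add_cancel (by omega)] at this
  · rw [hφ t htk]
    exact (affDist_pt_le _ _ _).trans hδ

theorem DecEmb.exists_inverse {τ : L.Tile → M.Tile} {g : L.Tile → pentagon ≃ᵢ pentagon}
    {t : L.Tile} {k : ℕ} (h : L.DecEmb M (L.tball t k) τ g) (hL : L.Regular) (hLC : L.Complete)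
    (hM : M.Regular) : ∃ τ' : M.Tile → L.Tile,
      M.DecEmb L (M.tball (τ t) k) τ' (fun u => (g (τ' u)).symm) ∧ τ' (τ t) = t := by
  have hE : L.toPentComplex.TileEmb M.toPentComplex (L.tball t k) τ g := h.1
  obtain ⟨τ', h', hl, hr⟩ := hE.exists_inverse hL hLC hM rfl
  refine ⟨τ', ⟨h', fun u hu p => ?_⟩, hl t (mem_tball_self t k)⟩
  obtain ⟨h1, h2⟩ := hr u hu
  have h3 := h.2 _ h1 ((g (τ' u)).symm p)
  rw [IsometryEquiv.apply_symm_apply, h2] at h3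
  exact h3.symm

end DecComplex

/-! ### Definiteness of the distance -/

namespace PointedTiling
open PentComplex DecComplex Pentagon

variable {A : Type} {deco : tilingK.Tile → pentagon → A}

theorem regular (u : PointedTiling (decoratedK deco)) : u.L.Regular :=
  tilingK_regular.of_tileEmb fun P => by
    obtain ⟨τ, g, h⟩ := u.locIso.exists_decEmb P
    exact ⟨τ, g, h.1⟩

theorem complete (u : PointedTiling (decoratedK deco)) : u.L.Complete :=
  u.isTiling.complete u.regular

/-- Pointed tilings with admissible maps between arbitrarily large balls are isomorphic. -/
theorem iso_of_forall_near {u v : PointedTiling (decoratedK deco)}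
    (h : ∀ m : ℕ, u.L.Near v.L u.x v.x (m + 1) (1 / (m + 1))) : Iso u v := by
  obtain ⟨u₀, q₀, hq₀⟩ := v.x.exists_pt
  choose φ h1 h2 h3 h4 using h
  -- The maps `φ m` for different `m` need not be compatible; along a nonprincipal ultrafilter the
  -- image of every tile stabilizes.
  let U : Ultrafilter ℕ := Filter.hyperfilter ℕ
  have hU : ∀ N : ℕ, ∀ᶠ m in U, N ≤ m := fun N =>
    Nat.hyperfilter_le_atTop (Filter.eventually_ge_atTop N)
  have key : ∀ (m : ℕ) t, ∃ (t' : v.L.Tile) (g : pentagon ≃ᵢ pentagon),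
      (∃ p, u.L.pt t p ∈ u.L.ball u.x (m + 1)) →
        (∀ p, u.L.pt t p ∈ u.L.ball u.x (m + 1) → φ m (u.L.pt t p) = v.L.pt t' (g p)) ∧
        ∀ p, v.L.deco t' (g p) = u.L.deco t p := by
    intro m t
    by_cases ht : ∃ p, u.L.pt t p ∈ u.L.ball u.x (m + 1)
    · obtain ⟨t', g, e⟩ := h2 m t ht
      exact ⟨t', g, fun _ => e⟩
    · exact ⟨u₀, IsometryEquiv.refl _, fun h => absurd h ht⟩
  choose τ g hτ using key
  have hball : ∀ t, ∀ᶠ m : ℕ in U, ∀ p, u.L.pt t p ∈ u.L.ball u.x (m + 1) := by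
    intro t
    filter_upwards [hU ⌈u.L.affDist u.x (u.L.pt t centre) + 2⌉₊] with m hm p
    have e1 := u.chained.affDist_triangle u.x (u.L.pt t centre) (u.L.pt t p)
    have e2 := (affDist_pt_le (L := u.L.toPentComplex) t centre p).trans (dist_le_two _ _)
    have e3 := Nat.ceil_le.1 hm
    change u.L.affDist u.x (u.L.pt t p) ≤ m + 1
    linarith
  have hx : ∀ m : ℕ, u.x ∈ u.L.ball u.x (m + 1) := fun m =>
    (affDist_self u.x).le.trans (by positivity)
  obtain ⟨f, f1, f2, f3⟩ := v.chained.exists_control u₀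
  -- `φ m` is isometric and moves `u.x` to within 1 of `v.x`, so the centre of `t` stays within `D +
  -- 1` of `v.x`. Only finitely many tiles come so close, and the pentagon has finitely many
  -- isometries.
  have hlim : ∀ t, ∃ a : v.L.Tile × (pentagon ≃ᵢ pentagon),
      ∀ᶠ m in U, (τ m t, g m t) = a := by
    intro t
    set D := u.L.affDist u.x (u.L.pt t centre) with hD
    have hfin : ((v.L.tball u₀ (⌈2 * (D + 1)⌉₊ + 5)) ×ˢ
        (Set.univ : Set (pentagon ≃ᵢ pentagon))).Finite :=
      (v.regular.finite_tball _ _).prod Set.finite_univ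
    obtain ⟨a, -, ha⟩ := U.exists_eventually_eq hfin (f := fun m => (τ m t, g m t)) (by
      filter_upwards [hball t] with m hm
      refine ⟨f3 _ (g m t centre) _ ?_, Set.mem_univ _⟩
      rw [← (hτ m t ⟨centre, hm centre⟩).1 centre (hm centre)]
      have e1 := f1.abs_sub_le v.chained (φ m (u.L.pt t centre)) v.x
      have e2 := v.chained.affDist_triangle (φ m (u.L.pt t centre)) (φ m u.x) v.x
      rw [h1 m _ (hm centre) _ (hx m), affDist_comm (u.L.pt t centre) u.x] at e2
      have e3 : (1 : ℝ) / (m + 1) ≤ 1 := by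
        rw [div_le_one (by positivity)]
        linarith [(Nat.cast_nonneg m : (0 : ℝ) ≤ m)]
      have e4 := h4 m
      have e5 : f v.x ≤ 0 := hq₀ ▸ f2 q₀
      linarith [le_abs_self (f (φ m (u.L.pt t centre)) - f v.x)])
    exact ⟨a, ha⟩
  choose a ha using hlim
  have ha' : ∀ t, ∀ᶠ m : ℕ in U, (∀ p, u.L.pt t p ∈ u.L.ball u.x (m + 1) ∧
      φ m (u.L.pt t p) = v.L.pt (a t).1 ((a t).2 p)) ∧
      ∀ p, v.L.deco (a t).1 ((a t).2 p) = u.L.deco t p := by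
    intro t
    filter_upwards [hball t, ha t] with m hm e
    have h5 := hτ m t ⟨centre, hm centre⟩
    rw [← e]
    exact ⟨fun p => ⟨hm p, h5.1 p (hm p)⟩, h5.2⟩
  have hE : u.L.toPentComplex.TileEmb v.L.toPentComplex Set.univ (fun t => (a t).1)
      (fun t => (a t).2) := by
    intro t _ w _ p q
    obtain ⟨m, hm, hm'⟩ := ((ha' t).and (ha' w)).exists
    have e := h1 m _ (hm.1 p).1 _ (hm'.1 q).1
    rw [(hm.1 p).2, (hm'.1 q).2] at e
    constructor
    · intro h
      refine v.regular.eq_of_affDist_eq_zero v.chained ?_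
      rw [e, h, affDist_self]
    · intro h
      refine u.regular.eq_of_affDist_eq_zero u.chained ?_
      rw [← e, h, affDist_self]
  have hdec : ∀ t p, v.L.deco (a t).1 ((a t).2 p) = u.L.deco t p := fun t => by
    obtain ⟨m, hm⟩ := (ha' t).exists
    exact hm.2
  obtain ⟨Φ, hΦ⟩ := hE.exists_map
  have hΦ : ∀ t p, Φ (u.L.pt t p) = v.L.pt (a t).1 ((a t).2 p) := fun t => hΦ t (Set.mem_univ t)
  obtain ⟨t₀, p₀, hp₀⟩ := u.x.exists_pt
  -- With `P` the whole complex, every ball around an image tile consists of image tiles, and `v.L`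
  -- is connected.
  have hsurj : ∀ t', ∃ t, (a t).1 = t' := by
    intro t'
    obtain ⟨k, hk⟩ := v.chained (a t₀).1 t'
    obtain ⟨t, -, ht⟩ := hE.exists_of_mem_tball u.regular u.complete v.regular
      (Set.subset_univ _) hk
    exact ⟨t, ht⟩
  have hbij : Function.Bijective Φ := by
    constructor
    · intro y z e
      obtain ⟨t, p, rfl⟩ := y.exists_pt
      obtain ⟨w, q, rfl⟩ := z.exists_pt
      rw [hΦ, hΦ] at e
      exact (hE t (Set.mem_univ t) w (Set.mem_univ w) p q).2 e
    · intro y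
      obtain ⟨t', p', rfl⟩ := y.exists_pt
      obtain ⟨t, rfl⟩ := hsurj t'
      exact ⟨u.L.pt t ((a t).2.symm p'), by rw [hΦ, IsometryEquiv.apply_symm_apply]⟩
  refine ⟨Equiv.ofBijective Φ hbij, fun t => ⟨(a t).1, (a t).2, fun p => ⟨hΦ t p, hdec t p⟩⟩,
    fun t' => ?_, ?_⟩
  · obtain ⟨t, rfl⟩ := hsurj t'
    refine ⟨t, (a t).2.symm, fun p => ⟨?_, ?_⟩⟩
    · rw [Equiv.symm_apply_eq]
      refine Eq.symm ((hΦ _ _).trans ?_)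
      rw [IsometryEquiv.apply_symm_apply]
    · rw [← hdec, IsometryEquiv.apply_symm_apply]
  -- For arbitrarily large `m` the limit map agrees at `u.x` with `φ m`, which moves this point to
  -- within 1/(m + 1) of `v.x`.
  · refine v.regular.eq_of_affDist_eq_zero v.chained (le_antisymm ?_ (affDist_nonneg _ _))
    refine le_of_forall_pos_le_add fun ε hε => ?_
    obtain ⟨N, hN⟩ := exists_nat_one_div_lt hε
    obtain ⟨m, hm, hm'⟩ := ((ha' t₀).and (hU N)).exists
    have e := h4 m
    rw [hp₀, (hm.1 p₀).2, ← hΦ, ← hp₀] at e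
    refine e.trans ?_
    have : (1 : ℝ) / (m + 1) ≤ 1 / (N + 1) := by
      refine one_div_le_one_div_of_le (by positivity) ?_
      have : (N : ℝ) ≤ m := by exact_mod_cast hm'
      linarith
    linarith

end PointedTiling

open PointedTiling in
theorem eq_of_hullDist_eq_zero {A : Type} {deco : PentComplex.tilingK.Tile → pentagon → A}
    {a b : ContinuousHull (decoratedK deco)} (h : hullDist a b = 0) : a = b := by
  obtain ⟨u, rfl⟩ := Quotient.exists_rep a
  obtain ⟨v, rfl⟩ := Quotient.exists_rep b
  refine Quotient.sound (iso_of_forall_near fun m => ?_)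
  have hpos : 0 < min ((1 : ℝ) / ((m : ℝ) + 1)) (1 / Real.sqrt 2) :=
    lt_min (by positivity) (by positivity)
  obtain ⟨ε, hε, hlt⟩ := exists_mem_of_hullDist_lt (h ▸ hpos) (min_le_right _ _)
  obtain ⟨h0, h1, -⟩ := mem_hullLambda.1 hε
  have h2 : ε ≤ 1 / (m + 1) := hlt.le.trans (min_le_left _ _)
  refine (DecComplex.nearMap_iff.1 h1).mono ?_ h2
  rw [le_div_iff₀ h0]
  rw [le_div_iff₀ (by positivity)] at h2
  linarith

/-- An ultrafilter decides every proposition; thus a relation in the limit becomes equivalent to the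
same relation in almost every term. -/
theorem Ultrafilter.eventually_iff_const {ι : Type*} (U : Ultrafilter ι) {a : Prop} {b : ι → Prop}
    (h : a ↔ ∀ᶠ n in U, b n) : ∀ᶠ n in U, (a ↔ b n) := by
  by_cases ha : a
  · exact (h.1 ha).mono fun n hn => iff_of_true ha hn
  · exact (Ultrafilter.eventually_not.2 (mt h.2 ha)).mono fun n hn => iff_of_false ha hn

/-! ### Limits of pointed complexes along an ultrafilter -/

namespace PentComplex
open Pentagon

section UltraLimit

variable {ι : Type} (U : Ultrafilter ι) (X : ι → PentComplex) (t : ∀ n, (X n).Tile)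

/-- The sequences of tiles at bounded combinatorial distance from the base tiles, up to
equality along the ultrafilter. -/
def ultraSetoid : Setoid {s : ∀ n, (X n).Tile // ∃ k, ∀ᶠ n in U, s n ∈ (X n).tball (t n) k} where
  r s s' := ∀ᶠ n in U, s.1 n = s'.1 n
  iseqv := ⟨fun _ => Filter.Eventually.of_forall fun _ => rfl, fun h => h.mono fun _ => Eq.symm,
    fun h h' => h.mp (h'.mono fun _ e e' => e'.trans e)⟩

/-- The tiles of the limit of a sequence of pointed complexes. -/
def UltraTile : Type := Quotient (ultraSetoid U X t)

variable {U X t}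

/-- A sequence of tiles that represents a tile of the limit. -/
def UltraTile.eval (T : UltraTile U X t) (n : ι) : (X n).Tile := (Quotient.out T).1 n

theorem UltraTile.bounded (T : UltraTile U X t) :
    ∃ k, ∀ᶠ n in U, T.eval n ∈ (X n).tball (t n) k := (Quotient.out T).2

theorem UltraTile.ext {T T' : UltraTile U X t} (h : ∀ᶠ n in U, T.eval n = T'.eval n) : T = T' := by
  have : (ultraSetoid U X t).r (Quotient.out T) (Quotient.out T') := h
  rw [← Quotient.out_eq T, ← Quotient.out_eq T']
  exact Quotient.sound this

theorem UltraTile.exists_eval {s : ∀ n, (X n).Tile}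
    (h : ∃ k, ∀ᶠ n in U, s n ∈ (X n).tball (t n) k) :
    ∃ T : UltraTile U X t, ∀ᶠ n in U, T.eval n = s n := by
  let a : {s : ∀ n, (X n).Tile // ∃ k, ∀ᶠ n in U, s n ∈ (X n).tball (t n) k} := ⟨s, h⟩
  have : (ultraSetoid U X t).r (Quotient.out (Quotient.mk (ultraSetoid U X t) a)) a :=
    Quotient.mk_out (s := ultraSetoid U X t) a
  exact ⟨Quotient.mk (ultraSetoid U X t) a, this⟩

theorem UltraTile.exists_eval_of_touch (T : UltraTile U X t) {s : ∀ n, (X n).Tile}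
    (h : ∀ᶠ n in U, (X n).Touch (T.eval n) (s n)) :
    ∃ T' : UltraTile U X t, ∀ᶠ n in U, T'.eval n = s n := by
  obtain ⟨k, hk⟩ := T.bounded
  refine UltraTile.exists_eval ⟨k + 1, ?_⟩
  filter_upwards [h, hk] with n h1 h2
  exact ⟨_, h2, h1⟩

variable (U X t)

/-- The limit of a sequence of pointed complexes along an ultrafilter. -/
abbrev ultraLimit : PentComplex where
  Tile := UltraTile U X t
  Glued T i T' j := ∀ᶠ n in U, (X n).Adj (T.eval n) i (T'.eval n) j

variable {U X t}

theorem ultraLimit_adj_iff {T T' : UltraTile U X t} {i j : ZMod 5} :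
    (ultraLimit U X t).Adj T i T' j ↔ ∀ᶠ n in U, (X n).Adj (T.eval n) i (T'.eval n) j := by
  refine ⟨?_, Or.inl⟩
  rintro (h | h)
  · exact h
  · exact h.mono fun n => Adj.symm

theorem ultraLimit_edgeRegular (hX : ∀ n, (X n).EdgeRegular) : (ultraLimit U X t).EdgeRegular := by
  intro T i T₁ j₁ T₂ j₂ h₁ h₂
  have h := ((ultraLimit_adj_iff.1 h₁).and (ultraLimit_adj_iff.1 h₂)).mono fun n hn =>
    hX n hn.1 hn.2
  obtain ⟨n, hn⟩ := h.exists
  exact ⟨UltraTile.ext (h.mono fun n hn => hn.1), hn.2⟩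

theorem IsTurn.exists_iterate_le {X : PentComplex} {τ : X.Tile × ZMod 5 → X.Tile × ZMod 5}
    (hτ : X.IsTurn τ) (hX : X.Regular) (hC : X.Complete) {a b : X.Tile × ZMod 5}
    (h : X.vert a.1 a.2 = X.vert b.1 b.2) : ∃ n ≤ 4, τ^[n] a = b := by
  classical
  obtain ⟨n, hn⟩ := hτ.exists_iterate hX hC h
  have hpos := Function.minimalPeriod_pos_of_mem_periodicPts (hτ.mem_periodicPts hX hC a)
  have hcard := hX.deg (X.vert a.1 a.2)
    ((Finset.range (Function.minimalPeriod τ a)).image fun n => τ^[n] a) (by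
      intro b hb
      obtain ⟨m, -, rfl⟩ := Finset.mem_image.1 hb
      exact hτ.iterate_vert hC a m)
  rw [Finset.card_image_of_injOn (by
    intro m hm m' hm' e
    exact Function.iterate_injOn_Iio_minimalPeriod (by simpa using hm) (by simpa using hm') e),
    Finset.card_range] at hcard
  refine ⟨n % Function.minimalPeriod τ a, (Nat.mod_lt n hpos).le.trans hcard, ?_⟩
  rw [Function.iterate_mod_minimalPeriod_eq, hn]

/-- Equality of vertices is a chain of gluings, and it passes to the limit because the chains have
bounded length: two corners at one vertex are at most four turns apart. So the number of turns can
be taken constant along `U`. -/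
theorem ultraLimit_vert_eq_iff (hX : ∀ n, (X n).Regular) (hC : ∀ n, (X n).Complete)
    {T T' : UltraTile U X t} {i j : ZMod 5} :
    (ultraLimit U X t).vert T i = (ultraLimit U X t).vert T' j ↔
      ∀ᶠ n in U, (X n).vert (T.eval n) i = (X n).vert (T'.eval n) j := by
  constructor
  · intro h
    replace h : Relation.EqvGen (ultraLimit U X t).CornerRel (T, i) (T', j) := Quot.eqvGen_exact h
    suffices ∀ a b : (ultraLimit U X t).Tile × ZMod 5, Relation.EqvGen (ultraLimit U X t).CornerRel a b →
        ∀ᶠ n in U, (X n).vert (a.1.eval n) a.2 = (X n).vert (b.1.eval n) b.2 from this _ _ h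
    intro a b h
    induction h with
    | rel a b h =>
      cases h with
      | left h => exact h.mono fun n => Adj.vert_left
      | right h => exact h.mono fun n => Adj.vert_right
    | refl a => exact Filter.Eventually.of_forall fun n => rfl
    | symm a b _ ih => exact ih.mono fun n => Eq.symm
    | trans a b c _ _ ih ih' => exact ih.mp (ih'.mono fun n e e' => e'.trans e)
  · intro h
    choose τ hτ using fun n => (hX n).exists_isTurn (hC n)
    have h1 : ∀ n, ∃ m, (X n).vert (T.eval n) i = (X n).vert (T'.eval n) j →
        m ≤ 4 ∧ (τ n)^[m] (T.eval n, i) = (T'.eval n, j) := by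
      intro n
      by_cases e : (X n).vert (T.eval n) i = (X n).vert (T'.eval n) j
      · obtain ⟨m, hm⟩ := (hτ n).exists_iterate_le (hX n) (hC n) (a := (T.eval n, i))
          (b := (T'.eval n, j)) e
        exact ⟨m, fun _ => hm⟩
      · exact ⟨0, fun h => absurd h e⟩
    choose m hm using h1
    obtain ⟨M, -, hM⟩ := U.exists_eventually_eq (Set.finite_Iic 4) (f := m)
      (h.mono fun n e => (hm n e).1)
    replace h : ∀ᶠ n in U, (τ n)^[M] (T.eval n, i) = (T'.eval n, j) := by
      filter_upwards [h, hM] with n e e'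
      rw [← e']
      exact (hm n e).2
    clear hM hm m
    induction M generalizing T i with
    | zero =>
      obtain ⟨n, hn⟩ := h.exists
      have e : T = T' := UltraTile.ext (h.mono fun n hn => (Prod.ext_iff.1 hn).1)
      rw [e, show i = j from (Prod.ext_iff.1 hn).2]
    -- The neighbours across side `i` touch `T`, so they represent a tile `S` of the limit, and the
    -- number of the side on which they are glued is constant along `U`. This performs one turn in
    -- the limit.
    | succ M ih =>
      choose s l hs e using fun n => (hτ n).exists_eq (hC n) (T.eval n, i)
      obtain ⟨S, hS⟩ := T.exists_eval_of_touch (Filter.Eventually.of_forall fun n => (hs n).touch)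
      obtain ⟨l', -, hl'⟩ := U.exists_eventually_eq (Set.finite_univ (α := ZMod 5)) (f := l)
        (Filter.Eventually.of_forall fun n => Set.mem_univ _)
      have hA : (ultraLimit U X t).Adj T i S l' := by
        refine ultraLimit_adj_iff.2 ?_
        filter_upwards [hS, hl'] with n e1 e2
        rw [e1, ← e2]
        exact hs n
      rw [hA.vert_left]
      refine ih ?_
      filter_upwards [hS, hl', h] with n e1 e2 e3
      rw [Function.iterate_succ_apply, e n, e2, ← e1] at e3
      exact e3

/-- Finite patches of the limit embed into almost all complexes of the sequence. -/
theorem ultraLimit_tileEmb (hX : ∀ n, (X n).Regular) (hC : ∀ n, (X n).Complete)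
    {P : Set (UltraTile U X t)} (hP : P.Finite) :
    ∀ᶠ n in U, (ultraLimit U X t).TileEmb (X n) P (fun T => T.eval n)
      (fun _ => IsometryEquiv.refl _) := by
  have hE : (ultraLimit U X t).EdgeRegular := ultraLimit_edgeRegular fun n => (hX n).edge
  have key : ∀ T T' : UltraTile U X t, ∀ᶠ n in U, ∀ p q,
      (ultraLimit U X t).pt T p = (ultraLimit U X t).pt T' q ↔
        (X n).pt (T.eval n) p = (X n).pt (T'.eval n) q := by
    intro T T'
    have h1 : ∀ᶠ n in U, (T = T' ↔ T.eval n = T'.eval n) :=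
      U.eventually_iff_const ⟨by rintro rfl; exact Filter.Eventually.of_forall fun _ => rfl,
        UltraTile.ext⟩
    have h2 : ∀ᶠ n in U, ∀ i j, ((ultraLimit U X t).Adj T i T' j ↔
        (X n).Adj (T.eval n) i (T'.eval n) j) :=
      Filter.eventually_all.2 fun i => Filter.eventually_all.2 fun j =>
        U.eventually_iff_const ultraLimit_adj_iff
    have h3 : ∀ᶠ n in U, ∀ i j, ((ultraLimit U X t).vert T i = (ultraLimit U X t).vert T' j ↔
        (X n).vert (T.eval n) i = (X n).vert (T'.eval n) j) :=
      Filter.eventually_all.2 fun i => Filter.eventually_all.2 fun j =>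
        U.eventually_iff_const (ultraLimit_vert_eq_iff hX hC)
    filter_upwards [h1, h2, h3] with n e1 e2 e3 p q
    rw [hE.pt_eq_iff, (hX n).edge.pt_eq_iff, Ident, Ident]
    refine or_congr (and_congr_left fun _ => e1) (or_congr ?_ ?_)
    · simp only [e2]
    · simp only [e3]
  have := (Filter.eventually_all_finite hP).2 fun T _ =>
    (Filter.eventually_all_finite hP).2 fun T' _ => key T T'
  exact this.mono fun n h T hT T' hT' => h T hT T' hT'

theorem ultraLimit_regular (hX : ∀ n, (X n).Regular) (hC : ∀ n, (X n).Complete) {Y : PentComplex}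
    (hY : Y.Regular) (h : ∀ (n : ι) (P : Finset (X n).Tile), ∃ τ g, (X n).TileEmb Y P τ g) :
    (ultraLimit U X t).Regular := by
  classical
  refine hY.of_tileEmb fun P => ?_
  obtain ⟨n, hn⟩ := (ultraLimit_tileEmb hX hC P.finite_toSet).exists
  obtain ⟨τ, g, H⟩ := h n (P.image fun T => T.eval n)
  refine ⟨fun T => τ (UltraTile.eval T n), fun T => g (UltraTile.eval T n), fun T hT T' hT' p q => ?_⟩
  rw [hn T hT T' hT', H _ (Finset.mem_image_of_mem _ hT) _ (Finset.mem_image_of_mem _ hT')]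
  rfl

theorem ultraLimit_complete (hC : ∀ n, (X n).Complete) : (ultraLimit U X t).Complete := by
  intro T i
  choose s l hs using fun n => hC n (UltraTile.eval T n) i
  obtain ⟨S, hS⟩ := UltraTile.exists_eval_of_touch T
    (Filter.Eventually.of_forall fun n => (hs n).touch)
  obtain ⟨l', -, hl'⟩ := U.exists_eventually_eq (Set.finite_univ (α := ZMod 5)) (f := l)
    (Filter.Eventually.of_forall fun n => Set.mem_univ _)
  refine ⟨S, l', ultraLimit_adj_iff.2 ?_⟩
  filter_upwards [hS, hl'] with n e1 e2
  rw [e1, ← e2]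
  exact hs n

/-- A chain of `k` steps is lifted step by step. The intermediate tiles stay at bounded distance
from the base tiles, and the pair of corners at which successive tiles meet is one of 25, hence
constant along `U`. -/
theorem ultraLimit_chained (hX : ∀ n, (X n).Regular) (hC : ∀ n, (X n).Complete) :
    (ultraLimit U X t).Chained := by
  obtain ⟨T₀, hT₀⟩ := UltraTile.exists_eval (U := U) (X := X) (t := t) (s := t)
    ⟨0, Filter.Eventually.of_forall fun n => mem_tball_self _ _⟩
  have key : ∀ (k : ℕ) (T : UltraTile U X t), (∀ᶠ n in U, T.eval n ∈ (X n).tball (t n) k) →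
      T ∈ (ultraLimit U X t).tball T₀ k := by
    intro k
    induction k with
    | zero =>
      intro T h
      refine UltraTile.ext ?_
      filter_upwards [hT₀, h] with n e1 e2
      exact Eq.trans e2 e1.symm
    | succ k ih =>
      intro T h
      have h1 : ∀ n, ∃ (u : (X n).Tile) (i j : ZMod 5), T.eval n ∈ (X n).tball (t n) (k + 1) →
          u ∈ (X n).tball (t n) k ∧ (X n).vert u i = (X n).vert (T.eval n) j := by
        intro n
        by_cases e : T.eval n ∈ (X n).tball (t n) (k + 1)
        · obtain ⟨u, hu, hT⟩ := e
          obtain ⟨i, j, hij⟩ := (hX n).edge.exists_vert_eq hT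
          exact ⟨u, i, j, fun _ => ⟨hu, hij⟩⟩
        · exact ⟨t n, 0, 0, fun h => absurd h e⟩
      choose u i j hu using h1
      obtain ⟨S, hS⟩ := UltraTile.exists_eval (U := U) (X := X) (t := t) (s := u)
        ⟨k, h.mono fun n hn => (hu n hn).1⟩
      obtain ⟨⟨i', j'⟩, -, hij⟩ := U.exists_eventually_eq (Set.finite_univ (α := ZMod 5 × ZMod 5))
        (f := fun n => (i n, j n)) (Filter.Eventually.of_forall fun n => Set.mem_univ _)
      refine ⟨S, ih S ?_, touch_of_vert_eq (i := i') (j := j')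
        ((ultraLimit_vert_eq_iff hX hC).2 ?_)⟩
      · filter_upwards [h, hS] with n e1 e2
        exact e2 ▸ (hu n e1).1
      · filter_upwards [h, hS, hij] with n e1 e2 e3
        obtain ⟨rfl, rfl⟩ := Prod.ext_iff.1 e3
        rw [e2]
        exact (hu n e1).2
  have key' : ∀ T : UltraTile U X t, ∃ k, T ∈ (ultraLimit U X t).tball T₀ k := fun T =>
    T.bounded.imp fun k => key k T
  intro T T'
  obtain ⟨k, hk⟩ := key' T
  obtain ⟨l, hl⟩ := key' T'
  exact ⟨k + l, tball_add (tball_symm hk) hl⟩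

end UltraLimit

end PentComplex

/-! ### Compactness of the hull -/

namespace PointedTiling
open PentComplex DecComplex Pentagon

variable {A : Type} {deco : tilingK.Tile → pentagon → A}

/-- The decorations of the tiles of all tilings of the hull form a finite set. -/
theorem exists_finite_deco (hdeco : (Set.range deco).Finite) :
    ∃ D : Set (pentagon → A), D.Finite ∧
      ∀ (u : PointedTiling (decoratedK deco)) (t : u.L.Tile), u.L.deco t ∈ D := by
  refine ⟨Set.image2 (fun d (g : pentagon ≃ᵢ pentagon) => d ∘ g) (Set.range deco) Set.univ,
    hdeco.image2 _ Set.finite_univ, fun u t => ?_⟩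
  obtain ⟨τ, g, h⟩ := u.locIso.exists_decEmb {t}
  exact ⟨deco (τ t), ⟨τ t, rfl⟩, g t, Set.mem_univ _, funext fun p => h.2 t (by simp) p⟩

/-- A sequence in the hull converges along every ultrafilter. -/
theorem exists_eventually_nearMap (hdeco : (Set.range deco).Finite) (U : Ultrafilter ℕ)
    (u : ℕ → PointedTiling (decoratedK deco)) :
    ∃ v : PointedTiling (decoratedK deco), ∀ ε > 0, ∀ᶠ n in U,
      (u n).L.NearMap v.L (u n).x v.x ε ∧ v.L.NearMap (u n).L v.x (u n).x ε := by
  classical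
  obtain ⟨D, hD, hdecoD⟩ := exists_finite_deco hdeco
  choose t p hx using fun n => (u n).x.exists_pt
  have hX : ∀ n, (u n).L.toPentComplex.Regular := fun n => (u n).regular
  have hC : ∀ n, (u n).L.toPentComplex.Complete := fun n => (u n).complete
  -- The decoration of a tile of the limit is the one that occurs almost everywhere among finitely
  -- many.
  choose d hdD hd using fun T : UltraTile U (fun n => (u n).L.toPentComplex) t =>
    U.exists_eventually_eq hD (f := fun n => (u n).L.deco (T.eval n))
      (Filter.Eventually.of_forall fun n => hdecoD (u n) _)
  let L : DecComplex A :=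
    { toPentComplex := ultraLimit U (fun n => (u n).L.toPentComplex) t
      deco := d }
  have hemb : ∀ P : Set L.Tile, P.Finite → ∀ᶠ n in U, L.DecEmb (u n).L P (fun T => UltraTile.eval T n)
      (fun _ => IsometryEquiv.refl _) := by
    intro P hP
    filter_upwards [ultraLimit_tileEmb hX hC hP, (Filter.eventually_all_finite hP).2 fun T _ => hd T]
      with n h1 h2
    exact ⟨h1, fun T hT p => congrFun (h2 T hT) p⟩
  have hL : L.Regular := ultraLimit_regular hX hC tilingK_regular fun n P => by
    obtain ⟨τ, g, h⟩ := (u n).locIso.exists_decEmb P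
    exact ⟨τ, g, h.1⟩
  have hLC : L.Complete := ultraLimit_complete hC
  have hLch : L.Chained := ultraLimit_chained hX hC
  have hloc : ∀ P : Finset L.Tile, ∃ τ g, L.DecEmb (decoratedK deco) P τ g := by
    intro P
    obtain ⟨n, h1, h2⟩ := (hemb P P.finite_toSet).exists
    obtain ⟨τ, g, h3, h4⟩ := (u n).locIso.exists_decEmb (P.image fun T => UltraTile.eval T n)
    refine ⟨fun T => τ (UltraTile.eval T n), fun T => g (UltraTile.eval T n),
      fun T hT T' hT' p q => ?_, fun T hT p => ?_⟩
    · rw [h1 T hT T' hT', h3 _ (Finset.mem_image_of_mem _ hT) _ (Finset.mem_image_of_mem _ hT')]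
      rfl
    · rw [h4 _ (Finset.mem_image_of_mem _ hT)]
      exact h2 T hT p
  obtain ⟨T₀, hT₀⟩ := UltraTile.exists_eval (U := U) (X := fun n => (u n).L.toPentComplex)
    (t := t) (s := t) ⟨0, Filter.Eventually.of_forall fun n => mem_tball_self _ _⟩
  -- The positions of the base points in their tiles converge along `U`, since the pentagon is
  -- compact.
  obtain ⟨q, -, hq⟩ := isCompact_univ.ultrafilter_le_nhds (U.map p) (by simp)
  replace hq : Filter.Tendsto p U (nhds q) := hq
  refine ⟨⟨L, isTiling_of_tileEmb hL hLC hLch T₀ fun P => ?_, locallyIsomorphic_of_decEmb hloc,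
    L.pt T₀ q⟩, fun ε hε => ?_⟩
  · obtain ⟨τ, g, h⟩ := hloc P
    exact ⟨τ, g, h.1⟩
  have hR : 0 ≤ 1 / ε := by positivity
  have hdist : ∀ᶠ n in U, dist q (p n) ≤ ε := by
    filter_upwards [hq.eventually (Metric.closedBall_mem_nhds q hε)] with n hn
    rwa [dist_comm]
  -- This combinatorial radius is what `DecEmb.near` requires for metric balls of radius 1/ε. The
  -- embedding and its inverse provide the two admissible maps.
  filter_upwards [hemb (L.tball T₀ (⌈2 * (3 * (1 / ε) + 1)⌉₊ + 6)) (hL.finite_tball _ _), hT₀, hdist]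
    with n h1 h2 h3
  have hch : (u n).L.Chained := (u n).chained
  obtain ⟨τ', h4, h5⟩ := h1.exists_inverse hL hLC (hX n)
  have near1 := h1.near hL hLC hLch (hX n) hch hR le_rfl (p := q) (q := p n) h3
  have near2 := h4.near (hX n) (hC n) hch hL hLch hR le_rfl (p := p n) (q := q) (δ := ε)
    (by rw [dist_comm]; exact h3)
  rw [h5] at near2
  rw [h2] at near1 near2
  rw [hx n, nearMap_iff, nearMap_iff]
  exact ⟨near2, near1⟩

end PointedTiling

/-- The continuous hull with the distance `hullDist`. -/
abbrev hullMetricSpace {A : Type} (deco : PentComplex.tilingK.Tile → pentagon → A) :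
    MetricSpace (ContinuousHull (decoratedK deco)) where
  dist := hullDist
  dist_self := hullDist_self
  dist_comm := hullDist_comm
  dist_triangle := hullDist_triangle
  eq_of_dist_eq_zero := eq_of_hullDist_eq_zero

/-- For a metric space sequential compactness suffices. The limit along a nonprincipal ultrafilter
is a cluster point of the sequence, hence the limit of a subsequence. -/
theorem compactSpace_hull {A : Type} {deco : PentComplex.tilingK.Tile → pentagon → A}
    (hdeco : (Set.range deco).Finite) :
    @CompactSpace (ContinuousHull (decoratedK deco))
      (hullMetricSpace deco).toPseudoMetricSpace.toUniformSpace.toTopologicalSpace := by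
  let := hullMetricSpace deco
  refine ⟨IsSeqCompact.isCompact fun x _ => ?_⟩
  choose u hu using fun n => Quotient.exists_rep (x n)
  obtain ⟨v, hv⟩ := PointedTiling.exists_eventually_nearMap hdeco (Filter.hyperfilter ℕ) u
  let a : ContinuousHull (decoratedK deco) := Quotient.mk (PointedTiling.isoSetoid _) v
  have hlim : Filter.Tendsto x (Filter.hyperfilter ℕ : Filter ℕ) (nhds a) := by
    refine Metric.nhds_basis_closedBall.tendsto_right_iff.2 fun ε hε => ?_
    filter_upwards [hv ε hε] with n hn
    rw [← hu n]
    exact hullDist_le_of_mem (PointedTiling.mem_hullLambda.2 ⟨hε, hn⟩)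
  have hcl : MapClusterPt a Filter.atTop x :=
    hlim.mapClusterPt.mono Nat.hyperfilter_le_atTop
  obtain ⟨ψ, hψ, h⟩ := hcl.tendsto_subseq
  exact ⟨a, Set.mem_univ a, ψ, hψ, h⟩
end

theorem theoremt {A : Type} (deco : PentComplex.tilingK.Tile → pentagon → A)
    (hdeco : (Set.range deco).Finite) :
    ∃ m : MetricSpace (ContinuousHull (decoratedK deco)),
      (∀ a b : ContinuousHull (decoratedK deco), m.dist a b = hullDist a b) ∧
      @CompactSpace (ContinuousHull (decoratedK deco))
        m.toPseudoMetricSpace.toUniformSpace.toTopologicalSpace :=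
  ⟨hullMetricSpace deco, fun _ _ => rfl, compactSpace_hull hdeco⟩
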